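/- Let $R=\mathbf Z_{(3)}$ be the localization of $\mathbf Z$ at the prime ideal $(3)$, and let $S_3$ be the symmetric group on three letters. *Double Burnside algebra.* For a finite group $G$, a finite $(G,G)$-biset is a finite set with commuting left and right $G$-actions. Let $\mathrm B_R(G,G)$ be the $R$-module freely generated by the isomorphism classes $[M]$ of finite $(G,G)$-bisets modulo the relations $[M\sqcup N]=[M]+[N]$. It is an $R$-algebra with multiplication $[M]\cdot[N]=[M\times_G N]$, where $M\times_G N$ is the set of orbits of $M\times N$ under $g(m,n)=(mg^{-1},gn)$, and with unit $[G]$. *The order $\Lambda_{(3)}$.* Let $R[\overline\eta,\overline\xi]=R[\eta,\xi]/(\eta^2,\eta\xi,\xi^2)$, and let $A_R$ be the $R$-module of block matrices $$\begin{bmatrix} s&0&0&t\\ 0&u&0&v\\ 0&0&w&0\\ x&y&0&z_1+z_2\overline\eta+z_3\overline\xi\end{bmatrix},\qquad s\in R^{3\times 3},\ t\in R^{3\times 1},\ x\in R^{1\times 3},\ u,v,w,y,z_1,z_2,z_3\in R .$$ It is an $R$-algebra under block matrix multiplication, with the following conventions for products of entries: $x\cdot t:=(xt)\,\overline\eta$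 and $y\cdot v:=yv\,(\overline\xi-12\overline\eta)$; an element $a+b\overline\eta+c\overline\xi$ acts on the entries $t,v$ (from the right) and $x,y$ (from the left) as multiplication by $a$; the products $t\cdot x,\ t\cdot y,\ v\cdot x,\ v\cdot y$ are zero; and all other products are the usual ones. Let $$\Lambda_{(3)}:=\{\text{elements of }A_R\ :\ x_1\equiv x_2\equiv x_3\equiv z_2\equiv 0 \bmod 3\},$$ an $R$-subalgebra of $A_R$. Regard elements of $A_R$ as $6\times 6$ matrices. For $i\in\{3,4,5,6\}$ let $e_i\in\Lambda_{(3)}$ be the element with single nonzero entry $1$ at position $(i,i)$. Let $\tau_1,\tau_2,\tau_3,\tau_4\in\Lambda_{(3)}$ be the elements whose single nonzero entry is, respectively, $3$ at position $(6,3)$, $1$ at position $(3,6)$, $1$ at position $(6,4)$, $1$ at position $(4,6)$. Put $\Lambda'_{(3)}:=(e_3+e_4+e_5+e_6)\,\Lambda_{(3)}\,(e_3+e_4+e_5+e_6)$; it contains all these $e_i$ and $\tau_i$. *The path algebra.* Let $\Psi$ be the quiver with vertices $\tilde e_3,\tilde e_4,\tilde e_5,\tilde e_6$ and arrows $\tilde\tau_1:\tilde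 e_6\to\tilde e_3$, $\tilde\tau_2:\tilde e_3\to\tilde e_6$, $\tilde\tau_3:\tilde e_6\to\tilde e_4$, $\tilde\tau_4:\tilde e_4\to\tilde e_6$ (so $\tilde e_5$ is isolated). Let $R\Psi$ be its path algebra, where the product $pq$ of two paths is "first $p$, then $q$" if $p$ ends where $q$ starts, and $0$ otherwise. Let $I=(\tilde\tau_4\tilde\tau_3,\ \tilde\tau_4\tilde\tau_1,\ \tilde\tau_2\tilde\tau_1,\ \tilde\tau_2\tilde\tau_3)$ be the two-sided ideal of $R\Psi$ generated by these four elements. **Proposition.** 1. There is an isomorphism of $R$-algebras $\Lambda'_{(3)}\xrightarrow{\ \sim\ }R\Psi/I$ with $e_i\mapsto\tilde e_i+I$ for $i\in\{3,4,5,6\}$ and $\tau_i\mapsto\tilde\tau_i+I$ for $i\in\{1,2,3,4\}$. 2. $\mathrm B_R(S_3,S_3)\cong\Lambda_{(3)}$ as $R$-algebras, and $\mathrm B_R(S_3,S_3)$ is Morita equivalent over $R$ to $\Lambda'_{(3)}$, hence also to $R\Psi/I$. (Two $R$-algebras are Morita equivalent over $R$ if their module categories are equivalent via an $R$-linear functor.)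 -/

import Mathlib

namespace KraussS3

open MulOpposite

/-! ## Finite bisets and the double Burnside algebra -/

section Bisets

/-- A finite `(G, G)`-biset: a finite set with a left action and a right action of `G`
that commute with each other. A right action of `G` is an action of `Gᵐᵒᵖ`, that is,
`x · g` is `op g • x`. -/
structure Biset (G : Type) [Group G] where
  carrier : Type
  [finite : Finite carrier]
  [left : MulAction G carrier]
  [right : MulAction Gᵐᵒᵖ carrier]
  [comm : SMulCommClass G Gᵐᵒᵖ carrier]

attribute [instance] Biset.finite Biset.left Biset.right Biset.comm

variable {G : Type} [Group G]

namespace Biset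

/-- Isomorphism of bisets: a bijection that respects both actions. -/
def Iso (M N : Biset G) : Prop :=
  ∃ f : M.carrier ≃ N.carrier,
    (∀ (g : G) (m : M.carrier), f (g • m) = g • f m) ∧
    (∀ (g : G) (m : M.carrier), f (op g • m) = op g • f m)

theorem Iso.refl (M : Biset G) : Iso M M := ⟨Equiv.refl _, fun _ _ => rfl, fun _ _ => rfl⟩

theorem Iso.symm {M N : Biset G} : Iso M N → Iso N M := by
  rintro ⟨f, hl, hr⟩
  refine ⟨f.symm, fun g n => ?_, fun g n => ?_⟩
  · rw [Equiv.symm_apply_eq, hl, Equiv.apply_symm_apply]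
  · rw [Equiv.symm_apply_eq, hr, Equiv.apply_symm_apply]

theorem Iso.trans {M N L : Biset G} : Iso M N → Iso N L → Iso M L := by
  rintro ⟨f, hl, hr⟩ ⟨f', hl', hr'⟩
  exact ⟨f.trans f', fun g m => by simp [hl, hl'], fun g m => by simp [hr, hr']⟩

instance setoid (G : Type) [Group G] : Setoid (Biset G) :=
  ⟨Iso, Iso.refl, Iso.symm, Iso.trans⟩

/-- The group `G` as a `(G, G)`-biset via multiplication on both sides. -/
def unit (G : Type) [Group G] [Finite G] : Biset G where
  carrier := G

/-- The disjoint union of two bisets. -/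
def sum (M N : Biset G) : Biset G where
  carrier := M.carrier ⊕ N.carrier
  left :=
    { smul := fun g => Sum.map (g • ·) (g • ·)
      one_smul := by rintro (m | n) <;> exact congrArg _ (one_smul _ _)
      mul_smul := by rintro g h (m | n) <;> exact congrArg _ (mul_smul _ _ _) }
  right :=
    { smul := fun g => Sum.map (g • ·) (g • ·)
      one_smul := by rintro (m | n) <;> exact congrArg _ (one_smul _ _)
      mul_smul := by rintro g h (m | n) <;> exact congrArg _ (mul_smul _ _ _) }
  comm := ⟨by rintro g h (m | n) <;> exact congrArg _ (smul_comm _ _ _)⟩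

/-- The orbit relation on `M × N` of the `G`-action `g (m, n) = (m g⁻¹, g n)`. -/
def tensorSetoid (M N : Biset G) : Setoid (M.carrier × N.carrier) where
  r p q := ∃ g : G, q = (op g⁻¹ • p.1, g • p.2)
  iseqv :=
    { refl := fun p => ⟨1, by simp⟩
      symm := by
        rintro p q ⟨g, rfl⟩
        exact ⟨g⁻¹, by simp [smul_smul]⟩
      trans := by
        rintro p q r ⟨g, rfl⟩ ⟨h, rfl⟩
        exact ⟨h * g, by simp [smul_smul]⟩ }

/-- The set of `G`-orbits on `M × N`. -/
def TensorType (M N : Biset G) : Type := Quotient (tensorSetoid M N)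

instance (M N : Biset G) : Finite (TensorType M N) := Quotient.finite _

/-- The left action `h · [m, n] = [h m, n]`. -/
instance (M N : Biset G) : MulAction G (TensorType M N) where
  smul h := Quotient.map (sa := tensorSetoid M N) (sb := tensorSetoid M N)
    (fun p => (h • p.1, p.2)) (by
      rintro p q ⟨g, rfl⟩
      exact ⟨g, by simp [smul_comm]⟩)
  one_smul := by
    rintro ⟨p⟩
    exact congrArg (Quotient.mk (tensorSetoid M N)) (by simp)
  mul_smul := by
    rintro g h ⟨p⟩
    exact congrArg (Quotient.mk (tensorSetoid M N)) (by simp [mul_smul])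

/-- The right action `[m, n] · k = [m, n k]`. -/
instance (M N : Biset G) : MulAction Gᵐᵒᵖ (TensorType M N) where
  smul k := Quotient.map (sa := tensorSetoid M N) (sb := tensorSetoid M N)
    (fun p => (p.1, k • p.2)) (by
      rintro p q ⟨g, rfl⟩
      exact ⟨g, by simp [smul_comm]⟩)
  one_smul := by
    rintro ⟨p⟩
    exact congrArg (Quotient.mk (tensorSetoid M N)) (by simp)
  mul_smul := by
    rintro g h ⟨p⟩
    exact congrArg (Quotient.mk (tensorSetoid M N)) (by simp [mul_smul])

instance (M N : Biset G) : SMulCommClass G Gᵐᵒᵖ (TensorType M N) :=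
  ⟨by rintro g h ⟨p⟩; rfl⟩

/-- The tensor product `M ×_G N` of two bisets. -/
def tensor (M N : Biset G) : Biset G where
  carrier := TensorType M N

/-- The orbit `[m, n]` as an element of the tensor product. -/
def tmk {M N : Biset G} (m : M.carrier) (n : N.carrier) : (tensor M N).carrier :=
  Quotient.mk (tensorSetoid M N) (m, n)

theorem tmk_smul {M N : Biset G} (g : G) (m : M.carrier) (n : N.carrier) :
    tmk (op g • m) n = tmk m (g • n) :=
  Quotient.sound (s := tensorSetoid M N) ⟨g, by simp [smul_smul]⟩

theorem smul_tmk {M N : Biset G} (g : G) (m : M.carrier) (n : N.carrier) :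
    g • tmk m n = tmk (g • m) n := rfl

theorem op_smul_tmk {M N : Biset G} (g : G) (m : M.carrier) (n : N.carrier) :
    op g • tmk m n = tmk m (op g • n) := rfl

theorem tensor_ind {M N : Biset G} {p : (tensor M N).carrier → Prop}
    (h : ∀ m n, p (tmk m n)) (x) : p x := by
  obtain ⟨m, n⟩ := x
  exact h m n

/-- Maps out of the tensor product. -/
def tlift {M N : Biset G} {T : Type} (f : M.carrier → N.carrier → T)
    (hf : ∀ (g : G) m n, f (op g • m) n = f m (g • n)) : (tensor M N).carrier → T :=
  Quotient.lift (s := tensorSetoid M N) (fun p => f p.1 p.2) (by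
    rintro ⟨m, n⟩ q ⟨g, rfl⟩
    simp [← hf, smul_smul])

theorem tlift_tmk {M N : Biset G} {T : Type} (f : M.carrier → N.carrier → T)
    (hf : ∀ (g : G) m n, f (op g • m) n = f m (g • n)) (m n) : tlift f hf (tmk m n) = f m n := rfl

theorem tensor_congr {M M' N N' : Biset G} :
    Iso M M' → Iso N N' → Iso (tensor M N) (tensor M' N') := by
  rintro ⟨f, fl, fr⟩ ⟨f', fl', fr'⟩
  refine ⟨⟨tlift (fun m n => tmk (f m) (f' n)) ?_,
    tlift (fun m n => tmk (f.symm m) (f'.symm n)) ?_, ?_, ?_⟩, ?_, ?_⟩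
  · intro g m n; rw [fr, fl', tmk_smul]
  · intro g m n
    have h1 : f.symm (op g • m) = op g • f.symm m := by
      rw [Equiv.symm_apply_eq, fr, Equiv.apply_symm_apply]
    have h2 : f'.symm (g • n) = g • f'.symm n := by
      rw [Equiv.symm_apply_eq, fl', Equiv.apply_symm_apply]
    rw [h1, h2, tmk_smul]
  · exact tensor_ind fun m n => by simp [tlift_tmk]
  · exact tensor_ind fun m n => by simp [tlift_tmk]
  · exact fun g => tensor_ind fun m n => by simp [tlift_tmk, smul_tmk, fl]
  · exact fun g => tensor_ind fun m n => by simp [tlift_tmk, op_smul_tmk, fr']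

theorem tensor_assoc (M N L : Biset G) :
    Iso (tensor (tensor M N) L) (tensor M (tensor N L)) := by
  refine ⟨⟨tlift (fun x l => tlift (fun m n => tmk m (tmk n l)) ?_ x) ?_,
    tlift (fun m x => tlift (fun n l => tmk (tmk m n) l) ?_ x) ?_, ?_, ?_⟩, ?_, ?_⟩
  · intro g m n; rw [tmk_smul, smul_tmk]
  · exact fun g => tensor_ind fun m n l => by simp [tlift_tmk, op_smul_tmk, tmk_smul]
  · intro g n l; rw [← tmk_smul, op_smul_tmk]
  · exact fun g m => tensor_ind fun n l => by simp [tlift_tmk, smul_tmk, tmk_smul]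
  · exact tensor_ind fun x l => by
      revert x
      exact tensor_ind fun m n => by simp [tlift_tmk]
  · exact tensor_ind fun m x => by
      revert x
      exact tensor_ind fun n l => by simp [tlift_tmk]
  · exact fun g => tensor_ind fun x l => by
      revert x
      exact tensor_ind fun m n => by simp [tlift_tmk, smul_tmk]
  · exact fun g => tensor_ind fun x l => by
      revert x
      exact tensor_ind fun m n => by simp [tlift_tmk, op_smul_tmk]

theorem unit_tensor [Finite G] (M : Biset G) : Iso (tensor (unit G) M) M := by
  refine ⟨⟨tlift (fun (g : G) m => g • m) ?_, fun m => tmk (M := unit G) (1 : G) m, ?_, ?_⟩, ?_, ?_⟩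
  · exact fun g (h : G) m => mul_smul h g m
  · refine tensor_ind fun (g : G) m => ?_
    change tmk (M := unit G) (1 : G) (g • m) = tmk (M := unit G) g m
    exact (tmk_smul (M := unit G) g (1 : G) m).symm.trans
      (congrArg (fun h : (unit G).carrier => tmk h m) (one_mul g))
  · exact fun m => one_smul G m
  · exact fun g => tensor_ind fun (h : G) m => mul_smul g h m
  · exact fun g => tensor_ind fun (h : G) m => smul_comm h (op g) m

theorem tensor_unit [Finite G] (M : Biset G) : Iso (tensor M (unit G)) M := by
  refine ⟨⟨tlift (fun m (g : G) => op g • m) ?_, fun m => tmk (N := unit G) m (1 : G), ?_, ?_⟩, ?_, ?_⟩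
  · intro g m (h : G)
    change op h • op g • m = op (g * h) • m
    rw [op_mul, mul_smul]
  · refine tensor_ind fun m (g : G) => ?_
    change tmk (N := unit G) (op g • m) (1 : G) = tmk (N := unit G) m g
    exact (tmk_smul (N := unit G) g m (1 : G)).trans
      (congrArg (fun h : (unit G).carrier => tmk m h) (mul_one g))
  · exact fun m => one_smul Gᵐᵒᵖ m
  · exact fun g => tensor_ind fun m (h : G) => (smul_comm g (op h) m).symm
  · intro g
    refine tensor_ind fun m (h : G) => ?_
    change op (h * g) • m = op g • op h • m
    rw [op_mul, mul_smul]

theorem sum_congr {M M' N N' : Biset G} :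
    Iso M M' → Iso N N' → Iso (sum M N) (sum M' N') := by
  rintro ⟨f, fl, fr⟩ ⟨f', fl', fr'⟩
  refine ⟨Equiv.sumCongr f f', ?_, ?_⟩
  · rintro g (m | n)
    · exact congrArg Sum.inl (fl g m)
    · exact congrArg Sum.inr (fl' g n)
  · rintro g (m | n)
    · exact congrArg Sum.inl (fr g m)
    · exact congrArg Sum.inr (fr' g n)

theorem tensor_sum (L M N : Biset G) :
    Iso (tensor L (sum M N)) (sum (tensor L M) (tensor L N)) := by
  refine ⟨⟨tlift (fun l x => Sum.map (tmk l) (tmk l) x) ?_,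
    Sum.elim (tlift (fun l m => tmk (N := sum M N) l (Sum.inl m)) ?_)
      (tlift (fun l n => tmk (N := sum M N) l (Sum.inr n)) ?_), ?_, ?_⟩, ?_, ?_⟩
  · rintro g l (m | n)
    · exact congrArg Sum.inl (tmk_smul g l m)
    · exact congrArg Sum.inr (tmk_smul g l n)
  · exact fun g l m => tmk_smul (N := sum M N) g l (Sum.inl m)
  · exact fun g l n => tmk_smul (N := sum M N) g l (Sum.inr n)
  · refine tensor_ind ?_
    rintro l (m | n) <;> rfl
  · rintro (x | x)
    · revert x
      exact tensor_ind fun l m => rfl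
    · revert x
      exact tensor_ind fun l m => rfl
  · refine fun g => tensor_ind ?_
    rintro l (m | n) <;> rfl
  · refine fun g => tensor_ind ?_
    rintro l (m | n) <;> rfl

theorem sum_tensor (M N L : Biset G) :
    Iso (tensor (sum M N) L) (sum (tensor M L) (tensor N L)) := by
  refine ⟨⟨tlift (fun x l => Sum.map (fun m => tmk m l) (fun n => tmk n l) x) ?_,
    Sum.elim (tlift (fun m l => tmk (M := sum M N) (Sum.inl m) l) ?_)
      (tlift (fun n l => tmk (M := sum M N) (Sum.inr n) l) ?_), ?_, ?_⟩, ?_, ?_⟩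
  · rintro g (m | n) l
    · exact congrArg Sum.inl (tmk_smul g m l)
    · exact congrArg Sum.inr (tmk_smul g n l)
  · exact fun g m l => tmk_smul (M := sum M N) g (Sum.inl m) l
  · exact fun g n l => tmk_smul (M := sum M N) g (Sum.inr n) l
  · refine tensor_ind ?_
    rintro (m | n) l <;> rfl
  · rintro (x | x)
    · revert x
      exact tensor_ind fun l m => rfl
    · revert x
      exact tensor_ind fun l m => rfl
  · refine fun g => tensor_ind ?_
    rintro (m | n) l <;> rfl
  · refine fun g => tensor_ind ?_
    rintro (m | n) l <;> rfl

end Biset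

variable (G)

/-- The isomorphism classes of finite `(G, G)`-bisets. -/
def BisetClass : Type 1 := Quotient (Biset.setoid G)

namespace BisetClass

variable {G}

/-- The isomorphism class of a biset. -/
def mk (M : Biset G) : BisetClass G := Quotient.mk _ M

/-- The class of the disjoint union. -/
def sum : BisetClass G → BisetClass G → BisetClass G :=
  Quotient.map₂ Biset.sum fun _ _ h _ _ h' => Biset.sum_congr h h'

/-- Isomorphism classes of bisets form a monoid under the tensor product over `G`,
with the class of `G` as unit. -/
instance [Finite G] : Monoid (BisetClass G) where
  mul := Quotient.map₂ Biset.tensor fun _ _ h _ _ h' => Biset.tensor_congr h h'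
  one := mk (Biset.unit G)
  mul_assoc := by
    rintro ⟨M⟩ ⟨N⟩ ⟨L⟩
    exact Quotient.sound (Biset.tensor_assoc M N L)
  one_mul := by
    rintro ⟨M⟩
    exact Quotient.sound (Biset.unit_tensor M)
  mul_one := by
    rintro ⟨M⟩
    exact Quotient.sound (Biset.tensor_unit M)

theorem mk_mul_mk [Finite G] (M N : Biset G) : mk M * mk N = mk (Biset.tensor M N) := rfl

theorem sum_mk_mk (M N : Biset G) : sum (mk M) (mk N) = mk (Biset.sum M N) := rfl

theorem mul_sum [Finite G] (a b c : BisetClass G) : a * sum b c = sum (a * b) (a * c) := by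
  obtain ⟨L⟩ := a
  obtain ⟨M⟩ := b
  obtain ⟨N⟩ := c
  exact Quotient.sound (Biset.tensor_sum L M N)

theorem sum_mul [Finite G] (a b c : BisetClass G) : sum a b * c = sum (a * c) (b * c) := by
  obtain ⟨M⟩ := a
  obtain ⟨N⟩ := b
  obtain ⟨L⟩ := c
  exact Quotient.sound (Biset.sum_tensor M N L)

end BisetClass

variable (R : Type) [CommRing R] [Finite G]

/-- The submodule of the free `R`-module on the isomorphism classes of finite bisets that is
spanned by the elements `[M ⊔ N] - [M] - [N]`. -/
noncomputable def burnsideRelations : Submodule R (MonoidAlgebra R (BisetClass G)) :=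
  Submodule.span R (Set.range fun p : BisetClass G × BisetClass G =>
    MonoidAlgebra.single (p.1.sum p.2) (1 : R)
      - MonoidAlgebra.single p.1 1 - MonoidAlgebra.single p.2 1)

variable {G R} in
theorem mul_mem_burnsideRelations (f x : MonoidAlgebra R (BisetClass G))
    (hx : x ∈ burnsideRelations G R) : f * x ∈ burnsideRelations G R := by
  induction f using MonoidAlgebra.induction_linear with
  | zero => simp
  | add f g hf hg => rw [add_mul]; exact add_mem hf hg
  | single a r =>
    induction hx using Submodule.span_induction with
    | zero => simp
    | add x y _ _ hx hy => rw [mul_add]; exact add_mem hx hy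
    | smul s x _ hx => rw [mul_smul_comm]; exact Submodule.smul_mem _ s hx
    | mem x hx =>
      obtain ⟨⟨b, c⟩, rfl⟩ := hx
      have h := Submodule.smul_mem (burnsideRelations G R) r
        (Submodule.subset_span ⟨(a * b, a * c), rfl⟩)
      convert h using 1
      simp [mul_sub, smul_sub, MonoidAlgebra.single_mul_single, BisetClass.mul_sum]

variable {G R} in
theorem burnsideRelations_mul_mem (x f : MonoidAlgebra R (BisetClass G))
    (hx : x ∈ burnsideRelations G R) : x * f ∈ burnsideRelations G R := by
  induction f using MonoidAlgebra.induction_linear with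
  | zero => simp
  | add f g hf hg => rw [mul_add]; exact add_mem hf hg
  | single a r =>
    induction hx using Submodule.span_induction with
    | zero => simp
    | add x y _ _ hx hy => rw [add_mul]; exact add_mem hx hy
    | smul s x _ hx => rw [smul_mul_assoc]; exact Submodule.smul_mem _ s hx
    | mem x hx =>
      obtain ⟨⟨b, c⟩, rfl⟩ := hx
      have h := Submodule.smul_mem (burnsideRelations G R) r
        (Submodule.subset_span ⟨(b * a, c * a), rfl⟩)
      convert h using 1
      simp [sub_mul, smul_sub, MonoidAlgebra.single_mul_single, BisetClass.sum_mul]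

/-- `burnsideRelations` as a two-sided ideal of the monoid algebra. -/
noncomputable def burnsideIdeal : TwoSidedIdeal (MonoidAlgebra R (BisetClass G)) :=
  TwoSidedIdeal.mk' (burnsideRelations G R : Set (MonoidAlgebra R (BisetClass G)))
    (zero_mem _) add_mem neg_mem
    (fun {f x} hx => mul_mem_burnsideRelations f x hx)
    (fun {x f} hx => burnsideRelations_mul_mem x f hx)

/-- The double Burnside `R`-algebra of `G`: the free `R`-module on the isomorphism classes of
finite `(G, G)`-bisets modulo `[M ⊔ N] = [M] + [N]`, with multiplication `[M][N] = [M ×_G N]`. -/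
abbrev DoubleBurnside : Type 1 := (burnsideIdeal G R).ringCon.Quotient

end Bisets

/-! ## Path algebras -/

section Paths

variable (R V : Type) [CommRing R] [Quiver.{0} V]

/-- The path algebra of a quiver with vertex set `V`: the free `R`-module on the set of paths. -/
def PathAlgebra : Type := (Σ a b : V, Quiver.Path a b) →₀ R

namespace PathAlgebra

noncomputable instance : AddCommGroup (PathAlgebra R V) :=
  inferInstanceAs (AddCommGroup ((Σ a b : V, Quiver.Path a b) →₀ R))

noncomputable instance : Module R (PathAlgebra R V) :=
  inferInstanceAs (Module R ((Σ a b : V, Quiver.Path a b) →₀ R))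

variable {V}

/-- The basis element given by a path. -/
noncomputable def ofPath {a b : V} (p : Quiver.Path a b) : PathAlgebra R V :=
  Finsupp.single (⟨a, b, p⟩ : Σ a b : V, Quiver.Path a b) (1 : R)

/-- The trivial path at a vertex. -/
noncomputable def vertex (a : V) : PathAlgebra R V := ofPath R (Quiver.Path.nil : Quiver.Path a a)

/-- The path of length one given by an arrow. -/
noncomputable def arrow {a b : V} (α : a ⟶ b) : PathAlgebra R V := ofPath R α.toPath

variable [DecidableEq V]

/-- Product of two paths: first `p`, then `q`, if `p` ends where `q` starts, and zero else. -/
noncomputable def pathMul (p q : Σ a b : V, Quiver.Path a b) : PathAlgebra R V :=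
  if h : q.1 = p.2.1 then ofPath R (p.2.2.comp (q.2.2.cast h rfl)) else 0

variable (V) in
/-- The bilinear extension of `pathMul`. -/
noncomputable def mulHom : PathAlgebra R V →ₗ[R] PathAlgebra R V →ₗ[R] PathAlgebra R V :=
  Finsupp.lift _ R _ fun p => Finsupp.lift _ R _ fun q => pathMul R p q

noncomputable instance : Mul (PathAlgebra R V) := ⟨fun f g => mulHom R V f g⟩

noncomputable instance [Fintype V] : One (PathAlgebra R V) := ⟨∑ a, vertex R a⟩

theorem mul_eq (f g : PathAlgebra R V) : f * g = mulHom R V f g := rfl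

theorem ofPath_mul {a b c d : V} (p : Quiver.Path a b) (q : Quiver.Path c d) :
    ofPath R p * ofPath R q = if h : c = b then ofPath R (p.comp (q.cast h rfl)) else 0 := by
  have key : ∀ {M : Type} [AddCommGroup M] [Module R M] (f : (Σ a b : V, Quiver.Path a b) → M)
      (x : Σ a b : V, Quiver.Path a b), Finsupp.lift M R _ f (Finsupp.single x 1) = f x := by
    intro M _ _ f x
    simp
  have h1 : mulHom R V (ofPath R p) = Finsupp.lift (PathAlgebra R V) R _
      fun q => pathMul R ⟨a, b, p⟩ q := key _ _
  rw [mul_eq, h1]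
  exact key _ _

theorem ofPath_mul_comp {a b c : V} (p : Quiver.Path a b) (q : Quiver.Path b c) :
    ofPath R p * ofPath R q = ofPath R (p.comp q) := by
  rw [ofPath_mul, dif_pos rfl, Quiver.Path.cast_rfl_rfl]

theorem ofPath_mul_of_ne {a b c d : V} (p : Quiver.Path a b) (q : Quiver.Path c d) (h : c ≠ b) :
    ofPath R p * ofPath R q = 0 := by
  rw [ofPath_mul, dif_neg h]

noncomputable instance : NonUnitalNonAssocRing (PathAlgebra R V) where
  left_distrib f g h := by simp [mul_eq]
  right_distrib f g h := by simp [mul_eq]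
  zero_mul f := by simp [mul_eq]
  mul_zero f := by simp [mul_eq]

instance : IsScalarTower R (PathAlgebra R V) (PathAlgebra R V) :=
  ⟨fun r f g => by simp [mul_eq]⟩

instance : SMulCommClass R (PathAlgebra R V) (PathAlgebra R V) :=
  ⟨fun r f g => by simp [mul_eq]⟩

variable {R} in
theorem induction_linear {p : PathAlgebra R V → Prop} (f : PathAlgebra R V) (zero : p 0)
    (add : ∀ f g, p f → p g → p (f + g))
    (smul : ∀ (r : R) (a b : V) (q : Quiver.Path a b), p (r • ofPath R q)) : p f := by
  refine Finsupp.induction_linear f zero add fun ⟨a, b, q⟩ r => ?_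
  have h : (Finsupp.single ⟨a, b, q⟩ r : (Σ a b : V, Quiver.Path a b) →₀ R) = r • ofPath R q :=
    (Finsupp.smul_single_one (⟨a, b, q⟩ : Σ a b : V, Quiver.Path a b) r).symm
  exact h ▸ smul r a b q

theorem ofPath_assoc {a b c d e f : V} (p : Quiver.Path a b) (q : Quiver.Path c d)
    (r : Quiver.Path e f) :
    ofPath R p * ofPath R q * ofPath R r = ofPath R p * (ofPath R q * ofPath R r) := by
  by_cases h : c = b
  · subst h
    by_cases h' : e = d
    · subst h'
      simp [ofPath_mul_comp, Quiver.Path.comp_assoc]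
    · simp [ofPath_mul_comp, ofPath_mul_of_ne _ _ _ h']
  · by_cases h' : e = d
    · subst h'
      simp [ofPath_mul_comp, ofPath_mul_of_ne _ _ _ h]
    · simp [ofPath_mul_of_ne _ _ _ h, ofPath_mul_of_ne _ _ _ h']

noncomputable instance [Fintype V] : Ring (PathAlgebra R V) where
  mul_assoc f g h := by
    induction f using induction_linear with
    | zero => simp
    | add f f' hf hf' => simp only [add_mul, hf, hf']
    | smul r a b p =>
      induction g using induction_linear with
      | zero => simp
      | add g g' hg hg' => simp only [add_mul, mul_add, hg, hg']
      | smul s c d q =>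
        induction h using induction_linear with
        | zero => simp
        | add h h' hh hh' => simp only [mul_add, hh, hh']
        | smul t e f r' => simp only [smul_mul_assoc, mul_smul_comm, ofPath_assoc]
  one_mul f := by
    change (∑ a, vertex R a) * f = f
    induction f using induction_linear with
    | zero => simp
    | add f f' hf hf' => rw [mul_add, hf, hf']
    | smul r a b p =>
      rw [mul_smul_comm, Finset.sum_mul, Finset.sum_eq_single a, vertex, ofPath_mul_comp,
        Quiver.Path.nil_comp]
      · exact fun c _ hc => ofPath_mul_of_ne R _ _ hc.symm
      · simp
  mul_one f := by
    change f * (∑ a, vertex R a) = f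
    induction f using induction_linear with
    | zero => simp
    | add f f' hf hf' => rw [add_mul, hf, hf']
    | smul r a b p =>
      rw [smul_mul_assoc, Finset.mul_sum, Finset.sum_eq_single b, vertex, ofPath_mul_comp,
        Quiver.Path.comp_nil]
      · exact fun c _ hc => ofPath_mul_of_ne R _ _ hc
      · simp

noncomputable instance [Fintype V] : Algebra R (PathAlgebra R V) :=
  Algebra.ofModule smul_mul_assoc mul_smul_comm

end PathAlgebra

end Paths

/-! ## The quiver `Ψ` and the ideal of relations -/

section Psi

/-- The vertices `ẽ₃, ẽ₄, ẽ₅, ẽ₆` of the quiver `Ψ`. -/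
inductive PsiVertex : Type
  | e3 | e4 | e5 | e6
  deriving DecidableEq

instance : Fintype PsiVertex :=
  ⟨{.e3, .e4, .e5, .e6}, by intro x; cases x <;> decide⟩

/-- The arrows of the quiver `Ψ`: `τ̃₁ : ẽ₆ → ẽ₃`, `τ̃₂ : ẽ₃ → ẽ₆`, `τ̃₃ : ẽ₆ → ẽ₄`,
`τ̃₄ : ẽ₄ → ẽ₆`. The vertex `ẽ₅` is isolated. -/
inductive PsiArrow : PsiVertex → PsiVertex → Type
  | tau1 : PsiArrow PsiVertex.e6 PsiVertex.e3
  | tau2 : PsiArrow PsiVertex.e3 PsiVertex.e6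
  | tau3 : PsiArrow PsiVertex.e6 PsiVertex.e4
  | tau4 : PsiArrow PsiVertex.e4 PsiVertex.e6

instance : Quiver.{0} PsiVertex := ⟨PsiArrow⟩

variable (R : Type) [CommRing R]

/-- The element `τ̃ᵢ` of the path algebra `RΨ` for an arrow of `Ψ`. -/
noncomputable def psiArrow {a b : PsiVertex} (α : PsiArrow a b) : PathAlgebra R PsiVertex :=
  PathAlgebra.arrow R (show a ⟶ b from α)

open PsiArrow in
/-- The two-sided ideal `I = (τ̃₄τ̃₃, τ̃₄τ̃₁, τ̃₂τ̃₁, τ̃₂τ̃₃)` of `RΨ`. -/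
noncomputable def psiIdeal : TwoSidedIdeal (PathAlgebra R PsiVertex) :=
  TwoSidedIdeal.span
    {psiArrow R tau4 * psiArrow R tau3, psiArrow R tau4 * psiArrow R tau1,
     psiArrow R tau2 * psiArrow R tau1, psiArrow R tau2 * psiArrow R tau3}

/-- The path algebra modulo relations `RΨ/I`. -/
abbrev PsiAlgebra : Type := (psiIdeal R).ringCon.Quotient

/-- The residue class of `ẽᵢ` in `RΨ/I`. -/
noncomputable def psiE (a : PsiVertex) : PsiAlgebra R :=
  (psiIdeal R).ringCon.mk' (PathAlgebra.vertex R a)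

/-- The residue class of `τ̃ᵢ` in `RΨ/I`. -/
noncomputable def psiTau {a b : PsiVertex} (α : PsiArrow a b) : PsiAlgebra R :=
  (psiIdeal R).ringCon.mk' (psiArrow R α)

end Psi

/-! ## The order `A_R` and its suborder `Λ` -/

section Order

/-- The `R`-module `A_R` of block matrices
```
  s   0   0   t
  0   u   0   v
  0   0   w   0
  x   y   0   z₁ + z₂ η + z₃ ξ
```
with `s` in `R^{3×3}`, `t` in `R^{3×1}`, `x` in `R^{1×3}`, scalars `u, v, w, y`, and last entry in
`R[η, ξ]/(η², ηξ, ξ²)`. -/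
@[ext]
structure BlockOrder (R : Type) : Type where
  s : Matrix (Fin 3) (Fin 3) R
  t : Fin 3 → R
  u : R
  v : R
  w : R
  x : Fin 3 → R
  y : R
  z₁ : R
  z₂ : R
  z₃ : R

namespace BlockOrder

variable {R : Type} [CommRing R]

instance : Zero (BlockOrder R) := ⟨⟨0, 0, 0, 0, 0, 0, 0, 0, 0, 0⟩⟩

instance : One (BlockOrder R) := ⟨⟨1, 0, 1, 0, 1, 0, 0, 1, 0, 0⟩⟩

instance : Add (BlockOrder R) :=
  ⟨fun a b => ⟨a.s + b.s, a.t + b.t, a.u + b.u, a.v + b.v, a.w + b.w, a.x + b.x, a.y + b.y,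
    a.z₁ + b.z₁, a.z₂ + b.z₂, a.z₃ + b.z₃⟩⟩

instance : Neg (BlockOrder R) :=
  ⟨fun a => ⟨-a.s, -a.t, -a.u, -a.v, -a.w, -a.x, -a.y, -a.z₁, -a.z₂, -a.z₃⟩⟩

instance : SMul R (BlockOrder R) :=
  ⟨fun r a => ⟨r • a.s, r • a.t, r • a.u, r • a.v, r • a.w, r • a.x, r • a.y,
    r • a.z₁, r • a.z₂, r • a.z₃⟩⟩

/-- Block matrix multiplication, where `η` and `ξ` annihilate the entries `t, v, x, y`, where a
product of an entry `x` with an entry `t` is `(x t) η`, a product of an entry `y` with an entry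
`v` is `y v (ξ - 12 η)`, and where the products of `t` with `x`, of `t` with `y`, of `v` with `x`
and of `v` with `y` are zero. -/
instance : Mul (BlockOrder R) :=
  ⟨fun a b =>
    { s := a.s * b.s
      t := fun i => (∑ j, a.s i j * b.t j) + a.t i * b.z₁
      u := a.u * b.u
      v := a.u * b.v + a.v * b.z₁
      w := a.w * b.w
      x := fun j => (∑ i, a.x i * b.s i j) + a.z₁ * b.x j
      y := a.y * b.u + a.z₁ * b.y
      z₁ := a.z₁ * b.z₁
      z₂ := (∑ i, a.x i * b.t i) - 12 * (a.y * b.v) + (a.z₁ * b.z₂ + a.z₂ * b.z₁)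
      z₃ := a.y * b.v + (a.z₁ * b.z₃ + a.z₃ * b.z₁) }⟩

section Components

variable (a b : BlockOrder R) (r : R)

@[simp] theorem zero_s : (0 : BlockOrder R).s = 0 := rfl
@[simp] theorem zero_t : (0 : BlockOrder R).t = 0 := rfl
@[simp] theorem zero_u : (0 : BlockOrder R).u = 0 := rfl
@[simp] theorem zero_v : (0 : BlockOrder R).v = 0 := rfl
@[simp] theorem zero_w : (0 : BlockOrder R).w = 0 := rfl
@[simp] theorem zero_x : (0 : BlockOrder R).x = 0 := rfl
@[simp] theorem zero_y : (0 : BlockOrder R).y = 0 := rfl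
@[simp] theorem zero_z₁ : (0 : BlockOrder R).z₁ = 0 := rfl
@[simp] theorem zero_z₂ : (0 : BlockOrder R).z₂ = 0 := rfl
@[simp] theorem zero_z₃ : (0 : BlockOrder R).z₃ = 0 := rfl

@[simp] theorem one_s : (1 : BlockOrder R).s = 1 := rfl
@[simp] theorem one_t : (1 : BlockOrder R).t = 0 := rfl
@[simp] theorem one_u : (1 : BlockOrder R).u = 1 := rfl
@[simp] theorem one_v : (1 : BlockOrder R).v = 0 := rfl
@[simp] theorem one_w : (1 : BlockOrder R).w = 1 := rfl
@[simp] theorem one_x : (1 : BlockOrder R).x = 0 := rfl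
@[simp] theorem one_y : (1 : BlockOrder R).y = 0 := rfl
@[simp] theorem one_z₁ : (1 : BlockOrder R).z₁ = 1 := rfl
@[simp] theorem one_z₂ : (1 : BlockOrder R).z₂ = 0 := rfl
@[simp] theorem one_z₃ : (1 : BlockOrder R).z₃ = 0 := rfl

@[simp] theorem add_s : (a + b).s = a.s + b.s := rfl
@[simp] theorem add_t : (a + b).t = a.t + b.t := rfl
@[simp] theorem add_u : (a + b).u = a.u + b.u := rfl
@[simp] theorem add_v : (a + b).v = a.v + b.v := rfl
@[simp] theorem add_w : (a + b).w = a.w + b.w := rfl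
@[simp] theorem add_x : (a + b).x = a.x + b.x := rfl
@[simp] theorem add_y : (a + b).y = a.y + b.y := rfl
@[simp] theorem add_z₁ : (a + b).z₁ = a.z₁ + b.z₁ := rfl
@[simp] theorem add_z₂ : (a + b).z₂ = a.z₂ + b.z₂ := rfl
@[simp] theorem add_z₃ : (a + b).z₃ = a.z₃ + b.z₃ := rfl

@[simp] theorem neg_s : (-a).s = -a.s := rfl
@[simp] theorem neg_t : (-a).t = -a.t := rfl
@[simp] theorem neg_u : (-a).u = -a.u := rfl
@[simp] theorem neg_v : (-a).v = -a.v := rfl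
@[simp] theorem neg_w : (-a).w = -a.w := rfl
@[simp] theorem neg_x : (-a).x = -a.x := rfl
@[simp] theorem neg_y : (-a).y = -a.y := rfl
@[simp] theorem neg_z₁ : (-a).z₁ = -a.z₁ := rfl
@[simp] theorem neg_z₂ : (-a).z₂ = -a.z₂ := rfl
@[simp] theorem neg_z₃ : (-a).z₃ = -a.z₃ := rfl

@[simp] theorem smul_s : (r • a).s = r • a.s := rfl
@[simp] theorem smul_t : (r • a).t = r • a.t := rfl
@[simp] theorem smul_u : (r • a).u = r * a.u := rfl
@[simp] theorem smul_v : (r • a).v = r * a.v := rfl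
@[simp] theorem smul_w : (r • a).w = r * a.w := rfl
@[simp] theorem smul_x : (r • a).x = r • a.x := rfl
@[simp] theorem smul_y : (r • a).y = r * a.y := rfl
@[simp] theorem smul_z₁ : (r • a).z₁ = r * a.z₁ := rfl
@[simp] theorem smul_z₂ : (r • a).z₂ = r * a.z₂ := rfl
@[simp] theorem smul_z₃ : (r • a).z₃ = r * a.z₃ := rfl

@[simp] theorem mul_s : (a * b).s = a.s * b.s := rfl
@[simp] theorem mul_t (i : Fin 3) :
    (a * b).t i = (∑ j, a.s i j * b.t j) + a.t i * b.z₁ := rfl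
@[simp] theorem mul_u : (a * b).u = a.u * b.u := rfl
@[simp] theorem mul_v : (a * b).v = a.u * b.v + a.v * b.z₁ := rfl
@[simp] theorem mul_w : (a * b).w = a.w * b.w := rfl
@[simp] theorem mul_x (j : Fin 3) :
    (a * b).x j = (∑ i, a.x i * b.s i j) + a.z₁ * b.x j := rfl
@[simp] theorem mul_y : (a * b).y = a.y * b.u + a.z₁ * b.y := rfl
@[simp] theorem mul_z₁ : (a * b).z₁ = a.z₁ * b.z₁ := rfl
@[simp] theorem mul_z₂ : (a * b).z₂ =
    (∑ i, a.x i * b.t i) - 12 * (a.y * b.v) + (a.z₁ * b.z₂ + a.z₂ * b.z₁) := rfl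
@[simp] theorem mul_z₃ : (a * b).z₃ = a.y * b.v + (a.z₁ * b.z₃ + a.z₃ * b.z₁) := rfl

end Components

instance : Ring (BlockOrder R) where
  add_assoc a b c := by ext <;> simp [add_assoc]
  zero_add a := by ext <;> simp
  add_zero a := by ext <;> simp
  add_comm a b := by ext <;> simp [add_comm]
  neg_add_cancel a := by ext <;> simp
  nsmul := nsmulRec
  zsmul := zsmulRec
  left_distrib a b c := by
    ext <;> simp [Matrix.mul_apply, Fin.sum_univ_three] <;> ring
  right_distrib a b c := by
    ext <;> simp [Matrix.mul_apply, Fin.sum_univ_three] <;> ring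
  zero_mul a := by ext <;> simp
  mul_zero a := by ext <;> simp
  mul_assoc a b c := by
    ext <;> simp [Matrix.mul_apply, Fin.sum_univ_three] <;> ring
  one_mul a := by
    ext <;> simp [Matrix.one_apply]
  mul_one a := by
    ext <;> simp [Matrix.one_apply]

instance : Module R (BlockOrder R) where
  one_smul a := by ext <;> simp
  mul_smul r s a := by ext <;> simp [mul_assoc]
  smul_zero r := by ext <;> simp
  smul_add r a b := by ext <;> simp [mul_add]
  add_smul r s a := by ext <;> simp [add_mul]
  zero_smul a := by ext <;> simp

instance : Algebra R (BlockOrder R) :=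
  Algebra.ofModule
    (fun r a b => by
      ext <;> simp [Matrix.mul_apply, Fin.sum_univ_three] <;> ring)
    (fun r a b => by
      ext <;> simp [Matrix.mul_apply, Fin.sum_univ_three] <;> ring)

end BlockOrder

variable (R : Type) [CommRing R]

/-- The suborder `Λ` of `A_R` that is cut out by the congruences `x₁ ≡ x₂ ≡ x₃ ≡ z₂ ≡ 0`
modulo `3`. For `R = ℤ_(3)` this is `Λ_(3)`. -/
def Lambda3 : Subalgebra R (BlockOrder R) where
  carrier := {a | (∀ i, (3 : R) ∣ a.x i) ∧ (3 : R) ∣ a.z₂}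
  mul_mem' := by
    rintro a b ⟨ha, ha'⟩ ⟨hb, hb'⟩
    refine ⟨fun j => ?_, ?_⟩
    · exact dvd_add (Finset.dvd_sum fun i _ => (ha i).mul_right _) ((hb j).mul_left _)
    · refine dvd_add (dvd_sub (Finset.dvd_sum fun i _ => (ha i).mul_right _) ?_)
        (dvd_add (hb'.mul_left _) (ha'.mul_right _))
      exact Dvd.dvd.mul_right ⟨4, by norm_num⟩ _
  add_mem' := by
    rintro a b ⟨ha, ha'⟩ ⟨hb, hb'⟩
    exact ⟨fun i => dvd_add (ha i) (hb i), dvd_add ha' hb'⟩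
  algebraMap_mem' r := by
    rw [Algebra.algebraMap_eq_smul_one]
    exact ⟨fun i => by simp, by simp⟩

namespace Lambda3

/-- `e₃`, with single nonzero entry `1` at position `(3, 3)`. -/
def e3 : Lambda3 R := ⟨{ (0 : BlockOrder R) with s := Matrix.single 2 2 1 }, by simp [Lambda3]⟩

/-- `e₄`, with single nonzero entry `1` at position `(4, 4)`. -/
def e4 : Lambda3 R := ⟨{ (0 : BlockOrder R) with u := 1 }, by simp [Lambda3]⟩

/-- `e₅`, with single nonzero entry `1` at position `(5, 5)`. -/
def e5 : Lambda3 R := ⟨{ (0 : BlockOrder R) with w := 1 }, by simp [Lambda3]⟩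

/-- `e₆`, with single nonzero entry `1` at position `(6, 6)`. -/
def e6 : Lambda3 R := ⟨{ (0 : BlockOrder R) with z₁ := 1 }, by simp [Lambda3]⟩

/-- `τ₁`, with single nonzero entry `3` at position `(6, 3)`. -/
def tau1 : Lambda3 R :=
  ⟨{ (0 : BlockOrder R) with x := Pi.single 2 3 }, fun i => by
    by_cases h : i = 2
    · subst h; simp
    · simp [h], by simp⟩

/-- `τ₂`, with single nonzero entry `1` at position `(3, 6)`. -/
def tau2 : Lambda3 R := ⟨{ (0 : BlockOrder R) with t := Pi.single 2 1 }, by simp [Lambda3]⟩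

/-- `τ₃`, with single nonzero entry `1` at position `(6, 4)`. -/
def tau3 : Lambda3 R := ⟨{ (0 : BlockOrder R) with y := 1 }, by simp [Lambda3]⟩

/-- `τ₄`, with single nonzero entry `1` at position `(4, 6)`. -/
def tau4 : Lambda3 R := ⟨{ (0 : BlockOrder R) with v := 1 }, by simp [Lambda3]⟩

/-- The idempotent `e₃ + e₄ + e₅ + e₆`. -/
def cornerIdem : Lambda3 R := e3 R + e4 R + e5 R + e6 R

end Lambda3

open Lambda3

theorem cornerIdem_isIdempotentElem : IsIdempotentElem (cornerIdem R) := by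
  refine Subtype.ext ?_
  ext i j <;> simp [cornerIdem, e3, e4, e5, e6]

/-- A corner `e A e` of an `R`-algebra is an `R`-algebra. -/
instance cornerAlgebra {A : Type} [Ring A] [Algebra R A] {e : A} (he : IsIdempotentElem e) :
    Algebra R he.Corner :=
  letI : SMul R he.Corner :=
    ⟨fun r a => ⟨r • a.1, r • a.1, by
      have h := (Subsemigroup.mem_corner_iff he).1 a.2
      simp [h.1, h.2]⟩⟩
  letI : Module R he.Corner :=
    { one_smul := fun a => Subtype.ext (one_smul R a.1)
      mul_smul := fun r s a => Subtype.ext (mul_smul r s a.1)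
      smul_zero := fun r => Subtype.ext (smul_zero r)
      smul_add := fun r a b => Subtype.ext (smul_add r a.1 b.1)
      add_smul := fun r s a => Subtype.ext (add_smul r s a.1)
      zero_smul := fun a => Subtype.ext (zero_smul R a.1) }
  Algebra.ofModule (fun r a b => Subtype.ext (smul_mul_assoc r a.1 b.1))
    (fun r a b => Subtype.ext (mul_smul_comm r a.1 b.1))

/-- The corner algebra `Λ' = (e₃ + e₄ + e₅ + e₆) Λ (e₃ + e₄ + e₅ + e₆)`. -/
abbrev CornerLambda3 : Type := (cornerIdem_isIdempotentElem R).Corner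

namespace CornerLambda3

/-- `eᵢ` for `i = 3, 4, 5, 6` as an element of `Λ'`. -/
def e : PsiVertex → CornerLambda3 R
  | .e3 => ⟨e3 R, e3 R, by ext i j <;> simp [cornerIdem, e3, e4, e5, e6]⟩
  | .e4 => ⟨e4 R, e4 R, by ext i j <;> simp [cornerIdem, e3, e4, e5, e6]⟩
  | .e5 => ⟨e5 R, e5 R, by ext i j <;> simp [cornerIdem, e3, e4, e5, e6]⟩
  | .e6 => ⟨e6 R, e6 R, by ext i j <;> simp [cornerIdem, e3, e4, e5, e6]⟩

/-- `τᵢ` for `i = 1, 2, 3, 4` as an element of `Λ'`, indexed by the arrows of `Ψ`. -/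
def tau : {a b : PsiVertex} → PsiArrow a b → CornerLambda3 R
  | _, _, .tau1 => ⟨tau1 R, tau1 R, by ext i j <;> simp [cornerIdem, e3, e4, e5, e6, tau1, Fin.sum_univ_three, Pi.single_apply, Matrix.single_apply, eq_comm]⟩
  | _, _, .tau2 => ⟨tau2 R, tau2 R, by ext i j <;> simp [cornerIdem, e3, e4, e5, e6, tau2, Pi.single_apply, Matrix.single_apply, eq_comm]⟩
  | _, _, .tau3 => ⟨tau3 R, tau3 R, by ext i j <;> simp [cornerIdem, e3, e4, e5, e6, tau3]⟩
  | _, _, .tau4 => ⟨tau4 R, tau4 R, by ext i j <;> simp [cornerIdem, e3, e4, e5, e6, tau4]⟩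

end CornerLambda3

end Order

/-! ## The localization of `ℤ` at `3` -/

instance isPrime_span_three : (Ideal.span {(3 : ℤ)}).IsPrime :=
  Ideal.isPrime_span_singleton_of_prime Int.prime_three

/-- The ring `ℤ_(3)`. -/
abbrev Z3 : Type := Localization.AtPrime (Ideal.span {(3 : ℤ)})

end KraussS3

open KraussS3

/-! The isomorphism of the double Burnside algebra with `Λ` is obtained without comparing
multiplication tables. Each algebra contains four elements `a`, `b`, `c`, `p` that satisfy the same
list `GeneratorRelations`, and these relations rewrite every product of generators as a linear
combination of 22 words. If the words form a basis of both algebras, then the subalgebra of the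
product generated by the four pairs of generators is again spanned by its 22 words, so both
projections from it are bijective and it is the graph of an isomorphism
(`nonempty_algEquiv_of_wordBasis`).

On the biset side the words are the classes of the transitive bisets `(S₃ × S₃) / L`, one for each
conjugacy class of subgroups `L`. The relations are instances of the Mackey formula with one or two
double cosets (`trans_mul_trans`, `trans_mul_trans_eq_sum`). The words span because every biset is a
union of orbits and every `L` is conjugate to one of 22 representatives (`exists_trans_eq`). They
are independent because the table of marks is triangular (`sum_burnsideClass_trans_eq_zero`).

On the side of `Λ` the generators are explicit matrices. The matrix `p` is an idempotent of rank
one, so the 16 words containing `p` are products of a column and a row and fill exactly the entries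
`s`, `t`, `x`, `z₂` under the congruences modulo 3. The other six words are detected by the
remaining six entries; here 2 has to be invertible (`Lambda3.wordBasis`).

For the path algebra, the relations kill every path that passes through `ẽ₆` between two arrows, so
ten paths span `RΨ/I`. Their images in `Λ'` are triangular with respect to the ten free entries, and
the factors 3 that occur are exactly those allowed for by the congruences (`psiToCorner_bijective`).

Morita equivalence holds because `e₃ + e₄ + e₅ + e₆` is a full idempotent: `e₃` alone generates the
whole `3 × 3` block. For a full idempotent `e` the functor `M ↦ e M` is an equivalence
(`cornerFunctor_isEquivalence`). -/

namespace KraussS3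

/-! ## Morita equivalence with a full corner -/

section FullCorner

open CategoryTheory
open scoped ModuleCat.Algebra

-- The double Burnside algebra lies in `Type 1`, so modules over rings in `Type` are taken in a
-- universe of their own.
universe w

variable {A : Type} [Ring A] {e : A} (he : IsIdempotentElem e)

/-- The additive subgroup `e M` of an `A`-module `M`. -/
def idemPart (_ : IsIdempotentElem e) (M : Type w) [AddCommGroup M] [Module A M] :
    AddSubgroup M where
  carrier := {m | e • m = m}
  zero_mem' := smul_zero e
  add_mem' := by
    intro a b ha hb
    exact (smul_add e a b).trans (congrArg₂ (· + ·) ha hb)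
  neg_mem' := by
    intro a ha
    exact (smul_neg e a).trans (congrArg Neg.neg ha)

theorem mem_idemPart {M : Type w} [AddCommGroup M] [Module A M] {m : M} :
    m ∈ idemPart he M ↔ e • m = m := Iff.rfl

theorem idemPart_smul {M : Type w} [AddCommGroup M] [Module A M] (m : idemPart he M) :
    e • (m : M) = m := m.2

theorem corner_mul_left (c : he.Corner) : e * c.1 = c.1 :=
  ((Subsemigroup.mem_corner_iff he).1 c.2).1

theorem corner_mul_right (c : he.Corner) : c.1 * e = c.1 :=
  ((Subsemigroup.mem_corner_iff he).1 c.2).2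

/-- The element `e a e` of the corner. -/
def toCorner (a : A) : he.Corner := ⟨e * a * e, a, rfl⟩

instance (M : Type w) [AddCommGroup M] [Module A M] : Module he.Corner (idemPart he M) where
  smul c m := ⟨c.1 • (m : M), by
    rw [mem_idemPart, ← mul_smul, corner_mul_left]⟩
  one_smul m := Subtype.ext m.2
  mul_smul c d m := Subtype.ext (mul_smul c.1 d.1 (m : M))
  smul_zero c := Subtype.ext (smul_zero c.1)
  smul_add c m n := Subtype.ext (smul_add c.1 (m : M) n)
  add_smul c d m := Subtype.ext (add_smul c.1 d.1 (m : M))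
  zero_smul m := Subtype.ext (zero_smul A (m : M))

theorem coe_corner_smul {M : Type w} [AddCommGroup M] [Module A M] (c : he.Corner)
    (m : idemPart he M) : ((c • m : idemPart he M) : M) = c.1 • (m : M) := rfl

/-- The restriction of an `A`-linear map `M → N` to `e M → e N`. -/
def idemPartMap {M N : Type w} [AddCommGroup M] [Module A M] [AddCommGroup N] [Module A N]
    (f : M →ₗ[A] N) : idemPart he M →ₗ[he.Corner] idemPart he N where
  toFun m := ⟨f m, by rw [mem_idemPart, ← map_smul, m.2]⟩
  map_add' m n := Subtype.ext (map_add f _ _)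
  map_smul' c m := Subtype.ext (map_smul f c.1 (m : M))

/-- The functor `M ↦ e M` from `A`-modules to `e A e`-modules. -/
def cornerFunctor : ModuleCat.{w} A ⥤ ModuleCat.{w} he.Corner where
  obj M := ModuleCat.of he.Corner (idemPart he M)
  map f := ModuleCat.ofHom (idemPartMap he f.hom)

-- Fullness of `e` recovers `m` from the elements `(e * y i) • m` of `e M`; this is why `e M`
-- determines `M`.
variable {he} in
theorem sum_smul_corner {ι : Type} [Fintype ι] {x y : ι → A} (hxy : ∑ i, x i * e * y i = 1)
    {M : Type w} [AddCommGroup M] [Module A M] (m : M) :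
    ∑ i, x i • (e * y i) • m = m := by
  simp only [← mul_smul, ← Finset.sum_smul, ← mul_assoc, hxy, one_smul]

theorem idemPart_mul_smul_mem {M : Type w} [AddCommGroup M] [Module A M] (a : A) (m : M) :
    (e * a) • m ∈ idemPart he M := by
  rw [mem_idemPart, ← mul_smul, ← mul_assoc, he.eq]

/-- The extension of an `e A e`-linear map `e M → e N` to an `A`-linear map, for a full
idempotent `e`. -/
def extendCorner {ι : Type} [Fintype ι] {x y : ι → A} (hxy : ∑ i, x i * e * y i = 1)
    {M N : Type w} [AddCommGroup M] [Module A M] [AddCommGroup N] [Module A N]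
    (g : idemPart he M →ₗ[he.Corner] idemPart he N) : M →ₗ[A] N where
  -- The formula is forced: an `A`-linear extension has to send `m = ∑ x i • (e * y i) • m` to this
  -- sum.
  toFun m := ∑ i, x i • (g ⟨(e * y i) • m, idemPart_mul_smul_mem he _ _⟩ : N)
  map_add' m n := by
    rw [← Finset.sum_add_distrib]
    refine Finset.sum_congr rfl fun i _ => ?_
    rw [← smul_add, ← AddSubgroup.coe_add, ← map_add]
    congr 3
    exact Subtype.ext (smul_add _ _ _)
  map_smul' a m := by
    -- Expanding `m` once more expresses `(e * y i) • a • m` through the elements `(e * y j) • m`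
    -- with coefficients `e * (y i * a * x j) * e` in the corner, and `g` is linear over these.
    have key : ∀ i, (g ⟨(e * y i) • a • m, idemPart_mul_smul_mem he _ _⟩ : N) =
        ∑ j, (e * y i * a * x j) •
          (g ⟨(e * y j) • m, idemPart_mul_smul_mem he _ _⟩ : N) := by
      intro i
      have h1 : (⟨(e * y i) • a • m, idemPart_mul_smul_mem he _ _⟩ : idemPart he M) =
          ∑ j, toCorner he (y i * a * x j) •
            ⟨(e * y j) • m, idemPart_mul_smul_mem he _ _⟩ := by
        refine Subtype.ext ?_
        rw [AddSubgroup.val_finsetSum]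
        simp only [coe_corner_smul]
        conv_lhs => rw [← sum_smul_corner hxy m]
        simp only [Finset.smul_sum, ← mul_smul, toCorner]
        refine Finset.sum_congr rfl fun j _ => ?_
        simp only [mul_assoc]
        rw [← mul_assoc e e, he.eq]
      rw [h1, map_sum, AddSubgroup.val_finsetSum]
      refine Finset.sum_congr rfl fun j _ => ?_
      rw [map_smul, coe_corner_smul]
      conv_rhs => rw [← idemPart_smul he (g _), ← mul_smul]
      simp only [toCorner, mul_assoc]
    simp only [key, Finset.smul_sum, RingHom.id_apply]
    rw [Finset.sum_comm]
    refine Finset.sum_congr rfl fun j _ => ?_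
    simp only [← mul_smul, ← Finset.sum_smul]
    congr 1
    simp only [← mul_assoc, ← Finset.sum_mul, hxy, one_mul]

theorem idemPartMap_extendCorner {ι : Type} [Fintype ι] {x y : ι → A}
    (hxy : ∑ i, x i * e * y i = 1)
    {M N : Type w} [AddCommGroup M] [Module A M] [AddCommGroup N] [Module A N]
    (g : idemPart he M →ₗ[he.Corner] idemPart he N) :
    idemPartMap he (extendCorner he hxy g) = g := by
  ext m
  change ∑ i, x i • (g ⟨(e * y i) • (m : M), idemPart_mul_smul_mem he _ _⟩ : N) = g m
  -- On `e M` the factor `e * y i` acts like the corner element `e * y i * e`, so it passes through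
  -- `g`.
  have h : ∀ i, (g ⟨(e * y i) • (m : M), idemPart_mul_smul_mem he _ _⟩ : N) =
      (e * y i) • (g m : N) := by
    intro i
    have h1 : (⟨(e * y i) • (m : M), idemPart_mul_smul_mem he _ _⟩ : idemPart he M) =
        toCorner he (y i) • m := by
      refine Subtype.ext ?_
      rw [coe_corner_smul]
      exact ((mul_smul _ _ _).trans (congrArg _ (idemPart_smul he m))).symm
    rw [h1, map_smul, coe_corner_smul]
    conv_rhs => rw [← idemPart_smul he (g m), ← mul_smul]
    rfl
  simp only [h]
  exact sum_smul_corner hxy _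

/-! ### Coinduction from the corner to the algebra. -/

/-- The left `e A e`-module `e A`. -/
abbrev CornerRow : Type := idemPart he A

/-- Right multiplication by an element of `A` on `e A`. -/
def cornerRowMul (a : A) : CornerRow he →ₗ[he.Corner] CornerRow he where
  toFun x := ⟨x.1 * a, by
    rw [mem_idemPart, smul_eq_mul, ← mul_assoc, ← smul_eq_mul e, x.2]⟩
  map_add' x y := Subtype.ext (add_mul _ _ _)
  map_smul' c x := Subtype.ext (mul_assoc _ _ _)

/-- The coinduced `A`-module `Hom(e A, N)`. -/
def Coind (N : Type w) [AddCommGroup N] [Module he.Corner N] : Type w :=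
  CornerRow he →ₗ[he.Corner] N

variable {N : Type w} [AddCommGroup N] [Module he.Corner N] in
/-- An element of `Coind he N` as a linear map. -/
def Coind.hom (f : Coind he N) : CornerRow he →ₗ[he.Corner] N := f

instance (N : Type w) [AddCommGroup N] [Module he.Corner N] : AddCommGroup (Coind he N) :=
  inferInstanceAs (AddCommGroup (CornerRow he →ₗ[he.Corner] N))

/-- `A` acts by precomposition with right multiplication on `e A`, which turns the right action on
`e A` into a left action on maps. -/
instance (N : Type w) [AddCommGroup N] [Module he.Corner N] : Module A (Coind he N) where
  smul a f := LinearMap.comp (Coind.hom he f) (cornerRowMul he a)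
  one_smul f := LinearMap.ext fun x => congrArg (Coind.hom he f)
    (Subtype.ext (mul_one x.1))
  mul_smul a b f := LinearMap.ext fun x =>
    congrArg (Coind.hom he f)
      (Subtype.ext (mul_assoc x.1 a b).symm)
  smul_zero a := rfl
  smul_add a f g := rfl
  add_smul a b f := LinearMap.ext fun x => by
    refine (congrArg (Coind.hom he f)
      (Subtype.ext (mul_add x.1 a b))).trans (map_add (Coind.hom he f) _ _)
  zero_smul f := LinearMap.ext fun x => by
    refine (congrArg (Coind.hom he f)
      (Subtype.ext (mul_zero x.1))).trans (map_zero (Coind.hom he f))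

/-- The idempotent as an element of `e A`. -/
def rowIdem : CornerRow he := ⟨e, he⟩

/-- Right multiplication by `e` as a linear map from `e A` to `e A e`. -/
def rowToCorner : CornerRow he →ₗ[he.Corner] he.Corner where
  toFun x := ⟨x.1 * e, x.1, by
    change e * x.1 * e = _
    rw [show e * x.1 = x.1 from x.2]⟩
  map_add' x y := Subtype.ext (add_mul _ _ _)
  map_smul' c x := Subtype.ext (mul_assoc _ _ _)

/-- `e Hom(e A, N) = N`. -/
def idemPartCoind (N : Type w) [AddCommGroup N] [Module he.Corner N] :
    idemPart he (Coind he N) ≃ₗ[he.Corner] N where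
  toFun f := Coind.hom he f.1 (rowIdem he)
  invFun n := ⟨(LinearMap.toSpanSingleton he.Corner N n).comp (rowToCorner he),
    LinearMap.ext fun x => by
      change (rowToCorner he (cornerRowMul he e x)) • n = rowToCorner he x • n
      congr 1
      refine Subtype.ext ?_
      change x.1 * e * e = x.1 * e
      rw [mul_assoc, he.eq]⟩
  map_add' f g := rfl
  map_smul' c f := by
    change Coind.hom he f.1 (cornerRowMul he c.1 (rowIdem he)) =
      c • Coind.hom he f.1 (rowIdem he)
    rw [← map_smul (Coind.hom he f.1)]
    congr 1
    refine Subtype.ext ?_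
    change e * c.1 = c.1 * e
    rw [corner_mul_left, corner_mul_right]
  -- `e • f = f` says that `f (x * e) = f x`, and `x * e` lies in the corner, so `f` is determined
  -- by its value at `e`.
  left_inv f := by
    refine Subtype.ext (LinearMap.ext fun x => ?_)
    change rowToCorner he x • Coind.hom he f.1 (rowIdem he) =
      Coind.hom he f.1 x
    have h : Coind.hom he f.1 (cornerRowMul he e x) =
        Coind.hom he f.1 x :=
      LinearMap.congr_fun (show (e • f.1 : Coind he N) = f.1 from f.2) x
    rw [← h, ← map_smul (Coind.hom he f.1)]
    congr 1
    refine Subtype.ext ?_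
    change x.1 * e * e = x.1 * e
    rw [mul_assoc, he.eq]
  right_inv n := by
    change rowToCorner he (rowIdem he) • n = n
    have h : rowToCorner he (rowIdem he) = 1 := Subtype.ext he
    rw [h, one_smul]

/-- A map is recovered from its restriction to `e M` by fullness of `e`, which gives faithfulness
and fullness of the functor. Essential surjectivity holds for every idempotent, since `e Hom(e A, N)
= N`. -/
theorem cornerFunctor_isEquivalence {ι : Type} [Fintype ι] {x y : ι → A}
    (hxy : ∑ i, x i * e * y i = 1) : (cornerFunctor.{w} he).IsEquivalence where
  faithful := ⟨by
    intro M N f g h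
    ext m
    have h' : ∀ i, f.hom ((e * y i) • m) = g.hom ((e * y i) • m) := fun i =>
      congrArg Subtype.val (LinearMap.congr_fun (ModuleCat.hom_ext_iff.1 h)
        ⟨(e * y i) • m, idemPart_mul_smul_mem he _ _⟩)
    rw [← sum_smul_corner hxy m]
    simp only [map_sum, map_smul f.hom (x _), map_smul g.hom (x _), h']⟩
  full := ⟨fun {M N} g => ⟨ModuleCat.ofHom (extendCorner he hxy g.hom),
    ModuleCat.hom_ext (idemPartMap_extendCorner he hxy g.hom)⟩⟩
  essSurj := ⟨fun N => ⟨ModuleCat.of A (Coind he N), ⟨(idemPartCoind he N).toModuleIso⟩⟩⟩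

variable (R : Type) [CommRing R] [Algebra R A]

/-- A scalar `r` of the corner is `r e`, and `e` fixes `e M` pointwise. -/
instance : (cornerFunctor.{w} he).Linear R where
  map_smul {M N} f r := by
    ext m
    refine Subtype.ext ?_
    change algebraMap R A r • f.hom m.1 = (algebraMap R he.Corner r).1 • f.hom m.1
    have h : (algebraMap R he.Corner r).1 = algebraMap R A r * e := by
      rw [Algebra.algebraMap_eq_smul_one, Algebra.algebraMap_eq_smul_one, smul_mul_assoc, one_mul]
      rfl
    rw [h, mul_smul, ← map_smul f.hom e, show e • m.1 = m.1 from m.2]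

/-- An algebra that is isomorphic to `A` is Morita equivalent to every algebra that is isomorphic to
a full corner of `A`. -/
theorem isMoritaEquivalent_of_corner {ι : Type} [Fintype ι] {x y : ι → A}
    (hxy : ∑ i, x i * e * y i = 1) {B : Type w} [Ring B] [Algebra R B] (φ : B ≃ₐ[R] A)
    {C : Type} [Ring C] [Algebra R C] (ψ : C ≃ₐ[R] he.Corner) : IsMoritaEquivalent R B C :=
  have := cornerFunctor_isEquivalence.{w} he hxy
  let E : ModuleCat.{w} B ≌ ModuleCat.{w} A :=
    ModuleCat.restrictScalarsEquivalenceOfRingEquiv φ.symm.toRingEquiv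
  let F : ModuleCat.{w} he.Corner ≌ ModuleCat.{w} C :=
    ModuleCat.restrictScalarsEquivalenceOfRingEquiv ψ.toRingEquiv
  have : E.functor.Linear R :=
    ModuleCat.Algebra.restrictScalarsEquivalenceOfRingEquiv_linear (R₀ := R) φ.symm
  have : F.functor.Linear R :=
    ModuleCat.Algebra.restrictScalarsEquivalenceOfRingEquiv_linear (R₀ := R) ψ
  ⟨⟨{ eqv := (E.trans (cornerFunctor.{w} he).asEquivalence).trans F
      linear := inferInstanceAs (((E.functor ⋙ cornerFunctor.{w} he) ⋙ F.functor).Linear R) }⟩⟩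

end FullCorner
end KraussS3

namespace KraussS3

/-! ## Algebra maps out of path algebras -/

section PathLift

variable {R V C : Type} [CommRing R] [Quiver.{0} V] [Ring C] [Algebra R C]

namespace PathAlgebra

variable (v : V → C) (t : ∀ {a b : V}, (a ⟶ b) → C)

/-- The product of the values of the arrows of a path. -/
def pathVal {a : V} : {b : V} → Quiver.Path a b → C
  -- Every value starts with the factor `v a`, so that `t α * v b = t α` suffices as an assumption
  -- on arrows and `v a * t α = t α` is not needed.
  | _, .nil => v a
  | _, .cons p α => pathVal p * t α

variable {v} {t}

theorem pathVal_mul_vertex (hv : ∀ a, v a * v a = v a)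
    (ht : ∀ {a b : V} (α : a ⟶ b), t α * v b = t α) {a b : V} (p : Quiver.Path a b) :
    pathVal v t p * v b = pathVal v t p := by
  cases p with
  | nil => exact hv a
  | cons p α => rw [pathVal, mul_assoc, ht]

theorem pathVal_comp (hv : ∀ a, v a * v a = v a)
    (ht : ∀ {a b : V} (α : a ⟶ b), t α * v b = t α) {a b c : V} (p : Quiver.Path a b)
    (q : Quiver.Path b c) : pathVal v t (p.comp q) = pathVal v t p * pathVal v t q := by
  induction q with
  | nil => exact (pathVal_mul_vertex hv ht p).symm
  | cons q α ih => rw [Quiver.Path.comp_cons, pathVal, ih, pathVal, mul_assoc]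

theorem vertex_mul_pathVal (hv : ∀ a, v a * v a = v a)
    {a b : V} (p : Quiver.Path a b) :
    v a * pathVal v t p = pathVal v t p := by
  induction p with
  | nil => exact hv a
  | cons p α ih => rw [pathVal, ← mul_assoc, ih]

theorem pathVal_mul_of_ne (hv : ∀ a, v a * v a = v a) (hv' : ∀ a b, a ≠ b → v a * v b = 0)
    (ht : ∀ {a b : V} (α : a ⟶ b), t α * v b = t α)
    {a b c d : V} (p : Quiver.Path a b)
    (q : Quiver.Path c d) (h : c ≠ b) : pathVal v t p * pathVal v t q = 0 := by
  rw [← pathVal_mul_vertex hv ht p, ← vertex_mul_pathVal hv q, mul_assoc, ← mul_assoc (v b),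
    hv' b c h.symm, zero_mul, mul_zero]

variable (R) (v) (t) in
/-- The linear map out of the path algebra with prescribed values on vertices and arrows. -/
noncomputable def liftLinear : PathAlgebra R V →ₗ[R] C :=
  Finsupp.lift C R (Σ a b : V, Quiver.Path a b) fun p => pathVal v t p.2.2

theorem liftLinear_ofPath {a b : V} (p : Quiver.Path a b) :
    liftLinear R v t (ofPath R p) = pathVal v t p :=
  (Finsupp.lift_apply _ _ _ _ _).trans ((Finsupp.sum_single_index
    (h := fun (q : Σ a b : V, Quiver.Path a b) (r : R) => r • pathVal v t q.2.2)
    (zero_smul R _)).trans (one_smul R _))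

variable [DecidableEq V] [Fintype V]

/-- The algebra map out of the path algebra given by a complete family of orthogonal idempotents
and elements for the arrows that are compatible with it. -/
noncomputable def liftAlgHom (hv : ∀ a, v a * v a = v a) (hv' : ∀ a b, a ≠ b → v a * v b = 0)
    (hv1 : ∑ a, v a = 1)
    (ht : ∀ {a b : V} (α : a ⟶ b), t α * v b = t α) : PathAlgebra R V →ₐ[R] C :=
  AlgHom.ofLinearMap (liftLinear R v t)
    (by
      change liftLinear R v t (∑ a, vertex R a) = 1
      rw [map_sum, ← hv1]
      exact Finset.sum_congr rfl fun a _ => liftLinear_ofPath _)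
    (by
      intro f g
      induction f using induction_linear with
      | zero => simp
      | add f f' hf hf' => simp only [add_mul, map_add, hf, hf']
      | smul r a b p =>
        induction g using induction_linear with
        | zero => simp
        | add g g' hg hg' => simp only [mul_add, map_add, hg, hg']
        | smul s c d q =>
          simp only [smul_mul_assoc, mul_smul_comm, map_smul]
          congr 2
          by_cases h : c = b
          · subst h
            rw [ofPath_mul_comp, liftLinear_ofPath, liftLinear_ofPath, liftLinear_ofPath,
              pathVal_comp hv ht]
          · rw [ofPath_mul_of_ne _ _ _ h, map_zero, liftLinear_ofPath, liftLinear_ofPath,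
              pathVal_mul_of_ne hv hv' ht _ _ h])

theorem liftAlgHom_ofPath (hv : ∀ a, v a * v a = v a) (hv' : ∀ a b, a ≠ b → v a * v b = 0)
    (hv1 : ∑ a, v a = 1)
    (ht : ∀ {a b : V} (α : a ⟶ b), t α * v b = t α)
    {a b : V} (p : Quiver.Path a b) :
    liftAlgHom (R := R) hv hv' hv1 ht (ofPath R p) = pathVal v t p :=
  liftLinear_ofPath p

end PathAlgebra

end PathLift

/-! ## Linear combinations of the ten nonzero paths -/

section PsiCombination

open PsiArrow PsiVertex

variable {R C D : Type} [CommRing R] [Ring C] [Algebra R C] [Ring D] [Algebra R D]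

/-- The linear combination of ten elements that correspond to the nonzero paths of `RΨ/I`. -/
def psiCombination (E : PsiVertex → C) (T : ∀ {a b : PsiVertex}, PsiArrow a b → C)
    (c : Fin 10 → R) : C :=
  c 0 • E e3 + c 1 • E e4 + c 2 • E e5 + c 3 • E e6 + c 4 • T tau1 + c 5 • T tau2 +
    c 6 • T tau3 + c 7 • T tau4 + c 8 • (T tau1 * T tau2) + c 9 • (T tau3 * T tau4)

variable (E : PsiVertex → C) (T : ∀ {a b : PsiVertex}, PsiArrow a b → C)

theorem psiCombination_zero : psiCombination E T (0 : Fin 10 → R) = 0 := by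
  simp [psiCombination]

theorem psiCombination_add (c d : Fin 10 → R) :
    psiCombination E T (c + d) = psiCombination E T c + psiCombination E T d := by
  simp only [psiCombination, Pi.add_apply, add_smul]
  abel

theorem psiCombination_smul (r : R) (c : Fin 10 → R) :
    psiCombination E T (r • c) = r • psiCombination E T c := by
  simp only [psiCombination, Pi.smul_apply, smul_eq_mul, smul_add, mul_smul]

theorem map_psiCombination (f : C →ₐ[R] D) (c : Fin 10 → R) :
    f (psiCombination E T c) = psiCombination (fun a => f (E a)) (fun {_ _} α => f (T α)) c := by
  simp only [psiCombination, map_add, map_smul, map_mul]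

theorem vertex_mem_range_psiCombination (a : PsiVertex) :
    E a ∈ Set.range (psiCombination (R := R) E T) := by
  cases a
  · exact ⟨![1, 0, 0, 0, 0, 0, 0, 0, 0, 0], by simp [psiCombination]⟩
  · exact ⟨![0, 1, 0, 0, 0, 0, 0, 0, 0, 0], by simp [psiCombination]⟩
  · exact ⟨![0, 0, 1, 0, 0, 0, 0, 0, 0, 0], by simp [psiCombination]⟩
  · exact ⟨![0, 0, 0, 1, 0, 0, 0, 0, 0, 0], by simp [psiCombination]⟩

/-- The hypothesis `h0` is the content of the relations: nothing survives that enters `e6` by an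
arrow and then continues. Hence a word can only be prolonged from a vertex, or from `T tau1` by `T
tau2`, or from `T tau3` by `T tau4`, and the ten words stay closed under right multiplication by
arrows. -/
theorem psiCombination_mul_arrow
    (hE : ∀ {a b c : PsiVertex} (β : PsiArrow b c), E a * T β = if a = b then T β else 0)
    (h0 : ∀ {a b c d : PsiVertex} (α : PsiArrow a b) (β : PsiArrow c d), b = e6 → T α * T β = 0)
    (hT : ∀ {a b c d : PsiVertex} (α : PsiArrow a b) (β : PsiArrow c d), c ≠ b → T α * T β = 0)
    (c : Fin 10 → R) {a b : PsiVertex} (β : PsiArrow a b) :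
    psiCombination E T c * T β ∈ Set.range (psiCombination (R := R) E T) := by
  have h2 := fun {a b : PsiVertex} (β : PsiArrow a b) => h0 tau2 β rfl
  have h4 := fun {a b : PsiVertex} (β : PsiArrow a b) => h0 tau4 β rfl
  cases β with
  | tau1 => exact ⟨![0, 0, 0, 0, c 3, 0, 0, 0, 0, 0], by
      simp [psiCombination, add_mul, hE, mul_assoc, h2, h4, hT tau1 tau1, hT tau3 tau1]⟩
  | tau2 => exact ⟨![0, 0, 0, 0, 0, c 0, 0, 0, c 4, 0], by
      simp [psiCombination, add_mul, hE, mul_assoc, h2, h4, hT tau3 tau2]⟩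
  | tau3 => exact ⟨![0, 0, 0, 0, 0, 0, c 3, 0, 0, 0], by
      simp [psiCombination, add_mul, hE, mul_assoc, h2, h4, hT tau1 tau3, hT tau3 tau3]⟩
  | tau4 => exact ⟨![0, 0, 0, 0, 0, 0, 0, c 1, 0, c 6], by
      simp [psiCombination, add_mul, hE, mul_assoc, h2, h4, hT tau1 tau4]⟩

end PsiCombination

/-! ## The corner of the order and the path algebra modulo relations -/

section CornerPsi

variable (R : Type) [CommRing R]

variable {R}

open CornerLambda3 Lambda3

/-- The block matrix of an element of `Λ'`. -/
def cornerVal (a : CornerLambda3 R) : BlockOrder R := a.1.1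

theorem cornerLambda3_ext {a b : CornerLambda3 R} (h : cornerVal a = cornerVal b) : a = b :=
  Subtype.ext (Subtype.ext h)

theorem cornerVal_mul (a b : CornerLambda3 R) :
    cornerVal (a * b) = cornerVal a * cornerVal b := rfl
theorem cornerVal_add (a b : CornerLambda3 R) :
    cornerVal (a + b) = cornerVal a + cornerVal b := rfl
theorem cornerVal_smul (r : R) (a : CornerLambda3 R) : cornerVal (r • a) = r • cornerVal a := rfl
theorem cornerVal_zero : cornerVal (0 : CornerLambda3 R) = 0 := rfl
theorem cornerVal_one : cornerVal (1 : CornerLambda3 R) = (cornerIdem R).1 := rfl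

theorem cornerVal_e3 : cornerVal (e R .e3) = (e3 R).1 := rfl
theorem cornerVal_e4 : cornerVal (e R .e4) = (e4 R).1 := rfl
theorem cornerVal_e5 : cornerVal (e R .e5) = (e5 R).1 := rfl
theorem cornerVal_e6 : cornerVal (e R .e6) = (e6 R).1 := rfl
theorem cornerVal_tau1 : cornerVal (tau R .tau1) = (tau1 R).1 := rfl
theorem cornerVal_tau2 : cornerVal (tau R .tau2) = (tau2 R).1 := rfl
theorem cornerVal_tau3 : cornerVal (tau R .tau3) = (tau3 R).1 := rfl
theorem cornerVal_tau4 : cornerVal (tau R .tau4) = (tau4 R).1 := rfl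

/-- Multiplication by the idempotent on both sides removes the first two rows and columns. Ten
scalars remain, as many as there are nonzero paths. -/
theorem cornerVal_eq (c : CornerLambda3 R) :
    cornerVal c = ⟨Matrix.single 2 2 ((cornerVal c).s 2 2), Pi.single 2 ((cornerVal c).t 2), (cornerVal c).u,
      (cornerVal c).v, (cornerVal c).w, Pi.single 2 ((cornerVal c).x 2), (cornerVal c).y, (cornerVal c).z₁,
      (cornerVal c).z₂, (cornerVal c).z₃⟩ := by
  have hl : (cornerIdem R).1 * cornerVal c = cornerVal c :=
    congrArg Subtype.val (corner_mul_left _ c)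
  have hr : cornerVal c * (cornerIdem R).1 = cornerVal c :=
    congrArg Subtype.val (corner_mul_right _ c)
  have hs : ∀ i j, (cornerVal c).s i j = (Matrix.single 2 2 ((cornerVal c).s 2 2) : Matrix _ _ R) i j := by
    intro i j
    have h := congrArg (fun z : BlockOrder R => z.s i j)
      ((congrArg (fun z => (cornerIdem R).1 * z) hr).trans hl)
    simp only [← h, cornerIdem, e3, e4, e5, e6]
    fin_cases i <;> fin_cases j <;>
      simp [Matrix.mul_apply, Matrix.single_apply]
  ext i j
  · exact hs i j
  · have h := congrArg (fun z : BlockOrder R => z.t i) hl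
    simp only [← h, cornerIdem, e3, e4, e5, e6]
    fin_cases i <;> simp [Matrix.single_apply]
  iterate 3 rfl
  · have h := congrArg (fun z : BlockOrder R => z.x i) hr
    simp only [← h, cornerIdem, e3, e4, e5, e6]
    fin_cases i <;> simp [Matrix.single_apply]
  iterate 4 rfl

variable (R)

theorem cornerLambda3_e_mul_e (a b : PsiVertex) :
    e R a * e R b = if a = b then e R a else 0 := by
  refine cornerLambda3_ext ?_
  cases a <;> cases b <;> ext i j <;>
    simp [cornerVal_mul, cornerVal_zero, cornerVal_e3, cornerVal_e4, cornerVal_e5, cornerVal_e6,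
      e3, e4, e5, e6]

theorem cornerLambda3_sum_e : ∑ a, e R a = 1 := by
  have h : (Finset.univ : Finset PsiVertex) = {.e3, .e4, .e5, .e6} := rfl
  rw [h, Finset.sum_insert (by decide), Finset.sum_insert (by decide),
    Finset.sum_insert (by decide), Finset.sum_singleton]
  refine cornerLambda3_ext ?_
  ext i j <;>
    simp [cornerVal_add, cornerVal_one, cornerVal_e3, cornerVal_e4, cornerVal_e5, cornerVal_e6,
      cornerIdem, e3, e4, e5, e6]

theorem cornerLambda3_tau_mul_e {a b : PsiVertex} (α : PsiArrow a b) :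
    tau R α * e R b = tau R α := by
  refine cornerLambda3_ext ?_
  cases α <;> ext i j <;> simp [cornerVal_mul, cornerVal_tau1, cornerVal_tau2,
    cornerVal_tau3, cornerVal_tau4, cornerVal_e3, cornerVal_e4, cornerVal_e6, e3, e4, e6, tau1,
    tau2, tau3, tau4, Fin.sum_univ_three, Pi.single_apply, Matrix.single_apply, eq_comm]

theorem cornerLambda3_e_mul_tau {a b : PsiVertex} (α : PsiArrow a b) :
    e R a * tau R α = tau R α := by
  refine cornerLambda3_ext ?_
  cases α <;> ext i j <;> simp [cornerVal_mul, cornerVal_tau1, cornerVal_tau2,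
    cornerVal_tau3, cornerVal_tau4, cornerVal_e3, cornerVal_e4, cornerVal_e6, e3, e4, e6, tau1,
    tau2, tau3, tau4, Pi.single_apply, Matrix.single_apply, eq_comm]

/-- The algebra map from the path algebra of `Ψ` to `Λ'`. -/
noncomputable def pathToCorner : PathAlgebra R PsiVertex →ₐ[R] CornerLambda3 R :=
  PathAlgebra.liftAlgHom (v := e R) (t := fun {_ _} α => tau R α)
    (fun a => by rw [cornerLambda3_e_mul_e, if_pos rfl])
    (fun a b h => by rw [cornerLambda3_e_mul_e, if_neg h])
    (cornerLambda3_sum_e R) (cornerLambda3_tau_mul_e R)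

theorem pathToCorner_vertex (a : PsiVertex) :
    pathToCorner R (PathAlgebra.vertex R a) = e R a :=
  PathAlgebra.liftAlgHom_ofPath _ _ _ _ _

theorem pathToCorner_arrow {a b : PsiVertex} (α : PsiArrow a b) :
    pathToCorner R (psiArrow R α) = tau R α :=
  (PathAlgebra.liftAlgHom_ofPath _ _ _ _ _).trans (cornerLambda3_e_mul_tau R α)

/-- The four generators go to products of type `v · y`, `v · x`, `t · x`, `t · y`, which are zero in
`A_R` by convention. -/
theorem psiIdeal_le_ker : psiIdeal R ≤ TwoSidedIdeal.ker (pathToCorner R) := by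
  refine TwoSidedIdeal.span_le.2 ?_
  rintro _ (rfl | rfl | rfl | rfl) <;> rw [SetLike.mem_coe, TwoSidedIdeal.mem_ker, map_mul,
    pathToCorner_arrow, pathToCorner_arrow] <;> refine cornerLambda3_ext ?_ <;> ext i j <;>
    simp [cornerVal_mul, cornerVal_zero, cornerVal_tau1, cornerVal_tau2,
    cornerVal_tau3, cornerVal_tau4, tau1, tau2, tau3, tau4]

/-- The algebra map from `RΨ/I` to `Λ'`. -/
noncomputable def psiToCorner : PsiAlgebra R →ₐ[R] CornerLambda3 R :=
  (psiIdeal R).ringCon.liftₐ (pathToCorner R)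
    (TwoSidedIdeal.ringCon_le_iff.1 (psiIdeal_le_ker R))

theorem psiToCorner_psiE (a : PsiVertex) : psiToCorner R (psiE R a) = e R a :=
  pathToCorner_vertex R a

theorem psiToCorner_psiTau {a b : PsiVertex} (α : PsiArrow a b) :
    psiToCorner R (psiTau R α) = tau R α :=
  pathToCorner_arrow R α

theorem psiTau_mul_of_ne {a b c d : PsiVertex} (α : PsiArrow a b) (β : PsiArrow c d) (h : c ≠ b) :
    psiTau R α * psiTau R β = 0 := by
  rw [psiTau, psiTau, ← map_mul, psiArrow, psiArrow, PathAlgebra.arrow, PathAlgebra.arrow,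
    PathAlgebra.ofPath_mul_of_ne _ _ _ h, map_zero]

theorem psiE_mul_psiTau {a b c : PsiVertex} (β : PsiArrow b c) :
    psiE R a * psiTau R β = if a = b then psiTau R β else 0 := by
  rw [psiTau, psiE, ← map_mul, psiArrow, PathAlgebra.arrow, PathAlgebra.vertex]
  split_ifs with h
  · subst h
    rw [PathAlgebra.ofPath_mul_comp, Quiver.Path.nil_comp]
  · rw [PathAlgebra.ofPath_mul_of_ne _ _ _ (Ne.symm h), map_zero]

theorem psiTau_mul_eq_zero {a b c d : PsiVertex} (α : PsiArrow a b) (β : PsiArrow c d)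
    (h : b = .e6) : psiTau R α * psiTau R β = 0 := by
  by_cases hb : c = b
  · subst hb
    have h0 : ∀ z ∈ psiIdeal R, (psiIdeal R).ringCon.mk' z = 0 := fun z hz =>
      (RingCon.eq _).2 ((TwoSidedIdeal.mem_iff _ _).1 hz)
    rw [psiTau, psiTau, ← map_mul]
    cases α <;> cases β <;> first
      | exact absurd h (by decide)
      | exact h0 _ (TwoSidedIdeal.subset_span (by simp))
  · exact psiTau_mul_of_ne R α β hb

/-- Paths are built by appending arrows, so closure under right multiplication by arrows is enough.
-/
theorem mk_ofPath_mem_range {a b : PsiVertex} (p : Quiver.Path a b) :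
    (psiIdeal R).ringCon.mkₐ R (PathAlgebra.ofPath R p) ∈
      Set.range (psiCombination (R := R) (psiE R) (psiTau R)) := by
  induction p with
  | nil => exact vertex_mem_range_psiCombination (psiE R) (psiTau R) _
  | cons p α ih =>
    have h : PathAlgebra.ofPath R (p.cons α) = PathAlgebra.ofPath R p * psiArrow R α :=
      (PathAlgebra.ofPath_mul_comp R p α.toPath).symm
    rw [h, map_mul]
    obtain ⟨c, hc⟩ := ih
    rw [← hc]
    exact psiCombination_mul_arrow (psiE R) (psiTau R) (psiE_mul_psiTau R) (psiTau_mul_eq_zero R)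
      (psiTau_mul_of_ne R) c α

theorem psiCombination_surjective :
    Function.Surjective (psiCombination (R := R) (psiE R) (psiTau R)) := by
  intro z
  obtain ⟨f, rfl⟩ := RingCon.mkₐ_surjective (α := R) (psiIdeal R).ringCon z
  induction f using PathAlgebra.induction_linear with
  | zero => exact ⟨0, by rw [psiCombination_zero, map_zero]⟩
  | add f g hf hg =>
    obtain ⟨c, hc⟩ := hf
    obtain ⟨d, hd⟩ := hg
    exact ⟨c + d, by rw [map_add, ← hc, ← hd, psiCombination_add]⟩
  | smul r a b p =>
    obtain ⟨c, hc⟩ := mk_ofPath_mem_range R p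
    exact ⟨r • c, by rw [map_smul, ← hc, psiCombination_smul]⟩

/-- The entry `z₂` comes from `τ₁ τ₂ = 3 η` and `τ₃ τ₄ = ξ - 12 η`. The coordinates are triangular,
with a factor 3 only in `x` and `z₂`, where `Λ` demands divisibility by 3. -/
theorem psiToCorner_psiCombination (c : Fin 10 → R) :
    cornerVal (psiToCorner R (psiCombination (psiE R) (psiTau R) c)) =
      ⟨Matrix.single 2 2 (c 0), Pi.single 2 (c 5), c 1, c 7, c 2, Pi.single 2 (c 4 * 3), c 6, c 3,
        3 * c 8 - 12 * c 9, c 9⟩ := by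
  rw [map_psiCombination]
  simp only [psiCombination, psiToCorner_psiE, psiToCorner_psiTau, cornerVal_add, cornerVal_smul,
    cornerVal_mul, cornerVal_e3, cornerVal_e4, cornerVal_e5, cornerVal_e6, cornerVal_tau1,
    cornerVal_tau2, cornerVal_tau3, cornerVal_tau4]
  ext i j <;> simp [e3, e4, e5, e6, tau1, tau2, tau3, tau4, Pi.single_apply, Matrix.single_apply]
  ring

variable {R}

/-- Injectivity needs that 3 can be cancelled; for surjectivity the congruences that define `Λ`
supply the quotients by 3. -/
theorem psiToCorner_bijective [NoZeroDivisors R] (h3 : (3 : R) ≠ 0) :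
    Function.Bijective (psiToCorner R) := by
  constructor
  · rw [injective_iff_map_eq_zero]
    intro z hz
    obtain ⟨c, rfl⟩ := psiCombination_surjective R z
    have h := psiToCorner_psiCombination R c
    rw [hz, cornerVal_zero] at h
    have h0 := congrArg (fun z : BlockOrder R => z.s 2 2) h
    have h1 := congrArg BlockOrder.u h
    have h2 := congrArg BlockOrder.w h
    have h3' := congrArg BlockOrder.z₁ h
    have h4 := congrArg (fun z : BlockOrder R => z.x 2) h
    have h5 := congrArg (fun z : BlockOrder R => z.t 2) h
    have h6 := congrArg BlockOrder.y h
    have h7 := congrArg BlockOrder.v h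
    have h8 := congrArg BlockOrder.z₂ h
    have h9 := congrArg BlockOrder.z₃ h
    simp only [BlockOrder.zero_s, BlockOrder.zero_u, BlockOrder.zero_w, BlockOrder.zero_z₁,
      BlockOrder.zero_x, BlockOrder.zero_t, BlockOrder.zero_y, BlockOrder.zero_v,
      BlockOrder.zero_z₂, BlockOrder.zero_z₃, Matrix.single_apply_same, Pi.single_eq_same,
      Matrix.zero_apply, Pi.zero_apply] at h0 h1 h2 h3' h4 h5 h6 h7 h8 h9
    rw [← h9, mul_zero, sub_zero, eq_comm, mul_eq_zero, or_iff_right h3] at h8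
    rw [eq_comm, mul_eq_zero, or_iff_left h3] at h4
    have hc : c = 0 := by
      ext i
      fin_cases i <;> simp [← h0, ← h1, ← h2, ← h3', h4, ← h5, ← h6, ← h7, h8, ← h9]
    rw [hc, psiCombination_zero]
  · intro a
    obtain ⟨x, hx⟩ : (3 : R) ∣ (cornerVal a).x 2 := a.1.2.1 2
    obtain ⟨z, hz⟩ : (3 : R) ∣ (cornerVal a).z₂ := a.1.2.2
    -- The coefficient `z + 4 z₃` of `τ₁ τ₂` makes up for the summand `-12 η` of `τ₃ τ₄`: `3 (z + 4
    -- z₃) - 12 z₃ = 3 z`.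
    refine ⟨psiCombination (psiE R) (psiTau R) ![(cornerVal a).s 2 2,
      (cornerVal a).u, (cornerVal a).w, (cornerVal a).z₁, x, (cornerVal a).t 2, (cornerVal a).y,
      (cornerVal a).v, z + 4 * (cornerVal a).z₃, (cornerVal a).z₃], cornerLambda3_ext ?_⟩
    rw [psiToCorner_psiCombination, cornerVal_eq a]
    ext i j <;> simp [hx, hz, mul_comm]
    ring

/-- The isomorphism of `RΨ/I` and `Λ'`. -/
noncomputable def psiEquivCorner [NoZeroDivisors R] (h3 : (3 : R) ≠ 0) :
    PsiAlgebra R ≃ₐ[R] CornerLambda3 R :=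
  AlgEquiv.ofBijective (psiToCorner R) (psiToCorner_bijective h3)

/-- `Λ'` is a full corner of `Λ`. -/
theorem cornerIdem_full :
    ∃ x y : Fin 3 → Lambda3 R, ∑ i, x i * cornerIdem R * y i = 1 := by
  let m (i j : Fin 3) : Lambda3 R :=
    ⟨{ (0 : BlockOrder R) with s := Matrix.single i j 1 }, by simp [Lambda3]⟩
  -- Matrix units passing through the index `2` give the two diagonal idempotents missing from the
  -- corner; the last summand is the idempotent itself.
  refine ⟨![m 0 2, m 1 2, 1], ![m 2 0, m 2 1, cornerIdem R], ?_⟩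
  simp only [Fin.sum_univ_three, Matrix.cons_val]
  refine Subtype.ext ?_
  ext i j
  · fin_cases i <;> fin_cases j <;>
      simp [m, cornerIdem, e3, e4, e5, e6]
  all_goals simp [m, cornerIdem, e3, e4, e5, e6, Matrix.single_apply]

end CornerPsi
end KraussS3

namespace KraussS3

open MulOpposite

/-! ## Transitive bisets -/

section Transitive

variable {G : Type} [Group G]

namespace Biset

theorem Iso.of_bijective {M N : Biset G} (f : M.carrier → N.carrier) (hf : Function.Bijective f)
    (hl : ∀ (g : G) m, f (g • m) = g • f m) (hr : ∀ (g : G) m, f (op g • m) = op g • f m) :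
    Iso M N :=
  ⟨Equiv.ofBijective f hf, hl, hr⟩

/-- The set `(G × G) / L`. -/
def Coset (L : Subgroup (G × G)) : Type := (G × G) ⧸ L

instance [Finite G] (L : Subgroup (G × G)) : Finite (Coset L) :=
  inferInstanceAs (Finite ((G × G) ⧸ L))

instance (L : Subgroup (G × G)) : MulAction (G × G) (Coset L) :=
  inferInstanceAs (MulAction (G × G) ((G × G) ⧸ L))

instance (L : Subgroup (G × G)) : MulAction G (Coset L) :=
  MulAction.compHom _ (MonoidHom.inl G G)

instance (L : Subgroup (G × G)) : MulAction Gᵐᵒᵖ (Coset L) :=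
  MulAction.compHom _ ((MonoidHom.inr G G).comp (MulEquiv.inv' G).symm.toMonoidHom)

instance (L : Subgroup (G × G)) : SMulCommClass G Gᵐᵒᵖ (Coset L) := ⟨fun g h z => by
  change ((g, (1 : G)) • ((1 : G), (unop h)⁻¹) • z) = ((1 : G), (unop h)⁻¹) • (g, (1 : G)) • z
  rw [← mul_smul, ← mul_smul]
  simp⟩

/-- The transitive biset `(G × G) / L`, with `g (x, y) h = (g x, h⁻¹ y)`. -/
def ofSubgroup [Finite G] (L : Subgroup (G × G)) : Biset G where
  carrier := Coset L

/-! ### Orbits of bisets as coset bisets. -/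

section OrbitMap

variable [Finite G] {L : Subgroup (G × G)}

/-- The class of `(x, y)` in `(G × G) / L`. -/
def point (L : Subgroup (G × G)) (x y : G) : (ofSubgroup L).carrier := QuotientGroup.mk (x, y)

theorem smul_point (g x y : G) : g • point L x y = point L (g * x) y :=
  congrArg (QuotientGroup.mk (s := L)) (Prod.ext rfl (one_mul y))

theorem op_smul_point (g x y : G) : op g • point L x y = point L x (g⁻¹ * y) :=
  congrArg (QuotientGroup.mk (s := L)) (Prod.ext (one_mul x) rfl)

theorem point_eq_point {x y x' y' : G} :
    point L x y = point L x' y' ↔ (x⁻¹ * x', y⁻¹ * y') ∈ L :=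
  QuotientGroup.eq

theorem point_ind {p : (ofSubgroup L).carrier → Prop} (h : ∀ x y, p (point L x y)) (z) : p z := by
  obtain ⟨⟨x, y⟩⟩ := z
  exact h x y

/-- The pair `(g, h)` acts on a biset by `m ↦ g m h⁻¹`, so its fixing `m` takes the form `g m = m
h`. -/
theorem smul_point_one_eq_iff {g h : G} :
    g • point L 1 1 = op h • point L 1 1 ↔ (g, h) ∈ L := by
  rw [smul_point, op_smul_point, point_eq_point]
  simp only [mul_one, one_mul, inv_one]
  rw [← inv_mem_iff]
  simp

omit [Finite G] in
theorem smul_op_smul_eq_iff {M : Biset G} {m m' : M.carrier} {x y x' y' : G} :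
    x • op y⁻¹ • m = x' • op y'⁻¹ • m' ↔ m = (x⁻¹ * x') • op (y⁻¹ * y')⁻¹ • m' := by
  rw [smul_eq_iff_eq_inv_smul, op_inv, inv_smul_eq_iff]
  simp only [mul_smul, op_mul, op_inv, mul_inv_rev, inv_inv]
  rw [← smul_comm x⁻¹, ← smul_comm x']

/-- The map from `(G × G) / L` to a biset that is given by a point with stabilizer `L`. -/
def orbitMap {M : Biset G} (m : M.carrier) (hm : ∀ g h : G, g • m = op h • m ↔ (g, h) ∈ L) :
    (ofSubgroup L).carrier → M.carrier :=
  Quotient.lift (s := QuotientGroup.leftRel L) (fun p => p.1 • op p.2⁻¹ • m) (by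
    rintro ⟨x, y⟩ ⟨x', y'⟩ h
    have h' := QuotientGroup.leftRel_apply.1 h
    refine smul_op_smul_eq_iff.2 ?_
    rw [smul_comm, op_inv, eq_inv_smul_iff, eq_comm]
    exact (hm _ _).2 h')

variable {M : Biset G} {m : M.carrier} (hm : ∀ g h : G, g • m = op h • m ↔ (g, h) ∈ L)

theorem orbitMap_point (x y : G) : orbitMap m hm (point L x y) = x • op y⁻¹ • m := rfl

theorem orbitMap_injective : Function.Injective (orbitMap m hm) := by
  refine point_ind fun x y => point_ind fun x' y' h => ?_
  rw [orbitMap_point, orbitMap_point, smul_op_smul_eq_iff, smul_comm, op_inv, eq_inv_smul_iff,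
    eq_comm, hm] at h
  exact point_eq_point.2 h

theorem orbitMap_smul (g : G) (z) : orbitMap m hm (g • z) = g • orbitMap m hm z := by
  revert z
  refine point_ind fun x y => ?_
  rw [smul_point, orbitMap_point, orbitMap_point, mul_smul]

theorem orbitMap_op_smul (g : G) (z) : orbitMap m hm (op g • z) = op g • orbitMap m hm z := by
  revert z
  refine point_ind fun x y => ?_
  rw [op_smul_point, orbitMap_point, orbitMap_point, ← smul_comm x, mul_inv_rev, inv_inv, op_mul,
    mul_smul]

/-- A biset with a generating point is isomorphic to `(G × G) / L`, with `L` the stabilizer. -/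
theorem iso_ofSubgroup (hm : ∀ g h : G, g • m = op h • m ↔ (g, h) ∈ L)
    (hgen : ∀ z : M.carrier, ∃ x y : G, z = x • op y • m) :
    Iso M (ofSubgroup L) := by
  refine Iso.symm (Iso.of_bijective (orbitMap m hm) ⟨orbitMap_injective hm, fun z => ?_⟩
    (orbitMap_smul hm) (orbitMap_op_smul hm))
  obtain ⟨x, y, rfl⟩ := hgen z
  exact ⟨point L x y⁻¹, by rw [orbitMap_point, inv_inv]⟩

/-- A biset that is the disjoint union of the orbit of a point and the image of another biset. -/
theorem iso_sum (hm : ∀ g h : G, g • m = op h • m ↔ (g, h) ∈ L) {N : Biset G}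
    (f : N.carrier → M.carrier) (hf : Function.Injective f)
    (hl : ∀ (g : G) n, f (g • n) = g • f n) (hr : ∀ (g : G) n, f (op g • n) = op g • f n)
    (hgen : ∀ z : M.carrier, (∃ x y : G, z = x • op y • m) ∨ z ∈ Set.range f)
    (hdisj : ∀ (x y : G) n, x • op y • m ≠ f n) :
    Iso M (sum (ofSubgroup L) N) := by
  refine Iso.symm (Iso.of_bijective (M := sum (ofSubgroup L) N)
    (Sum.elim (orbitMap m hm) f) ⟨?_, fun z => ?_⟩ ?_ ?_)
  · refine Function.Injective.sumElim (orbitMap_injective hm) hf ?_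
    exact point_ind fun x y => hdisj x y⁻¹
  · rcases hgen z with ⟨x, y, rfl⟩ | ⟨n, rfl⟩
    · exact ⟨Sum.inl (point L x y⁻¹), by rw [Sum.elim_inl, orbitMap_point, inv_inv]⟩
    · exact ⟨Sum.inr n, rfl⟩
  · rintro g (z | z)
    · exact orbitMap_smul hm g z
    · exact hl g z
  · rintro g (z | z)
    · exact orbitMap_op_smul hm g z
    · exact hr g z

end OrbitMap

end Biset

/-! ### Products of transitive bisets (Mackey formula). -/

namespace BisetClass

variable [Finite G]

/-- The isomorphism class of `(G × G) / L`. -/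
def trans (L : Subgroup (G × G)) : BisetClass G := mk (Biset.ofSubgroup L)

open Biset

theorem mk_eq_trans {M : Biset G} {L : Subgroup (G × G)} (m : M.carrier)
    (hm : ∀ g h : G, g • m = op h • m ↔ (g, h) ∈ L)
    (hgen : ∀ z : M.carrier, ∃ x y : G, z = x • op y • m) : mk M = trans L :=
  Quotient.sound (iso_ofSubgroup hm hgen)

theorem one_eq_trans {L : Subgroup (G × G)} (hL : ∀ g h : G, (g, h) ∈ L ↔ g = h) :
    (1 : BisetClass G) = trans L := by
  refine mk_eq_trans (M := unit G) (1 : G) (fun g h => ?_) (fun (z : G) => ⟨z, 1, ?_⟩)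
  · rw [hL]
    change g * 1 = 1 * h ↔ g = h
    rw [mul_one, one_mul]
  · change z = z * (1 * 1)
    rw [mul_one, mul_one]

/-- Conjugate subgroups give isomorphic transitive bisets. -/
theorem trans_eq_of_conj {L L' : Subgroup (G × G)} (x y : G)
    (h : ∀ g k : G, (g, k) ∈ L' ↔ (x⁻¹ * g * x, y⁻¹ * k * y) ∈ L) : trans L = trans L' := by
  refine mk_eq_trans (M := ofSubgroup L) (point L x y) (fun g k => ?_)
    (point_ind fun a b => ⟨a * x⁻¹, y * b⁻¹, ?_⟩)
  · rw [smul_point, op_smul_point, point_eq_point, h, ← inv_mem_iff]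
    simp [mul_assoc]
  · rw [op_smul_point, smul_point]
    simp

-- An equality in the tensor product is witnessed by an element `k` moved across the middle. With `n
-- = n'` this shows that the stabilizer of `m ⊗ n` is the composite, as relations, of the
-- stabilizers of `m` and `n`.
omit [Finite G] in
theorem smul_tmk_eq_iff {M N : Biset G} {m : M.carrier} {n n' : N.carrier} (g h : G) :
    g • tmk m n = op h • tmk m n' ↔ ∃ k : G, g • m = op k • m ∧ k • n = op h • n' := by
  rw [smul_tmk, op_smul_tmk]
  constructor
  · intro H
    obtain ⟨k, hk⟩ := Quotient.exact (s := tensorSetoid M N) H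
    refine ⟨k, ?_, (congrArg Prod.snd hk).symm⟩
    rw [eq_comm, smul_eq_iff_eq_inv_smul, ← op_inv]
    exact (congrArg Prod.fst hk)
  · rintro ⟨k, h1, h2⟩
    rw [h1, tmk_smul, h2]

/-- Orbits of the tensor product correspond to double cosets of the second projection of `L` and the
first projection of `L'`. The factors `a` and `b` of the middle element are absorbed by the outer
actions, and only the representative `c` remains. -/
theorem tensor_point_eq {L L' : Subgroup (G × G)} {a b x y u v u' v' c : G}
    (h1 : (x, a) ∈ L) (h2 : (b, y) ∈ L') (hk : v⁻¹ * u' = a * c * b) :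
    tmk (point L u v) (point L' u' v') =
      (u * x) • op (y * v'⁻¹) • tmk (point L 1 1) (c • point L' 1 1) := by
  have e1 := smul_point_one_eq_iff.2 h1
  have e2 := smul_point_one_eq_iff.2 h2
  have e3 : point L u v = op v⁻¹ • u • point L 1 1 := by
    rw [smul_point, op_smul_point]
    simp
  have e4 : point L' u' v' = u' • op v'⁻¹ • point L' 1 1 := by
    rw [op_smul_point, smul_point]
    simp
  rw [e3, e4, tmk_smul, ← mul_smul, hk, mul_smul, mul_smul, ← tmk_smul, ← smul_comm u, e1.symm,
    smul_comm b, e2, mul_smul, op_mul, mul_smul, op_smul_tmk, op_smul_tmk, smul_tmk, smul_tmk,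
    ← smul_comm c, ← smul_comm c]

/-- The Mackey formula for a single double coset, which is what `hgen` expresses; `L''` is the
composite relation. -/
theorem trans_mul_trans {L L' L'' : Subgroup (G × G)}
    (hgen : ∀ k : G, ∃ a b x y : G, (x, a) ∈ L ∧ (b, y) ∈ L' ∧ k = a * b)
    (h : ∀ g h : G, (g, h) ∈ L'' ↔ ∃ k, (g, k) ∈ L ∧ (k, h) ∈ L') :
    trans L * trans L' = trans L'' := by
  refine mk_eq_trans (M := tensor (ofSubgroup L) (ofSubgroup L'))
    (tmk (point L 1 1) (point L' 1 1)) (fun g k => ?_) ?_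
  · rw [h, smul_tmk_eq_iff]
    simp only [smul_point_one_eq_iff]
  · refine tensor_ind (point_ind fun u v => point_ind fun u' v' => ?_)
    obtain ⟨a, b, x, y, h1, h2, hk⟩ := hgen (v⁻¹ * u')
    refine ⟨u * x, y * v'⁻¹, ?_⟩
    rw [tensor_point_eq h1 h2 (c := 1) (by rw [hk, mul_one]), one_smul]

/-- A product with two orbits, of `[1, 1]` and of `[1, t · r]`. -/
theorem trans_mul_trans_eq_sum {L L' L₁ L₂ : Subgroup (G × G)} (t r : G)
    (hgen : ∀ k : G, ∃ a b x y : G, (x, a) ∈ L ∧ (b, y) ∈ L' ∧ (k = a * b ∨ k = a * t * b))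
    (hdisj : ∀ a b x y : G, (x, a) ∈ L → (b, y) ∈ L' → t ≠ a * b)
    (h₁ : ∀ g h : G, (g, h) ∈ L₁ ↔ ∃ k, (g, k) ∈ L ∧ (k, h) ∈ L')
    (h₂ : ∀ g h : G, (g, h) ∈ L₂ ↔ ∃ k, (g, k) ∈ L ∧ (t⁻¹ * k * t, r * h * r⁻¹) ∈ L') :
    trans L * trans L' = sum (trans L₁) (trans L₂) := by
  -- The double coset of `t` gives the second orbit. The element `r` only conjugates its stabilizer
  -- in the right factor, so that a preferred representative `L₂` can be reached.
  have hm₂ : ∀ g h : G, g • tmk (point L 1 1) (point L' t r⁻¹) =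
      op h • tmk (point L 1 1) (point L' t r⁻¹) ↔ (g, h) ∈ L₂ := by
    intro g h
    rw [h₂, smul_tmk_eq_iff]
    refine exists_congr fun k => and_congr smul_point_one_eq_iff ?_
    rw [smul_point, op_smul_point, point_eq_point, ← inv_mem_iff]
    simp [mul_assoc]
  refine Quotient.sound (iso_sum (M := tensor (ofSubgroup L) (ofSubgroup L'))
    (m := tmk (point L 1 1) (point L' 1 1)) (fun g k => ?_) (orbitMap _ hm₂)
    (orbitMap_injective hm₂) (orbitMap_smul hm₂) (orbitMap_op_smul hm₂) ?_ ?_)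
  · rw [h₁, smul_tmk_eq_iff]
    simp only [smul_point_one_eq_iff]
  · refine tensor_ind (point_ind fun u v => point_ind fun u' v' => ?_)
    obtain ⟨a, b, x, y, h1, h2, hk | hk⟩ := hgen (v⁻¹ * u')
    · refine Or.inl ⟨u * x, y * v'⁻¹, ?_⟩
      rw [tensor_point_eq h1 h2 (c := 1) (by rw [hk, mul_one]), one_smul]
    · refine Or.inr ⟨point L₂ (u * x) (r⁻¹ * (y * v'⁻¹))⁻¹, ?_⟩
      rw [tensor_point_eq h1 h2 hk, orbitMap_point, inv_inv, op_mul, mul_smul (op _), op_smul_tmk r⁻¹,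
        op_smul_point, smul_point]
      simp
  · intro x y
    refine point_ind fun u v H => ?_
    rw [orbitMap_point, op_smul_tmk, op_smul_tmk, smul_tmk, smul_tmk, smul_point, smul_point,
      op_smul_point, op_smul_point] at H
    obtain ⟨k, hk⟩ := Quotient.exact (s := tensorSetoid (ofSubgroup L) (ofSubgroup L')) H
    have e1 := congrArg Prod.fst hk
    have e2 := congrArg Prod.snd hk
    simp only [op_smul_point, smul_point, point_eq_point, mul_one, one_mul, inv_one, inv_inv] at e1 e2
    exact hdisj k (t⁻¹ * k)⁻¹ _ _ e1 (inv_mem e2) (by simp)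

end BisetClass

/-! ## Classes of bisets in the double Burnside algebra -/

section BurnsideClass

variable (R : Type) [CommRing R] [Finite G]

/-- The class of a biset in the double Burnside algebra. -/
noncomputable def burnsideClass (x : BisetClass G) : DoubleBurnside G R :=
  (burnsideIdeal G R).ringCon.mkₐ R (MonoidAlgebra.single x 1)

theorem burnsideClass_one : burnsideClass R (1 : BisetClass G) = 1 :=
  map_one ((burnsideIdeal G R).ringCon.mkₐ R)

theorem burnsideClass_mul (x y : BisetClass G) :
    burnsideClass R (x * y) = burnsideClass R x * burnsideClass R y := by
  rw [burnsideClass, burnsideClass, burnsideClass, ← map_mul, MonoidAlgebra.single_mul_single,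
    one_mul]

theorem mem_burnsideIdeal {z : MonoidAlgebra R (BisetClass G)} :
    z ∈ burnsideIdeal G R ↔ z ∈ burnsideRelations G R :=
  TwoSidedIdeal.mem_mk' _ _ _ _ _ _ _

theorem mk_eq_zero_iff {z : MonoidAlgebra R (BisetClass G)} :
    (burnsideIdeal G R).ringCon.mkₐ R z = 0 ↔ z ∈ burnsideRelations G R := by
  rw [← mem_burnsideIdeal, TwoSidedIdeal.mem_iff]
  exact RingCon.eq _

theorem burnsideClass_sum (x y : BisetClass G) :
    burnsideClass R (x.sum y) = burnsideClass R x + burnsideClass R y := by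
  have h := (mk_eq_zero_iff R).2 (Submodule.subset_span (s := Set.range fun p : BisetClass G × BisetClass G =>
    MonoidAlgebra.single (p.1.sum p.2) (1 : R)
      - MonoidAlgebra.single p.1 1 - MonoidAlgebra.single p.2 1) ⟨(x, y), rfl⟩)
  rw [map_sub, map_sub, sub_sub, sub_eq_zero] at h
  exact h

/-! ### Splitting off one orbit of a biset. -/

namespace Biset

/-- The points outside of the orbit of a point. -/
def ComplType (M : Biset G) (m : M.carrier) : Type :=
  {z : M.carrier // ∀ x y : G, z ≠ x • op y • m}

instance (M : Biset G) (m : M.carrier) : Finite (M.ComplType m) :=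
  inferInstanceAs (Finite {z : M.carrier // ∀ x y : G, z ≠ x • op y • m})

instance (M : Biset G) (m : M.carrier) : MulAction G (M.ComplType m) where
  smul g z := ⟨g • z.1, fun x y h => z.2 (g⁻¹ * x) y (by
    rw [mul_smul, ← h, inv_smul_smul])⟩
  one_smul z := Subtype.ext (one_smul _ _)
  mul_smul g h z := Subtype.ext (mul_smul _ _ _)

instance (M : Biset G) (m : M.carrier) : MulAction Gᵐᵒᵖ (M.ComplType m) where
  smul g z := ⟨g • z.1, fun x y h => z.2 x (y * unop g⁻¹) (by
    rw [op_mul, mul_smul, op_unop, smul_comm x, ← h, inv_smul_smul])⟩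
  one_smul z := Subtype.ext (one_smul _ _)
  mul_smul g h z := Subtype.ext (mul_smul _ _ _)

instance (M : Biset G) (m : M.carrier) : SMulCommClass G Gᵐᵒᵖ (M.ComplType m) :=
  ⟨fun g h z => Subtype.ext (smul_comm g h z.1)⟩

/-- The complement of the orbit of a point. -/
def compl (M : Biset G) (m : M.carrier) : Biset G where
  carrier := M.ComplType m

/-- The stabilizer of a point of a biset. -/
def stab (M : Biset G) (m : M.carrier) : Subgroup (G × G) where
  carrier := {p | p.1 • m = op p.2 • m}
  one_mem' := by simp
  mul_mem' := by
    rintro ⟨g, h⟩ ⟨g', h'⟩ (h1 : g • m = op h • m) (h2 : g' • m = op h' • m)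
    change (g * g') • m = op (h * h') • m
    rw [mul_smul, h2, smul_comm, h1, op_mul, mul_smul]
  inv_mem' := by
    rintro ⟨g, h⟩ (h1 : g • m = op h • m)
    change g⁻¹ • m = op h⁻¹ • m
    rw [inv_smul_eq_iff, smul_comm g, h1, op_inv, inv_smul_smul]

theorem iso_sum_compl (M : Biset G) (m : M.carrier) :
    Iso M (sum (ofSubgroup (M.stab m)) (M.compl m)) := by
  refine iso_sum (m := m) (fun _ _ => Iff.rfl) (N := M.compl m) Subtype.val
    Subtype.val_injective (fun _ _ => rfl) (fun _ _ => rfl) (fun z => ?_) (fun x y n h => n.2 x y h.symm)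
  by_cases hz : ∃ x y : G, z = x • op y • m
  · exact Or.inl hz
  · push Not at hz
    exact Or.inr ⟨⟨z, hz⟩, rfl⟩

end Biset

/-- The double Burnside algebra is spanned by the classes of the transitive bisets. -/
theorem span_burnsideClass_trans :
    Submodule.span R (Set.range fun L : Subgroup (G × G) => burnsideClass R (BisetClass.trans L)) =
      ⊤ := by
  have key : ∀ (n : ℕ) (M : Biset G), Nat.card M.carrier = n →
      burnsideClass R (BisetClass.mk M) ∈ Submodule.span R
        (Set.range fun L : Subgroup (G × G) => burnsideClass R (BisetClass.trans L)) := by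
    intro n
    induction n using Nat.strong_induction_on with
    | _ n ih =>
      intro M hM
      rcases isEmpty_or_nonempty M.carrier with hE | ⟨⟨m⟩⟩
      -- The empty biset satisfies `M ≅ M ⊔ M`, so its class is its own double and vanishes.
      · have h : BisetClass.mk M = (BisetClass.mk M).sum (BisetClass.mk M) :=
          Quotient.sound (Biset.Iso.of_bijective (N := Biset.sum M M) Sum.inl
            ⟨Sum.inl_injective, fun z => isEmptyElim (α := M.carrier) (Sum.elim id id z)⟩
            (fun _ _ => rfl) (fun _ _ => rfl))
        have h' := congrArg (burnsideClass R) h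
        rw [burnsideClass_sum, left_eq_add] at h'
        rw [h']
        exact zero_mem _
      · have h : BisetClass.mk M =
            (BisetClass.trans (M.stab m)).sum (BisetClass.mk (M.compl m)) :=
          Quotient.sound (M.iso_sum_compl m)
        rw [h, burnsideClass_sum]
        refine add_mem (Submodule.subset_span ⟨_, rfl⟩) (ih _ ?_ _ rfl)
        rw [← hM]
        refine Finite.card_subtype_lt (x := m) fun h => ?_
        exact h 1 1 (by simp)
  refine eq_top_iff.2 fun z _ => ?_
  obtain ⟨f, rfl⟩ := RingCon.mkₐ_surjective (α := R) (burnsideIdeal G R).ringCon z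
  induction f using MonoidAlgebra.induction_linear with
  | zero => rw [map_zero]; exact zero_mem _
  | add f g hf hg => rw [map_add]; exact add_mem (hf trivial) (hg trivial)
  | single a r =>
    have h : (MonoidAlgebra.single a r : MonoidAlgebra R (BisetClass G)) =
        r • MonoidAlgebra.single a 1 := by simp
    rw [h, map_smul]
    obtain ⟨M⟩ := a
    exact Submodule.smul_mem _ _ (key _ M rfl)

/-! ## Marks -/

/-- The number of points of a biset that are fixed by a subgroup of `G × G`. -/
noncomputable def Biset.mark (L : Subgroup (G × G)) (M : Biset G) : ℕ :=
  Nat.card {m : M.carrier // L ≤ M.stab m}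

omit [Finite G] in
theorem Biset.mark_congr (L : Subgroup (G × G)) {M N : Biset G} (h : Biset.Iso M N) :
    M.mark L = N.mark L := by
  obtain ⟨f, hl, hr⟩ := h
  refine Nat.card_congr (Equiv.subtypeEquiv f fun m => ?_)
  have h : N.stab (f m) = M.stab m := by
    ext ⟨x, y⟩
    change x • f m = op y • f m ↔ x • m = op y • m
    rw [← hl, ← hr, f.injective.eq_iff]
  rw [h]

omit [Finite G] in
theorem Biset.mark_sum (L : Subgroup (G × G)) (M N : Biset G) :
    (Biset.sum M N).mark L = M.mark L + N.mark L := by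
  have e1 : ∀ m : M.carrier, (Biset.sum M N).stab (Sum.inl m) = M.stab m := fun m =>
    SetLike.ext fun p => Sum.inl_injective.eq_iff (a := p.1 • m) (b := op p.2 • m)
  have e2 : ∀ n : N.carrier, (Biset.sum M N).stab (Sum.inr n) = N.stab n := fun n =>
    SetLike.ext fun p => Sum.inr_injective.eq_iff (a := p.1 • n) (b := op p.2 • n)
  change Nat.card {m : M.carrier ⊕ N.carrier // L ≤ (Biset.sum M N).stab m} = _
  rw [Nat.card_congr (Equiv.subtypeSum (α := M.carrier) (β := N.carrier)), Nat.card_sum]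
  simp only [e1, e2, Biset.mark]

/-- The mark of an isomorphism class. -/
noncomputable def BisetClass.mark (L : Subgroup (G × G)) : BisetClass G → ℕ :=
  Quotient.lift (Biset.mark L) fun _ _ h => Biset.mark_congr L h

omit [Finite G] in
theorem BisetClass.mark_sum (L : Subgroup (G × G)) (x y : BisetClass G) :
    (x.sum y).mark L = x.mark L + y.mark L := by
  obtain ⟨M⟩ := x
  obtain ⟨N⟩ := y
  exact Biset.mark_sum L M N

theorem BisetClass.mark_trans_self_ne_zero (L : Subgroup (G × G)) :
    (BisetClass.trans L).mark L ≠ 0 := by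
  have : Nonempty {m : (Biset.ofSubgroup L).carrier // L ≤ (Biset.ofSubgroup L).stab m} :=
    ⟨⟨Biset.point L 1 1, fun p hp => Biset.smul_point_one_eq_iff.2 hp⟩⟩
  exact Nat.card_pos.ne'

/-- A coset fixed by `L` has a stabilizer that is a conjugate of `L'`; thus the table of marks is
triangular for subconjugacy. -/
theorem BisetClass.exists_conj_le_of_mark_ne_zero {L L' : Subgroup (G × G)}
    (h : (BisetClass.trans L').mark L ≠ 0) :
    ∃ x y : G, ∀ g k : G, (g, k) ∈ L → (x⁻¹ * g * x, y⁻¹ * k * y) ∈ L' := by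
  by_contra hne
  refine h (@Nat.card_of_isEmpty _ ⟨?_⟩)
  rintro ⟨m, hm⟩
  revert m
  refine Biset.point_ind fun x y hm => hne ⟨x, y, fun g k hgk => ?_⟩
  have h1 : g • Biset.point L' x y = op k • Biset.point L' x y := hm hgk
  rw [Biset.smul_point, Biset.op_smul_point, Biset.point_eq_point, ← inv_mem_iff] at h1
  simpa [mul_assoc] using h1

/-- A linear relation between classes of bisets implies the same relation between marks. -/
theorem sum_mul_mark_eq_zero {ι : Type} [Fintype ι] (r : ι → R) (x : ι → BisetClass G)
    (h : ∑ i, r i • burnsideClass R (x i) = 0) (L : Subgroup (G × G)) :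
    ∑ i, r i * ((x i).mark L : R) = 0 := by
  let f : MonoidAlgebra R (BisetClass G) →ₗ[R] R :=
    (Finsupp.lift R R (BisetClass G) fun y => (y.mark L : R)) ∘ₗ
      (MonoidAlgebra.coeffLinearEquiv R).toLinearMap
  have hf : ∀ y, f (MonoidAlgebra.single y 1) = (y.mark L : R) := fun y => by simp [f]
  -- Marks are additive on disjoint unions, so the functional `f` descends to the double Burnside
  -- algebra.
  have hker : burnsideRelations G R ≤ LinearMap.ker f := by
    refine Submodule.span_le.2 ?_
    rintro _ ⟨⟨y, z⟩, rfl⟩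
    simp only [SetLike.mem_coe, LinearMap.mem_ker, map_sub, hf, BisetClass.mark_sum, Nat.cast_add]
    ring
  have h0 : ∑ i, r i • (MonoidAlgebra.single (x i) 1 : MonoidAlgebra R (BisetClass G)) ∈
      burnsideRelations G R := by
    rw [← mk_eq_zero_iff, map_sum]
    simp only [map_smul]
    exact h
  have h1 := LinearMap.mem_ker.1 (hker h0)
  simpa only [map_sum, map_smul, hf, smul_eq_mul] using h1

/-- Linear independence of the classes of transitive bisets, in terms of a function `w` on the
indices that is monotone along subconjugacy. -/
theorem sum_burnsideClass_trans_eq_zero [IsDomain R] [CharZero R] {ι : Type} [Fintype ι]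
    (L : ι → Subgroup (G × G)) (w : ι → ℕ)
    (hw : ∀ i j (x y : G), (∀ g k : G, (g, k) ∈ L i → (x⁻¹ * g * x, y⁻¹ * k * y) ∈ L j) →
      i = j ∨ w i < w j) (r : ι → R)
    (h : ∑ i, r i • burnsideClass R (BisetClass.trans (L i)) = 0) : r = 0 := by
  classical
  by_contra hr
  have hne : (Finset.univ.filter fun i => r i ≠ 0).Nonempty := by
    obtain ⟨i, hi⟩ := Function.ne_iff.1 hr
    exact ⟨i, by simpa using hi⟩
  -- At an index with nonzero coefficient and maximal `w`, the mark at `L i` sees only the term `i`: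
  -- any other contributing `j` would have larger `w`.
  obtain ⟨i, hi, hmax⟩ := Finset.exists_max_image _ w hne
  have hi' : r i ≠ 0 := (Finset.mem_filter.1 hi).2
  have h1 := sum_mul_mark_eq_zero R r _ h (L i)
  rw [Finset.sum_eq_single i] at h1
  · exact mul_ne_zero hi' (Nat.cast_ne_zero.2 (BisetClass.mark_trans_self_ne_zero (L i))) h1
  · intro j _ hji
    by_contra hj
    obtain ⟨hrj, hmj⟩ := mul_ne_zero_iff.1 hj
    obtain ⟨x, y, hxy⟩ := BisetClass.exists_conj_le_of_mark_ne_zero (Nat.cast_ne_zero.1 hmj)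
    rcases hw i j x y hxy with rfl | hlt
    · exact hji rfl
    · exact absurd (hmax j (by simpa using hrj)) (not_le.2 hlt)
  · simp

end BurnsideClass

end Transitive
end KraussS3

namespace KraussS3

/-! ## An algebra presented by generators and relations -/

section Presentation

/-- The relations between the four generators of the double Burnside algebra of `S₃`. -/
structure GeneratorRelations {A : Type*} [Ring A] (a b c p : A) : Prop where
  aa : a * a = a + a * c
  bb : b * b = b
  cc : c * c = c + c
  pp : p * p = p
  aba : a * b * a = a
  bab : b * a * b = b
  ca : c * a = a * c
  -- For bisets, `a * c` is the class of the free biset `S₃ × S₃`, which factors through the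
  -- one-point biset `p`.
  ac : a * c * p * (a * c) = a * c
  bc : b * c = c * p * c
  cb : c * b = c * p * c
  bp : b * p = p
  pb : p * b = p
  bap : b * a * p = p
  pab : p * a * b = p
  pap : p * a * p = p
  pcp : p * c * p = p
  pacp : p * (a * c) * p = p

/-- The left and right factors of the words that contain `p`. -/
def outerWord {A : Type*} [Ring A] (a c : A) : Fin 4 → A := ![1, a, c, a * c]

/-- The index set of the words. -/
abbrev WordIndex : Type := Fin 4 × Fin 4 ⊕ Fin 6

/-- The words in the generators that span the algebra. -/
def word {A : Type*} [Ring A] (a b c p : A) : WordIndex → A :=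
  Sum.elim (fun ij => outerWord a c ij.1 * p * outerWord a c ij.2)
    ![1, a, b, a * b, b * a, c]

variable (R : Type) [CommRing R]

namespace GeneratorRelations

variable {A : Type*} [Ring A] [Algebra R A] {a b c p : A}

variable (h : GeneratorRelations a b c p)
include h

theorem acc : a * c * c = a * c + a * c := by rw [mul_assoc, h.cc, mul_add]

theorem aac : a * (a * c) = a * c + a * c + a * c := by
  rw [← mul_assoc, h.aa, add_mul, h.acc, ← add_assoc]

theorem cac : c * (a * c) = a * c + a * c := by rw [← mul_assoc, h.ca, h.acc]

theorem bcp : b * (c * p) = c * p := by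
  rw [← mul_assoc, h.bc, mul_assoc, mul_assoc, ← mul_assoc p, h.pcp]

theorem bacp : b * (a * c * p) = c * p := by
  rw [← h.ca, ← mul_assoc, ← mul_assoc, h.bc, mul_assoc, mul_assoc, mul_assoc, ← mul_assoc c a,
    h.ca, ← mul_assoc p, h.pacp]

/-- Only the part of the word to the left of the right factor changes, and the relations keep `p`,
`a p`, `c p`, `a c p` stable under left multiplication by the generators up to linear combinations.
-/
theorem mul_word_inl {S : Submodule R A} (hS : ∀ i, word a b c p i ∈ S) {g : A}
    (hg : g = a ∨ g = b ∨ g = c ∨ g = p) (i j : Fin 4) :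
    g * word a b c p (Sum.inl (i, j)) ∈ S := by
  have h0 : p * outerWord a c j ∈ S := by simpa [word, outerWord] using hS (Sum.inl (0, j))
  have h1 : a * p * outerWord a c j ∈ S := by simpa [word, outerWord] using hS (Sum.inl (1, j))
  have h2 : c * p * outerWord a c j ∈ S := by simpa [word, outerWord] using hS (Sum.inl (2, j))
  have h3 : a * c * p * outerWord a c j ∈ S := by
    simpa [word, outerWord] using hS (Sum.inl (3, j))
  change g * (outerWord a c i * p * outerWord a c j) ∈ S
  rw [← mul_assoc g]
  rcases hg with rfl | rfl | rfl | rfl <;> fin_cases i <;>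
    simp only [outerWord, Fin.zero_eta, Fin.mk_one, Fin.reduceFinMk, Matrix.cons_val, one_mul]
  · exact h1
  · rw [← mul_assoc, h.aa, add_mul, add_mul]
    exact add_mem h1 h3
  · rw [← mul_assoc]
    exact h3
  · rw [← mul_assoc, h.aac]
    simp only [add_mul]
    exact add_mem (add_mem h3 h3) h3
  · rw [h.bp]
    exact h0
  · rw [← mul_assoc, h.bap]
    exact h0
  · rw [h.bcp]
    exact h2
  · rw [h.bacp]
    exact h2
  · exact h2
  · rw [← mul_assoc, h.ca]
    exact h3
  · rw [← mul_assoc, h.cc, add_mul, add_mul]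
    exact add_mem h2 h2
  · rw [← mul_assoc, h.cac, add_mul, add_mul]
    exact add_mem h3 h3
  · rw [h.pp]
    exact h0
  · rw [← mul_assoc, h.pap]
    exact h0
  · rw [← mul_assoc, h.pcp]
    exact h0
  · rw [← mul_assoc, h.pacp]
    exact h0

/-- Words without `p` may turn into words with `p`, through `b c = c b = c p c` and `a c = a c p a
c`. -/
theorem mul_word_inr {S : Submodule R A} (hS : ∀ i, word a b c p i ∈ S) {g : A}
    (hg : g = a ∨ g = b ∨ g = c ∨ g = p) (k : Fin 6) :
    g * word a b c p (Sum.inr k) ∈ S := by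
  have ha : a ∈ S := hS (Sum.inr 1)
  have hb : b ∈ S := hS (Sum.inr 2)
  have hab : a * b ∈ S := hS (Sum.inr 3)
  have hba : b * a ∈ S := hS (Sum.inr 4)
  have hc : c ∈ S := hS (Sum.inr 5)
  have hp : p ∈ S := by simpa [word, outerWord] using hS (Sum.inl (0, 0))
  have hpa : p * a ∈ S := by simpa [word, outerWord] using hS (Sum.inl (0, 1))
  have hpc : p * c ∈ S := by simpa [word, outerWord] using hS (Sum.inl (0, 2))
  have hac : a * c ∈ S := by simpa [word, outerWord, h.ac] using hS (Sum.inl (3, 3))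
  have hcpc : c * p * c ∈ S := hS (Sum.inl (2, 2))
  have hacpc : a * c * p * c ∈ S := hS (Sum.inl (3, 2))
  have hcpac : c * p * (a * c) ∈ S := hS (Sum.inl (2, 3))
  have hacb : a * c * b ∈ S := by rw [mul_assoc, h.cb, ← mul_assoc, ← mul_assoc]; exact hacpc
  rcases hg with rfl | rfl | rfl | rfl <;> fin_cases k <;>
    simp only [word, Sum.elim_inr, Fin.zero_eta, Fin.mk_one, Fin.reduceFinMk, Matrix.cons_val,
      mul_one]
  · exact ha
  · rw [h.aa]
    exact add_mem ha hac
  · exact hab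
  · rw [← mul_assoc, h.aa, add_mul]
    exact add_mem hab hacb
  · rw [← mul_assoc, h.aba]
    exact ha
  · exact hac
  · exact hb
  · exact hba
  · rw [h.bb]
    exact hb
  · rw [← mul_assoc, h.bab]
    exact hb
  · rw [← mul_assoc, h.bb]
    exact hba
  · rw [h.bc]
    exact hcpc
  · exact hc
  · rw [h.ca]
    exact hac
  · rw [h.cb]
    exact hcpc
  · rw [← mul_assoc, h.ca]
    exact hacb
  · rw [← mul_assoc, h.cb, mul_assoc, h.ca]
    exact hcpac
  · rw [h.cc]
    exact add_mem hc hc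
  · exact hp
  · exact hpa
  · rw [h.pb]
    exact hp
  · rw [← mul_assoc, h.pab]
    exact hp
  · rw [← mul_assoc, h.pb]
    exact hpa
  · exact hpc

/-- The words span the algebra if the generators generate it. -/
theorem span_word (hgen : Algebra.adjoin R {a, b, c, p} = ⊤) :
    Submodule.span R (Set.range (word a b c p)) = ⊤ := by
  set S := Submodule.span R (Set.range (word a b c p)) with hSdef
  have hS : ∀ i, word a b c p i ∈ S := fun i => Submodule.subset_span ⟨i, rfl⟩
  have h1 : (1 : A) ∈ S := hS (Sum.inr 0)
  -- The span is a left ideal, as it is stable under the generators; it contains `1`.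
  have hmul : ∀ x : A, ∀ y ∈ S, x * y ∈ S := by
    intro x
    have hx : x ∈ Algebra.adjoin R {a, b, c, p} := hgen ▸ Algebra.mem_top
    induction hx using Algebra.adjoin_induction with
    | mem g hg =>
      intro y hy
      induction hy using Submodule.span_induction with
      | mem y hy =>
        obtain ⟨i | k, rfl⟩ := hy
        · exact h.mul_word_inl R hS hg i.1 i.2
        · exact h.mul_word_inr R hS hg k
      | zero => rw [mul_zero]; exact zero_mem _
      | add y z _ _ hy hz => rw [mul_add]; exact add_mem hy hz
      | smul r y _ hy => rw [mul_smul_comm]; exact Submodule.smul_mem _ _ hy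
    | algebraMap r =>
      intro y hy
      rw [← Algebra.smul_def]
      exact Submodule.smul_mem _ _ hy
    | add x y _ _ hx hy =>
      intro z hz
      rw [add_mul]
      exact add_mem (hx z hz) (hy z hz)
    | mul x y _ _ hx hy =>
      intro z hz
      rw [mul_assoc]
      exact hx _ (hy z hz)
  exact eq_top_iff.2 fun x _ => mul_one x ▸ hmul x 1 h1

end GeneratorRelations

theorem map_word {A B : Type*} [Ring A] [Algebra R A] [Ring B] [Algebra R B] (f : A →ₐ[R] B)
    (a b c p : A) (i : WordIndex) :
    f (word a b c p i) = word (f a) (f b) (f c) (f p) i := by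
  rcases i with ⟨i, j⟩ | k
  · fin_cases i <;> fin_cases j <;> simp [word, outerWord]
  · fin_cases k <;> simp [word]

/-- The words form a basis of the algebra. -/
structure WordBasis {A : Type*} [Ring A] [Algebra R A] (a b c p : A) : Prop extends
    GeneratorRelations a b c p where
  span : Submodule.span R (Set.range (word a b c p)) = ⊤
  indep : ∀ r : WordIndex → R, ∑ i, r i • word a b c p i = 0 → r = 0

/-- A spanning family that is carried to a basis is itself a basis. -/
theorem bijective_of_wordBasis {U A : Type*} [Ring U] [Algebra R U] [Ring A] [Algebra R A]
    (f : U →ₐ[R] A) {a b c p : U} (hU : Submodule.span R (Set.range (word a b c p)) = ⊤)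
    (h : WordBasis R (f a) (f b) (f c) (f p)) : Function.Bijective f := by
  constructor
  · rw [injective_iff_map_eq_zero]
    intro u hu
    have hmem : u ∈ Submodule.span R (Set.range (word a b c p)) := hU ▸ Submodule.mem_top
    obtain ⟨r, rfl⟩ := (Submodule.mem_span_range_iff_exists_fun R).1 hmem
    have hr : r = 0 := h.indep r (by simpa only [map_sum, map_smul, map_word] using hu)
    simp [hr]
  · intro x
    have hmem : x ∈ Submodule.span R (Set.range (word (f a) (f b) (f c) (f p))) :=
      h.span ▸ Submodule.mem_top
    obtain ⟨r, rfl⟩ := (Submodule.mem_span_range_iff_exists_fun R).1 hmem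
    exact ⟨∑ i, r i • word a b c p i, by simp only [map_sum, map_smul, map_word]⟩

theorem GeneratorRelations.prod {A B : Type*} [Ring A] [Ring B] {a b c p : A} {a' b' c' p' : B}
    (h : GeneratorRelations a b c p) (h' : GeneratorRelations a' b' c' p') :
    GeneratorRelations (a, a') (b, b') (c, c') (p, p') := by
  constructor <;> simp only [Prod.mk_mul_mk, Prod.mk_add_mk, h.aa, h.bb, h.cc, h.pp, h.aba, h.bab,
    h.ca, h.ac, h.bc, h.cb, h.bp, h.pb, h.bap, h.pab, h.pap, h.pcp, h.pacp, h'.aa, h'.bb, h'.cc,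
    h'.pp, h'.aba, h'.bab, h'.ca, h'.ac, h'.bc, h'.cb, h'.bp, h'.pb, h'.bap, h'.pab, h'.pap, h'.pcp,
    h'.pacp]

/-- Two algebras whose words form a basis are isomorphic. -/
theorem nonempty_algEquiv_of_wordBasis {A B : Type*} [Ring A] [Algebra R A] [Ring B] [Algebra R B]
    {a b c p : A} {a' b' c' p' : B} (h : WordBasis R a b c p) (h' : WordBasis R a' b' c' p') :
    Nonempty (A ≃ₐ[R] B) := by
  set T : Set (A × B) := {(a, a'), (b, b'), (c, c'), (p, p')} with hT
  -- `U` is the graph of the isomorphism sought. The relations hold in `U`, so its words span it,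
  -- and each projection carries them to a basis.
  let U := Algebra.adjoin R T
  let ua : U := ⟨(a, a'), Algebra.subset_adjoin (by simp [hT])⟩
  let ub : U := ⟨(b, b'), Algebra.subset_adjoin (by simp [hT])⟩
  let uc : U := ⟨(c, c'), Algebra.subset_adjoin (by simp [hT])⟩
  let up : U := ⟨(p, p'), Algebra.subset_adjoin (by simp [hT])⟩
  have hprod := h.toGeneratorRelations.prod h'.toGeneratorRelations
  have hrel : GeneratorRelations ua ub uc up := by
    constructor <;> refine Subtype.ext ?_
    exacts [hprod.aa, hprod.bb, hprod.cc, hprod.pp, hprod.aba, hprod.bab, hprod.ca, hprod.ac,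
      hprod.bc, hprod.cb, hprod.bp, hprod.pb, hprod.bap, hprod.pab, hprod.pap, hprod.pcp,
      hprod.pacp]
  have hgen : Algebra.adjoin R ({ua, ub, uc, up} : Set U) = ⊤ := by
    rw [← Algebra.adjoin_adjoin_coe_preimage (s := T)]
    congr 1
    ext u
    simp [hT, ua, ub, uc, up, Subtype.ext_iff, U]
  have hspan := hrel.span_word R hgen
  have h1 := bijective_of_wordBasis R ((AlgHom.fst R A B).comp U.val) hspan h
  have h2 := bijective_of_wordBasis R ((AlgHom.snd R A B).comp U.val) hspan h'
  exact ⟨(AlgEquiv.ofBijective _ h1).symm.trans (AlgEquiv.ofBijective _ h2)⟩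

end Presentation

/-! ## Generators of the order -/

section OrderGenerators

variable {R : Type} [CommRing R]

namespace Lambda3

/-- The image in `Λ` of the biset `S₃ ×_{C₂} S₃`. -/
def genA : Lambda3 R :=
  ⟨⟨!![3, 1, -2; 2, 1, -2; 1, 0, 0], ![1, 1, 0], 1, 0, 0, ![3, 3, -6], 0, 0, 3, 0⟩,
    fun i => by fin_cases i <;> simp [show (6 : R) = 3 * 2 by norm_num], by simp⟩

/-- The image in `Λ` of the biset `S₃ / C₃`. -/
def genB : Lambda3 R :=
  ⟨⟨!![0, 0, 1; 0, 1, 0; 0, 0, 1], 0, 1, 1, 0, 0, 1, 0, -12, 1⟩,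
    fun i => by simp, by simp [show (12 : R) = 3 * 4 by norm_num]⟩

/-- The image in `Λ` of the biset `S₃ ×_{C₃} S₃`, where `h = 1 / 2`. -/
def genC (h : R) : Lambda3 R :=
  ⟨⟨!![2, 1, -2; 0, 2, 0; 0, 1, 0], ![1, 0, 0], 0, 0, 2, ![3, 0, -3], 0, 0, 3 * h, 0⟩,
    fun i => by fin_cases i <;> simp, by simp⟩

/-- The image in `Λ` of the biset with one point. -/
def genP : Lambda3 R :=
  ⟨⟨!![0, 0, 1; 0, 0, 1; 0, 0, 1], 0, 0, 0, 0, 0, 0, 0, 0, 0⟩, fun i => by simp, by simp⟩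

set_option maxHeartbeats 4000000 in
theorem generatorRelations {h : R} (hh : 2 * h = 1) :
    GeneratorRelations (genA (R := R)) genB (genC h) genP := by
  constructor <;> refine Subtype.ext ?_ <;> ext i j
  all_goals
    (try fin_cases i) <;> (try fin_cases j) <;>
    simp [genA, genB, genC, genP, Matrix.mul_apply, Fin.sum_univ_three] <;> first
      | done
      | (ring1)
      -- The value of `h` matters only through the entry `3 * h` of `genC`.
      | (linear_combination hh)
      | (linear_combination 3 * hh)
      | (linear_combination (-3) * hh)

end Lambda3
end OrderGenerators
end KraussS3

namespace KraussS3

/-! ## The words form a basis of the order -/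

section OrderBasis

variable {R : Type} [CommRing R]

namespace Lambda3

/-- The upper part of the column of the left factor of a word. -/
def wordCol : Fin 4 → Fin 3 → R := ![![1, 1, 1], ![2, 1, 1], ![1, 2, 1], ![3, 2, 1]]

/-- The left part of the row of the right factor of a word. -/
def wordRow : Fin 4 → Fin 3 → R := ![![0, 0, 1], ![1, 0, 0], ![0, 1, 0], ![2, 1, -2]]

/-- The last entry of the column and of the row of a word. -/
def wordEnd : Fin 4 → R := ![0, 0, 0, 1]

/-- `genP` is the column `(1, 1, 1)` times the row `(0, 0, 1)`, so a left factor acts on the column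
alone. The `x` part of the result carries a factor 3, which is split off from `wordEnd`. -/
theorem outerWord_mul_genP (h : R) (i : Fin 4) :
    (outerWord genA (genC h) i * genP : Lambda3 R).1 =
      ⟨Matrix.of fun k l => wordCol i k * wordRow 0 l, 0, 0, 0, 0,
        fun l => 3 * wordEnd i * wordRow 0 l, 0, 0, 0, 0⟩ := by
  fin_cases i <;> ext k l
  all_goals
    (try fin_cases k) <;> (try fin_cases l) <;>
    simp [outerWord, genA, genC, genP, wordCol, wordRow, wordEnd, Matrix.mul_apply,
      Fin.sum_univ_succ] <;> norm_num

theorem genP_mul_outerWord (h : R) (j : Fin 4) :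
    (genP * outerWord genA (genC h) j : Lambda3 R).1 =
      ⟨Matrix.of fun k l => wordCol 0 k * wordRow j l, fun k => wordCol 0 k * wordEnd j,
        0, 0, 0, 0, 0, 0, 0, 0⟩ := by
  fin_cases j <;> ext k l
  all_goals
    (try fin_cases k) <;> (try fin_cases l) <;>
    simp [outerWord, genA, genC, genP, wordCol, wordRow, wordEnd, Matrix.mul_apply,
      Fin.sum_univ_succ]

/-- Writing `p` as `p * p` splits the word into a column times a row. The inner product `wordRow 0 ·
wordCol 0` is 1, and `z₂` arises from the product of `x` with `t`. -/
theorem word_inl {h : R} (hh : 2 * h = 1) (i j : Fin 4) :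
    (word genA genB (genC h) genP (Sum.inl (i, j)) : Lambda3 R).1 =
      ⟨Matrix.of fun k l => wordCol i k * wordRow j l, fun k => wordCol i k * wordEnd j, 0, 0, 0,
        fun l => 3 * wordEnd i * wordRow j l, 0, 0, 3 * wordEnd i * wordEnd j, 0⟩ := by
  have h1 : (word genA genB (genC h) genP (Sum.inl (i, j)) : Lambda3 R) =
      (outerWord genA (genC h) i * genP) * (genP * outerWord genA (genC h) j) := by
    rw [← mul_assoc, mul_assoc (outerWord _ _ i), (generatorRelations hh).pp]
    rfl
  rw [h1, MulMemClass.coe_mul, outerWord_mul_genP, genP_mul_outerWord]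
  have h2 : ∑ k : Fin 3, (wordRow 0 k * wordCol 0 k : R) = 1 := by
    simp [Fin.sum_univ_three, wordCol, wordRow]
  have h3 (c d : R) (f : Fin 3 → R) (hf : ∀ x, f x = c * (wordRow 0 x * wordCol 0 x) * d) :
      ∑ x, f x = c * d := by
    rw [Finset.sum_congr rfl fun x _ => hf x, ← Finset.sum_mul, ← Finset.mul_sum, h2, mul_one]
  ext k l
  · simp only [BlockOrder.mul_s, Matrix.mul_apply, Matrix.of_apply]
    exact h3 _ _ _ (fun x => by ring)
  · simp only [BlockOrder.mul_t, Matrix.of_apply, add_zero, mul_zero]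
    exact h3 _ _ _ (fun x => by ring)
  iterate 3 simp
  · simp only [BlockOrder.mul_x, Matrix.of_apply, zero_mul, add_zero]
    exact h3 _ _ _ (fun x => by ring)
  iterate 2 simp
  · simp only [BlockOrder.mul_z₂, mul_zero, add_zero, sub_zero]
    exact h3 _ _ _ (fun x => by ring)
  · simp

/-- The contribution of the words that contain `p` to a linear combination. -/
theorem sum_inl {h : R} (hh : 2 * h = 1) (m : Fin 4 × Fin 4 → R) :
    (∑ ij, m ij • word genA genB (genC h) genP (Sum.inl ij) : Lambda3 R).1 =
      ⟨Matrix.of fun k l => ∑ i, ∑ j, m (i, j) * (wordCol i k * wordRow j l),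
        fun k => ∑ i, ∑ j, m (i, j) * (wordCol i k * wordEnd j), 0, 0, 0,
        fun l => ∑ i, ∑ j, m (i, j) * (3 * wordEnd i * wordRow j l), 0, 0,
        ∑ i, ∑ j, m (i, j) * (3 * wordEnd i * wordEnd j), 0⟩ := by
  rw [Fintype.sum_prod_type]
  simp only [Fin.sum_univ_four, Subalgebra.coe_add, Subalgebra.coe_smul, word_inl hh]
  ext k l <;> simp

/-- The contribution of the words without `p` to the entries outside of `s`, `t`, `x`, `z₂`. -/
theorem sum_inr (h : R) (q : Fin 6 → R) :
    ((∑ k, q k • word genA genB (genC h) genP (Sum.inr k) : Lambda3 R).1.u =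
      q 0 + q 1 + q 2 + q 3 + q 4) ∧
    ((∑ k, q k • word genA genB (genC h) genP (Sum.inr k) : Lambda3 R).1.v = q 2 + q 3) ∧
    ((∑ k, q k • word genA genB (genC h) genP (Sum.inr k) : Lambda3 R).1.w = q 0 + 2 * q 5) ∧
    ((∑ k, q k • word genA genB (genC h) genP (Sum.inr k) : Lambda3 R).1.y = q 2 + q 4) ∧
    ((∑ k, q k • word genA genB (genC h) genP (Sum.inr k) : Lambda3 R).1.z₁ = q 0) ∧
    ((∑ k, q k • word genA genB (genC h) genP (Sum.inr k) : Lambda3 R).1.z₃ = q 2) := by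
  simp only [Fin.sum_univ_six]
  refine ⟨?_, ?_, ?_, ?_, ?_, ?_⟩ <;> simp [word, genA, genB, genC, mul_comm]

-- After division of `x` and `z₂` by 3, the entries `s`, `t`, `x`, `z₂` form a `4 × 4` matrix. The
-- four columns `(wordCol i, wordEnd i)` and the four rows `(wordRow j, wordEnd j)` are unimodular
-- bases, so their products span all such matrices.
set_option maxHeartbeats 2000000 in
theorem mem_span_of_eq_zero {h : R} (hh : 2 * h = 1) (a : Lambda3 R) (hu : a.1.u = 0)
    (hv : a.1.v = 0) (hw : a.1.w = 0) (hy : a.1.y = 0) (hz₁ : a.1.z₁ = 0) (hz₃ : a.1.z₃ = 0) :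
    ∃ m : Fin 4 × Fin 4 → R,
      a = ∑ ij, m ij • word genA genB (genC h) genP (Sum.inl ij) := by
  choose x hx using a.2.1
  obtain ⟨z, hz⟩ := a.2.2
  -- The coordinates of the vector `(A, B, C, D)` in the basis of columns.
  let col (A B C D : R) : Fin 4 → R := ![3 * C - A - B + 2 * D, A - C - 2 * D, B - C - D, D]
  let c0 := col (a.1.s 0 0) (a.1.s 1 0) (a.1.s 2 0) (x 0)
  let c1 := col (a.1.s 0 1) (a.1.s 1 1) (a.1.s 2 1) (x 1)
  let c2 := col (a.1.s 0 2) (a.1.s 1 2) (a.1.s 2 2) (x 2)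
  let c3 := col (a.1.t 0) (a.1.t 1) (a.1.t 2) z
  -- The second index inverts the basis of rows: only the row `(2, 1, -2, 1)` meets the last column,
  -- and its contribution is subtracted from the other three.
  refine ⟨fun ij => (![c2 ij.1 + 2 * c3 ij.1, c0 ij.1 - 2 * c3 ij.1, c1 ij.1 - c3 ij.1, c3 ij.1] :
    Fin 4 → R) ij.2, Subtype.ext ?_⟩
  rw [sum_inl hh]
  ext k l
  · fin_cases k <;> fin_cases l <;>
      simp [Fin.sum_univ_four, c0, c1, c2, c3, col, wordCol, wordRow] <;> ring
  · fin_cases k <;> simp [Fin.sum_univ_four, c0, c1, c2, c3, col, wordCol, wordEnd] <;> ring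
  · exact hu
  · exact hv
  · exact hw
  · fin_cases k <;> simp [Fin.sum_univ_four, c0, c1, c2, c3, col, wordRow, wordEnd, hx] <;> ring
  · exact hy
  · exact hz₁
  · rw [hz]
    simp [Fin.sum_univ_four, c3, col, wordEnd]
    ring
  · exact hz₃

/-- Words with `p` vanish in the entries `u`, `v`, `w`, `y`, `z₁`, `z₃`. These entries determine the
coefficients of the other six words, and what is left is a question about the `4 × 4` part. -/
theorem wordBasis [NoZeroDivisors R] (h3 : (3 : R) ≠ 0) {h : R} (hh : 2 * h = 1) :
    WordBasis R (genA (R := R)) genB (genC h) genP where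
  toGeneratorRelations := generatorRelations hh
  span := by
    refine eq_top_iff.2 fun a _ => (Submodule.mem_span_range_iff_exists_fun R).2 ?_
    -- The solution of the linear system in `sum_inr`; `h = 1 / 2` enters because `genC` has the
    -- entry `w = 2`.
    obtain ⟨q, h0, h1, h2, h3, h4, h5⟩ : ∃ q : Fin 6 → R, q 0 = a.1.z₁ ∧
        q 1 = a.1.u - a.1.z₁ - a.1.v - a.1.y + a.1.z₃ ∧ q 2 = a.1.z₃ ∧ q 3 = a.1.v - a.1.z₃ ∧
        q 4 = a.1.y - a.1.z₃ ∧ q 5 = h * (a.1.w - a.1.z₁) :=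
      ⟨![a.1.z₁, a.1.u - a.1.z₁ - a.1.v - a.1.y + a.1.z₃, a.1.z₃, a.1.v - a.1.z₃, a.1.y - a.1.z₃,
        h * (a.1.w - a.1.z₁)], rfl, rfl, rfl, rfl, rfl, rfl⟩
    obtain ⟨iu, iv, iw, iy, iz₁, iz₃⟩ := sum_inr h q
    rw [h0, h1, h2, h3, h4] at iu
    rw [h2, h3] at iv
    rw [h0, h5] at iw
    rw [h2, h4] at iy
    rw [h0] at iz₁
    rw [h2] at iz₃
    obtain ⟨m, hm⟩ := mem_span_of_eq_zero hh
      (a + -∑ k, q k • word genA genB (genC h) genP (Sum.inr k))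
      (by rw [Subalgebra.coe_add, Subalgebra.coe_neg, BlockOrder.add_u, BlockOrder.neg_u, iu]; ring)
      (by rw [Subalgebra.coe_add, Subalgebra.coe_neg, BlockOrder.add_v, BlockOrder.neg_v, iv]; ring)
      (by
        rw [Subalgebra.coe_add, Subalgebra.coe_neg, BlockOrder.add_w, BlockOrder.neg_w, iw]
        linear_combination (a.1.z₁ - a.1.w) * hh)
      (by rw [Subalgebra.coe_add, Subalgebra.coe_neg, BlockOrder.add_y, BlockOrder.neg_y, iy]; ring)
      (by
        rw [Subalgebra.coe_add, Subalgebra.coe_neg, BlockOrder.add_z₁, BlockOrder.neg_z₁, iz₁]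
        ring)
      (by
        rw [Subalgebra.coe_add, Subalgebra.coe_neg, BlockOrder.add_z₃, BlockOrder.neg_z₃, iz₃]
        ring)
    refine ⟨Sum.elim m q, ?_⟩
    rw [Fintype.sum_sum_type]
    simp only [Sum.elim_inl, Sum.elim_inr]
    rw [← hm, neg_add_cancel_right]
  indep r hr := by
    rw [Fintype.sum_sum_type] at hr
    obtain ⟨iu, iv, iw, iy, iz₁, iz₃⟩ := sum_inr h fun k => r (Sum.inr k)
    have hJ := sum_inl hh fun ij => r (Sum.inl ij)
    have hr' := congrArg Subtype.val hr
    rw [Subalgebra.coe_add, hJ, Subalgebra.coe_zero] at hr'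
    have eu := congrArg BlockOrder.u hr'
    have ev := congrArg BlockOrder.v hr'
    have ew := congrArg BlockOrder.w hr'
    have ey := congrArg BlockOrder.y hr'
    have ez₁ := congrArg BlockOrder.z₁ hr'
    have ez₃ := congrArg BlockOrder.z₃ hr'
    simp only [BlockOrder.add_u, BlockOrder.add_v, BlockOrder.add_w, BlockOrder.add_y,
      BlockOrder.add_z₁, BlockOrder.add_z₃, iu, iv, iw, iy, iz₁, iz₃, BlockOrder.zero_u,
      BlockOrder.zero_v, BlockOrder.zero_w, BlockOrder.zero_y, BlockOrder.zero_z₁,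
      BlockOrder.zero_z₃, zero_add] at eu ev ew ey ez₁ ez₃
    rw [ez₃, zero_add] at ev ey
    rw [ez₁, zero_add] at ew
    rw [ez₁, ez₃, ev, ey, zero_add, add_zero, add_zero, add_zero] at eu
    have ew' : r (Sum.inr 5) = 0 := by linear_combination h * ew - r (Sum.inr 5) * hh
    have hq : ∀ k, r (Sum.inr k) = 0 := by
      intro k
      fin_cases k <;> assumption
    simp only [hq, zero_smul, Finset.sum_const_zero, Subalgebra.coe_zero, add_zero] at hr'
    have es := fun k l => congrArg (fun b : BlockOrder R => b.s k l) hr'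
    have et := fun k => congrArg (fun b : BlockOrder R => b.t k) hr'
    have ex := fun l => congrArg (fun b : BlockOrder R => b.x l) hr'
    have ez := congrArg BlockOrder.z₂ hr'
    simp [Fin.sum_univ_four, Fin.forall_fin_succ, wordCol, wordRow, wordEnd, h3] at es et ex ez
    obtain ⟨⟨s00, s01, s02⟩, ⟨s10, s11, s12⟩, s20, s21, s22⟩ := es
    obtain ⟨t0, t1, t2⟩ := et
    obtain ⟨x0, x1, x2⟩ := ex
    have cancel {a : R} (ha : a * 3 = 0) : a = 0 := (mul_eq_zero.1 ha).resolve_right h3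
    -- The first three columns `wordCol` are independent. Elimination starts from `z₂`, goes on with
    -- `t` and `x`, and ends with `s`.
    have solve {a b c : R} (h₁ : a + b * 2 + c = 0) (h₂ : a + b + c * 2 = 0) (h₃ : a + b + c = 0) :
        a = 0 ∧ b = 0 ∧ c = 0 :=
      ⟨by linear_combination 3 * h₃ - h₁ - h₂, by linear_combination h₁ - h₃,
        by linear_combination h₂ - h₃⟩
    simp only [ez, zero_mul, add_zero, neg_zero] at x0 x1 x2 t0 t1 t2
    obtain ⟨e03, e13, e23⟩ := solve t0 t1 t2
    have e30 := cancel x2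
    have e31 := cancel x0
    have e32 := cancel x1
    simp only [ez, e03, e13, e23, e30, e31, e32, zero_mul,
      add_zero, neg_zero] at s00 s01 s02 s10 s11 s12 s20 s21 s22
    obtain ⟨e01, e11, e21⟩ := solve s00 s10 s20
    obtain ⟨e02, e12, e22⟩ := solve s01 s11 s21
    obtain ⟨e00, e10, e20⟩ := solve s02 s12 s22
    ext (⟨i, j⟩ | k)
    · fin_cases i <;> fin_cases j <;> assumption
    · exact hq k

end Lambda3

end OrderBasis
end KraussS3

namespace KraussS3

/-! ## The generators of the double Burnside algebra of `S₃` -/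

section SymmetricGroup

/-- The symmetric group on three letters. -/
abbrev S3 : Type := Equiv.Perm (Fin 3)

/-- The membership test for the even permutations. -/
abbrev IsRot (g : S3) : Prop := g 1 = g 0 + 1

/-- The sign homomorphism, up to the choice of the target. -/
theorem isRot_mul (g h : S3) : IsRot (g * h) ↔ (IsRot g ↔ IsRot h) := by
  revert g h
  decide +kernel

theorem isRot_inv (g : S3) : IsRot g⁻¹ ↔ IsRot g := by
  revert g
  decide +kernel

theorem isRot_one : IsRot 1 := by decide

/-- The subgroup that is cut out by the condition that one coordinate is fixed. -/
def swapGroup : Subgroup S3 := MulAction.stabilizer S3 (2 : Fin 3)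

/-- The subgroup of even permutations. -/
def rotGroup : Subgroup S3 where
  carrier := {g | IsRot g}
  one_mem' := isRot_one
  mul_mem' := fun {g h} hg hh => (isRot_mul g h).2 (iff_of_true hg hh)
  inv_mem' := fun {g} hg => (isRot_inv g).2 hg

theorem mem_swapGroup {g : S3} : g ∈ swapGroup ↔ g 2 = 2 := Iff.rfl

theorem mem_rotGroup {g : S3} : g ∈ rotGroup ↔ IsRot g := Iff.rfl

/-- Representatives of the conjugacy classes of subgroups of `S₃`. -/
def sub : Fin 4 → Subgroup S3 := ![⊤, swapGroup, rotGroup, ⊥]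

variable {G : Type} [Group G]

/-- The diagonal copy of a subgroup. -/
def diagonal (H : Subgroup G) : Subgroup (G × G) where
  carrier := {x | x.1 = x.2 ∧ x.1 ∈ H}
  one_mem' := ⟨rfl, one_mem H⟩
  mul_mem' := fun hx hy => ⟨congrArg₂ (· * ·) hx.1 hy.1, mul_mem hx.2 hy.2⟩
  inv_mem' := fun hx => ⟨congrArg (·⁻¹) hx.1, inv_mem hx.2⟩

theorem mem_diagonal {H : Subgroup G} {g h : G} : (g, h) ∈ diagonal H ↔ g = h ∧ g ∈ H := Iff.rfl

/-- The pairs of permutations of equal sign. -/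
def signGraph : Subgroup (S3 × S3) where
  carrier := {x | IsRot x.1 ↔ IsRot x.2}
  one_mem' := Iff.rfl
  mul_mem' := fun {x y} hx hy => by
    change IsRot (x.1 * y.1) ↔ IsRot (x.2 * y.2)
    rw [isRot_mul, isRot_mul, show IsRot x.1 ↔ _ from hx, show IsRot y.1 ↔ _ from hy]
  inv_mem' := fun {x} hx => by
    change IsRot x.1⁻¹ ↔ IsRot x.2⁻¹
    rw [isRot_inv, isRot_inv]
    exact hx

theorem mem_signGraph {g h : S3} : (g, h) ∈ signGraph ↔ (IsRot g ↔ IsRot h) := Iff.rfl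

/-- Representatives of the conjugacy classes of subgroups of `S₃ × S₃`. -/
def wordGroup : WordIndex → Subgroup (S3 × S3) :=
  Sum.elim (fun ij => (sub ij.1).prod (sub ij.2))
    ![diagonal ⊤, diagonal swapGroup, signGraph, signGraph ⊓ swapGroup.prod ⊤,
      signGraph ⊓ (⊤ : Subgroup S3).prod swapGroup, diagonal rotGroup]

namespace BisetClass

variable [Finite G]

/-- The first projection of the right factor is the whole group, so there is only one double coset.
-/
theorem diagonal_mul_prod {H K : Subgroup G} :
    trans (diagonal H) * trans ((⊤ : Subgroup G).prod K) = trans (H.prod K) := by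
  refine trans_mul_trans (fun k => ⟨1, k, 1, 1, ⟨rfl, one_mem H⟩, ⟨trivial, one_mem K⟩, by simp⟩)
    fun g h => ?_
  simp [mem_diagonal, Subgroup.mem_prod]

theorem prod_mul_diagonal {H K : Subgroup G} :
    trans (H.prod ⊤) * trans (diagonal K) = trans (H.prod K) := by
  refine trans_mul_trans (fun k => ⟨k, 1, 1, 1, ⟨one_mem H, trivial⟩, ⟨rfl, one_mem K⟩, by simp⟩)
    fun g h => ?_
  simp only [mem_diagonal, Subgroup.mem_prod, Subgroup.mem_top, and_true]
  exact ⟨fun hh => ⟨h, hh.1, rfl, hh.2⟩, fun ⟨k, h1, h2, h3⟩ => ⟨h1, h2 ▸ h3⟩⟩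

theorem prod_mul_prod {H K K' : Subgroup G} :
    trans (H.prod K) * trans ((⊤ : Subgroup G).prod K') = trans (H.prod K') := by
  refine trans_mul_trans (fun k => ⟨1, k, 1, 1, one_mem _, ⟨trivial, one_mem K'⟩, by simp⟩)
    fun g h => ?_
  simp only [Subgroup.mem_prod, Subgroup.mem_top, true_and]
  exact ⟨fun hh => ⟨1, ⟨hh.1, one_mem K⟩, hh.2⟩, fun ⟨k, h1, h2⟩ => ⟨h1.1, h2⟩⟩

theorem diagonal_mul_diagonal {H K : Subgroup G} (hHK : ∀ k, ∃ a ∈ H, ∃ b ∈ K, k = a * b) :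
    trans (diagonal H) * trans (diagonal K) = trans (diagonal (H ⊓ K)) := by
  refine trans_mul_trans (fun k => ?_) fun g h => ?_
  · obtain ⟨a, ha, b, hb, hk⟩ := hHK k
    exact ⟨a, b, a, b, ⟨rfl, ha⟩, ⟨rfl, hb⟩, hk⟩
  · simp only [mem_diagonal, Subgroup.mem_inf]
    exact ⟨fun ⟨h1, h2, h3⟩ => ⟨g, ⟨rfl, h2⟩, h1, h3⟩, fun ⟨k, ⟨h1, h2⟩, h3, h4⟩ =>
      ⟨h1.trans h3, h2, h1 ▸ h4⟩⟩

theorem one_eq_diagonal : (1 : BisetClass G) = trans (diagonal ⊤) :=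
  one_eq_trans fun g h => by simp [mem_diagonal]

/-- Both projections of `signGraph` are surjective, so a product with it on either side has a single
orbit. -/
theorem signGraph_mul {L L' : Subgroup (S3 × S3)}
    (h : ∀ g h, (g, h) ∈ L' ↔ ∃ k, (IsRot g ↔ IsRot k) ∧ (k, h) ∈ L) :
    trans signGraph * trans L = trans L' :=
  trans_mul_trans (fun k => ⟨k, 1, k, 1, Iff.rfl, one_mem L, by simp⟩) h

theorem mul_signGraph {L L' : Subgroup (S3 × S3)}
    (h : ∀ g h, (g, h) ∈ L' ↔ ∃ k, (g, k) ∈ L ∧ (IsRot k ↔ IsRot h)) :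
    trans L * trans signGraph = trans L' :=
  trans_mul_trans (fun k => ⟨1, k, 1, k, one_mem L, Iff.rfl, by simp⟩) h

end BisetClass

/-- Together with `eq_of_mem_swapGroup`: the sign restricted to `swapGroup` is bijective, so
`swapGroup` is a complement of `rotGroup`. -/
theorem exists_mem_swapGroup (g : S3) : ∃ k ∈ swapGroup, (IsRot g ↔ IsRot k) := by
  have : ∀ g : S3, ∃ k : S3, k 2 = 2 ∧ (IsRot g ↔ IsRot k) := by decide +kernel
  exact this g

theorem eq_of_mem_swapGroup {g h : S3} (hg : g ∈ swapGroup) (hh : h ∈ swapGroup)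
    (hgh : IsRot g ↔ IsRot h) : g = h := by
  have : ∀ g h : S3, g 2 = 2 → h 2 = 2 → (IsRot g ↔ IsRot h) → g = h := by decide +kernel
  exact this g h hg hh hgh

theorem swapGroup_inf_rotGroup : swapGroup ⊓ rotGroup = ⊥ := by
  ext g
  rw [Subgroup.mem_inf, Subgroup.mem_bot]
  exact ⟨fun h => eq_of_mem_swapGroup h.1 (one_mem _) (iff_of_true h.2 isRot_one),
    fun h => h ▸ ⟨one_mem _, one_mem _⟩⟩

theorem exists_mul_eq (k : S3) : ∃ a ∈ swapGroup, ∃ b ∈ rotGroup, k = a * b := by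
  obtain ⟨a, ha, hk⟩ := exists_mem_swapGroup k
  exact ⟨a, ha, a⁻¹ * k, by rw [mem_rotGroup, isRot_mul, isRot_inv, hk], by simp⟩

theorem exists_mul_eq' (k : S3) : ∃ b ∈ rotGroup, ∃ a ∈ swapGroup, k = b * a := by
  obtain ⟨a, ha, hk⟩ := exists_mem_swapGroup k
  exact ⟨k * a⁻¹, by rw [mem_rotGroup, isRot_mul, isRot_inv, hk], a, ha, by simp⟩

/-! ### Products of the generators. -/

namespace BisetClass

theorem swap_mul_rot :
    trans (diagonal swapGroup) * trans (diagonal rotGroup) = trans (diagonal (⊥ : Subgroup S3)) := by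
  rw [diagonal_mul_diagonal exists_mul_eq, swapGroup_inf_rotGroup]

theorem rot_mul_swap :
    trans (diagonal rotGroup) * trans (diagonal swapGroup) = trans (diagonal (⊥ : Subgroup S3)) := by
  rw [diagonal_mul_diagonal exists_mul_eq', inf_comm, swapGroup_inf_rotGroup]

theorem diagonal_bot : diagonal (⊥ : Subgroup G) = (⊥ : Subgroup G).prod ⊥ := by
  ext ⟨g, h⟩
  rw [mem_diagonal, Subgroup.mem_prod, Subgroup.mem_bot, Subgroup.mem_bot]
  exact ⟨fun ⟨h1, h2⟩ => ⟨h2, h1 ▸ h2⟩, fun ⟨h1, h2⟩ => ⟨h1.trans h2.symm, h1⟩⟩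

/-- A subgroup of order two has two double cosets in `S₃`, those of `1` and of a three-cycle; the
three-cycle conjugates it to a subgroup with trivial intersection. -/
theorem swap_mul_swap :
    trans (diagonal swapGroup) * trans (diagonal swapGroup) =
      sum (trans (diagonal swapGroup)) (trans (diagonal (⊥ : Subgroup S3))) := by
  have h1 : ∀ k : S3, ∃ a b : S3, a 2 = 2 ∧ b 2 = 2 ∧ (k = a * b ∨ k = a * finRotate 3 * b) := by
    decide +kernel
  have h2 : ∀ a b : S3, a 2 = 2 → b 2 = 2 → finRotate 3 ≠ a * b := by decide +kernel
  have h3 : ∀ g h : S3, (g = h ∧ g = 1) ↔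
      ∃ k : S3, (g = k ∧ g 2 = 2) ∧ ((finRotate 3)⁻¹ * k * finRotate 3 = 1 * h * 1⁻¹ ∧
        ((finRotate 3)⁻¹ * k * finRotate 3) 2 = 2) := by decide +kernel
  refine trans_mul_trans_eq_sum (finRotate 3) 1 (fun k => ?_) (fun a b x y ha hb => ?_)
    (fun g h => ?_) fun g h => ?_
  · obtain ⟨a, b, ha, hb, hk⟩ := h1 k
    exact ⟨a, b, a, b, ⟨rfl, ha⟩, ⟨rfl, hb⟩, hk⟩
  · obtain ⟨rfl, ha1⟩ := mem_diagonal.1 ha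
    exact h2 x b ha1 hb.2
  · exact ⟨fun ⟨e, h⟩ => ⟨g, ⟨rfl, h⟩, e, h⟩, fun ⟨k, ⟨e, h⟩, e', _⟩ => ⟨e.trans e', h⟩⟩
  · rw [mem_diagonal, Subgroup.mem_bot, h3]
    rfl

/-- `rotGroup` is normal of index two, so both double cosets give the same intersection; the choice
`r = s⁻¹` undoes the conjugation by `s`. -/
theorem rot_mul_rot :
    trans (diagonal rotGroup) * trans (diagonal rotGroup) =
      sum (trans (diagonal rotGroup)) (trans (diagonal rotGroup)) := by
  let s : S3 := Equiv.swap 0 1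
  have hs : ¬ IsRot s := by decide
  refine trans_mul_trans_eq_sum s s⁻¹ (fun k => ?_) (fun a b x y ha hb he => ?_)
    (fun g h => ?_) fun g h => ?_
  · by_cases hk : IsRot k
    · exact ⟨k, 1, k, 1, ⟨rfl, hk⟩, one_mem _, Or.inl (mul_one k).symm⟩
    · refine ⟨1, s⁻¹ * k, 1, s⁻¹ * k, one_mem _, ⟨rfl, ?_⟩, Or.inr (by simp)⟩
      rw [mem_rotGroup, isRot_mul, isRot_inv]
      exact iff_of_false hs hk
  · obtain ⟨rfl, ha1⟩ := mem_diagonal.1 ha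
    have h1 : IsRot x := ha1
    exact hs (he ▸ (isRot_mul x b).2 (iff_of_true h1 hb.2))
  · exact ⟨fun ⟨e, h⟩ => ⟨g, ⟨rfl, h⟩, e, h⟩, fun ⟨k, ⟨e, h⟩, e', _⟩ => ⟨e.trans e', h⟩⟩
  · simp only [mem_diagonal, mem_rotGroup, isRot_mul, isRot_inv, inv_inv]
    constructor
    · rintro ⟨rfl, h⟩
      exact ⟨g, ⟨rfl, h⟩, rfl, by tauto⟩
    · rintro ⟨k, ⟨rfl, h⟩, e, -⟩
      exact ⟨by simpa using e, h⟩

theorem swap_mul_sign : trans (diagonal swapGroup) * trans signGraph =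
    trans (signGraph ⊓ swapGroup.prod ⊤) :=
  mul_signGraph fun g h => ⟨fun hh => ⟨g, ⟨rfl, hh.2.1⟩, hh.1⟩, by
    rintro ⟨k, hd, h2⟩
    obtain ⟨rfl, h1⟩ := mem_diagonal.1 hd
    exact ⟨h2, h1, trivial⟩⟩

theorem sign_mul_swap : trans signGraph * trans (diagonal swapGroup) =
    trans (signGraph ⊓ (⊤ : Subgroup S3).prod swapGroup) :=
  signGraph_mul fun g h => ⟨fun hh => ⟨h, hh.1, rfl, hh.2.2⟩, by
    rintro ⟨k, h1, hd⟩
    obtain ⟨rfl, h2⟩ := mem_diagonal.1 hd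
    exact ⟨h1, trivial, h2⟩⟩

theorem sign_mul_sign : trans signGraph * trans signGraph = trans signGraph :=
  signGraph_mul fun g _ => ⟨fun h => ⟨g, Iff.rfl, h⟩, fun ⟨_, h1, h2⟩ => h1.trans h2⟩

theorem swap_mul_sign_mul_swap : trans (diagonal swapGroup) * trans signGraph *
    trans (diagonal swapGroup) = trans (diagonal swapGroup) := by
  rw [swap_mul_sign]
  refine trans_mul_trans (fun k => ?_) fun g h => ⟨?_, ?_⟩
  · obtain ⟨x, hx, h⟩ := exists_mem_swapGroup k
    exact ⟨k, 1, x, 1, ⟨h.symm, hx, trivial⟩, one_mem _, (mul_one k).symm⟩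
  · intro hd
    obtain ⟨rfl, h⟩ := mem_diagonal.1 hd
    exact ⟨g, ⟨Iff.rfl, h, trivial⟩, rfl, h⟩
  · rintro ⟨k, ⟨h1, h2, -⟩, hd⟩
    obtain ⟨rfl, h3⟩ := mem_diagonal.1 hd
    exact ⟨eq_of_mem_swapGroup h2 h3 h1, h2⟩

theorem sign_mul_swap_mul_sign : trans signGraph * trans (diagonal swapGroup) *
    trans signGraph = trans signGraph := by
  rw [mul_assoc, swap_mul_sign]
  refine signGraph_mul fun g h => ⟨fun hh => ?_, fun ⟨k, h1, h2, _⟩ => h1.trans h2⟩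
  obtain ⟨k, hk, hgk⟩ := exists_mem_swapGroup g
  exact ⟨k, hgk, hgk.symm.trans hh, hk, trivial⟩

theorem sign_mul_rot : trans signGraph * trans (diagonal rotGroup) =
    trans (rotGroup.prod rotGroup) :=
  signGraph_mul fun g h => ⟨fun hh => ⟨h, iff_of_true hh.1 hh.2, rfl, hh.2⟩, by
    rintro ⟨k, h1, hd⟩
    obtain ⟨rfl, h2⟩ := mem_diagonal.1 hd
    exact ⟨h1.2 h2, h2⟩⟩

theorem rot_mul_sign : trans (diagonal rotGroup) * trans signGraph =
    trans (rotGroup.prod rotGroup) :=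
  mul_signGraph fun g h => ⟨fun hh => ⟨g, ⟨rfl, hh.1⟩, iff_of_true hh.1 hh.2⟩, by
    rintro ⟨k, hd, h2⟩
    obtain ⟨rfl, h1⟩ := mem_diagonal.1 hd
    exact ⟨h1, h2.1 h1⟩⟩

theorem sign_mul_prod {H K : Subgroup S3} (hH : ∀ g, ∃ k ∈ H, (IsRot g ↔ IsRot k)) :
    trans signGraph * trans (H.prod K) = trans ((⊤ : Subgroup S3).prod K) :=
  signGraph_mul fun g h => ⟨fun hh => by
    obtain ⟨k, hk, hgk⟩ := hH g
    exact ⟨k, hgk, hk, hh.2⟩, fun ⟨k, _, h2⟩ => ⟨trivial, h2.2⟩⟩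

theorem prod_mul_sign {H K : Subgroup S3} (hK : ∀ g, ∃ k ∈ K, (IsRot g ↔ IsRot k)) :
    trans (H.prod K) * trans signGraph = trans (H.prod ⊤) :=
  mul_signGraph fun g h => ⟨fun hh => by
    obtain ⟨k, hk, hgk⟩ := hK h
    exact ⟨k, ⟨hh.1, hk⟩, hgk.symm⟩, fun ⟨k, h1, _⟩ => ⟨h1.1, trivial⟩⟩

end BisetClass

variable (R : Type) [CommRing R]

open BisetClass

/-- The class of `(S₃ × S₃) / L` in the double Burnside algebra. -/
noncomputable def transClass [Finite G] (L : Subgroup (G × G)) : DoubleBurnside G R :=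
  burnsideClass R (trans L)

theorem transClass_mul [Finite G] {L L' L'' : Subgroup (G × G)} (h : trans L * trans L' = trans L'') :
    transClass R L * transClass R L' = transClass R L'' := by
  rw [transClass, transClass, ← burnsideClass_mul, h, transClass]

theorem transClass_mul_eq_add [Finite G] {L L' L₁ L₂ : Subgroup (G × G)}
    (h : trans L * trans L' = BisetClass.sum (trans L₁) (trans L₂)) :
    transClass R L * transClass R L' = transClass R L₁ + transClass R L₂ := by
  rw [transClass, transClass, ← burnsideClass_mul, h, burnsideClass_sum, transClass, transClass]

theorem transClass_mul_mul [Finite G] {L L' L'' M : Subgroup (G × G)}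
    (h : trans L * trans L' * trans L'' = trans M) :
    transClass R L * transClass R L' * transClass R L'' = transClass R M := by
  rw [transClass, transClass, transClass, ← burnsideClass_mul, ← burnsideClass_mul, h, transClass]

theorem one_eq_transClass [Finite G] : (1 : DoubleBurnside G R) = transClass R (diagonal ⊤) := by
  rw [transClass, ← one_eq_diagonal, burnsideClass_one]

theorem generatorRelations_transClass :
    GeneratorRelations (transClass R (diagonal swapGroup)) (transClass R signGraph)
      (transClass R (diagonal rotGroup))
      (transClass R ((⊤ : Subgroup S3).prod (⊤ : Subgroup S3))) := by
  have hac := transClass_mul R swap_mul_rot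
  have top (g : S3) : ∃ k ∈ (⊤ : Subgroup S3), (IsRot g ↔ IsRot k) := ⟨g, trivial, Iff.rfl⟩
  constructor
  · rw [hac]
    exact transClass_mul_eq_add R swap_mul_swap
  · exact transClass_mul R sign_mul_sign
  · exact transClass_mul_eq_add R rot_mul_rot
  · exact transClass_mul R prod_mul_prod
  · exact transClass_mul_mul R swap_mul_sign_mul_swap
  · exact transClass_mul_mul R sign_mul_swap_mul_sign
  · rw [hac]
    exact transClass_mul R rot_mul_swap
  · rw [hac, transClass_mul R diagonal_mul_prod, transClass_mul R prod_mul_diagonal, diagonal_bot]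
  · rw [transClass_mul R diagonal_mul_prod, transClass_mul R prod_mul_diagonal]
    exact transClass_mul R sign_mul_rot
  · rw [transClass_mul R diagonal_mul_prod, transClass_mul R prod_mul_diagonal]
    exact transClass_mul R rot_mul_sign
  · exact transClass_mul R (sign_mul_prod top)
  · exact transClass_mul R (prod_mul_sign top)
  · rw [mul_assoc, transClass_mul R diagonal_mul_prod]
    exact transClass_mul R (sign_mul_prod exists_mem_swapGroup)
  · rw [transClass_mul R prod_mul_diagonal]
    exact transClass_mul R (prod_mul_sign exists_mem_swapGroup)
  · rw [transClass_mul R prod_mul_diagonal]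
    exact transClass_mul R prod_mul_prod
  · rw [transClass_mul R prod_mul_diagonal]
    exact transClass_mul R prod_mul_prod
  · rw [hac, transClass_mul R prod_mul_diagonal]
    exact transClass_mul R prod_mul_prod

theorem outerWord_transClass (i : Fin 4) :
    outerWord (transClass R (diagonal swapGroup)) (transClass R (diagonal rotGroup)) i =
      transClass R (diagonal (sub i)) := by
  fin_cases i
  · exact one_eq_transClass R
  · rfl
  · rfl
  · exact transClass_mul R swap_mul_rot

/-- Through this, spanning becomes a classification of subgroups and independence a statement about
marks. -/
theorem word_transClass (i : WordIndex) :
    word (transClass R (diagonal swapGroup)) (transClass R signGraph)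
      (transClass R (diagonal rotGroup))
      (transClass R ((⊤ : Subgroup S3).prod (⊤ : Subgroup S3))) i = transClass R (wordGroup i) := by
  rcases i with ⟨i, j⟩ | k
  · change outerWord _ _ i * _ * outerWord _ _ j = transClass R ((sub i).prod (sub j))
    rw [outerWord_transClass, outerWord_transClass, transClass_mul R diagonal_mul_prod,
      transClass_mul R prod_mul_diagonal]
  · fin_cases k
    · exact one_eq_transClass R
    · rfl
    · rfl
    · exact transClass_mul R swap_mul_sign
    · exact transClass_mul R sign_mul_swap
    · rfl

end SymmetricGroup
end KraussS3

namespace KraussS3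

/-! ## The subgroups of `S₃ × S₃` up to conjugacy -/

section Classification

open BisetClass

/-- A transposition. -/
def s12 : S3 := Equiv.swap 0 1

/-- A three-cycle. -/
def cyc : S3 := finRotate 3

theorem not_isRot_s12 : ¬ IsRot s12 := by decide

theorem isRot_cyc : IsRot cyc := by decide

theorem eq_of_isRot : ∀ r : S3, IsRot r → r = 1 ∨ r = cyc ∨ r = cyc⁻¹ := by decide +kernel

/-- The conjugating element can be taken to be a rotation; it then commutes with `cyc`, so
conditions on `cyc` survive the conjugation. -/
theorem exists_conj_s12 : ∀ g : S3, ¬ IsRot g → ∃ x : S3, x⁻¹ * s12 * x = g ∧ x⁻¹ * cyc * x = cyc := by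
  decide +kernel

theorem mem_swapGroup_iff (g : S3) : g ∈ swapGroup ↔ g = 1 ∨ g = s12 := by
  have : ∀ g : S3, g 2 = 2 ↔ g = 1 ∨ g = s12 := by decide +kernel
  exact this g

theorem isRot_conj (x g : S3) : IsRot (x⁻¹ * g * x) ↔ IsRot g := by
  rw [isRot_mul, isRot_mul, isRot_inv]
  tauto

theorem isRot_mul_of_not {g h : S3} (hg : ¬ IsRot g) (hh : ¬ IsRot h) : IsRot (g * h) :=
  (isRot_mul g h).2 (iff_of_false hg hh)

theorem isRot_mul_inv_of_not {g h : S3} (hg : ¬ IsRot g) (hh : ¬ IsRot h) : IsRot (g * h⁻¹) :=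
  isRot_mul_of_not hg (by rwa [isRot_inv])

theorem eq_one_of_mul_self : ∀ g : S3, IsRot g → g * g = 1 → g = 1 := by decide +kernel

theorem isRot_iff_pow : ∀ g : S3, IsRot g ↔ g * g * g = 1 := by decide +kernel

/-- For a transposition `g` the equation says that `h` centralizes `g`, and the centralizer of `g`
is `{1, g}`. -/
theorem eq_of_mul_conj_eq_one : ∀ g h : S3, ¬ IsRot g → g * (h⁻¹ * g * h) = 1 → h = 1 ∨ h = g := by
  decide +kernel

/-! ### Subgroups of `S₃` up to conjugacy. -/

section Subgroup

variable {H : Subgroup S3}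

theorem mem_of_isRot (hH : cyc ∈ H) {r : S3} (hr : IsRot r) : r ∈ H := by
  rcases eq_of_isRot r hr with rfl | rfl | rfl
  exacts [one_mem H, hH, inv_mem hH]

theorem eq_one_of_isRot (hH : cyc ∉ H) {r : S3} (hr : IsRot r) (hrH : r ∈ H) : r = 1 := by
  rcases eq_of_isRot r hr with rfl | rfl | rfl
  exacts [rfl, absurd hrH hH, absurd ((inv_mem_iff (H := H)).1 hrH) hH]

/-- Up to conjugacy a subgroup is determined by whether it contains `cyc` and whether it contains an
odd element. -/
theorem exists_conj_sub (H : Subgroup S3) :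
    ∃ (i : Fin 4) (x : S3), ∀ g, g ∈ sub i ↔ x⁻¹ * g * x ∈ H := by
  by_cases hc : cyc ∈ H <;> by_cases hs : ∃ g ∈ H, ¬ IsRot g
  · obtain ⟨g₀, hg₀, h0⟩ := hs
    refine ⟨0, 1, fun g => iff_of_true trivial ?_⟩
    rw [inv_one, one_mul, mul_one]
    by_cases hg : IsRot g
    · exact mem_of_isRot hc hg
    · simpa using mul_mem (mem_of_isRot hc (isRot_mul_inv_of_not hg h0)) hg₀
  · push Not at hs
    refine ⟨2, 1, fun g => ?_⟩
    rw [inv_one, one_mul, mul_one]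
    exact ⟨fun hg => mem_of_isRot hc hg, hs g⟩
  · obtain ⟨g₀, hg₀, h0⟩ := hs
    obtain ⟨x, rfl, -⟩ := exists_conj_s12 g₀ h0
    refine ⟨1, x, fun g => (mem_swapGroup_iff g).trans ⟨?_, fun hg => ?_⟩⟩
    · rintro (rfl | rfl)
      · simp
      · exact hg₀
    · by_cases hr : IsRot g
      · left
        have := eq_one_of_isRot hc ((isRot_conj x g).2 hr) hg
        simpa [mul_assoc, mul_eq_one_iff_eq_inv] using this
      · right
        have := eq_one_of_isRot hc (isRot_mul_inv_of_not (by rwa [isRot_conj]) h0)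
          (mul_mem hg (inv_mem hg₀))
        rw [mul_inv_eq_one] at this
        simpa using this
  · push Not at hs
    refine ⟨3, 1, fun g => ?_⟩
    rw [inv_one, one_mul, mul_one]
    refine ⟨fun hg => ?_, fun hg => Subgroup.mem_bot.2 (eq_one_of_isRot hc (hs g hg) hg)⟩
    rw [Subgroup.mem_bot.1 hg]
    exact one_mem H

end Subgroup

/-! ### Subgroups of `S₃ × S₃` by their intersections with the factors, in the spirit of Goursat's
lemma. -/

variable {L : Subgroup (S3 × S3)}

/-- The hypothesis makes `L` the product of its intersections with the two factors, and each of
these can be conjugated separately. -/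
theorem exists_trans_eq_of_prod (hL : ∀ g h, (g, h) ∈ L → (g, 1) ∈ L) :
    ∃ i, trans L = trans (wordGroup i) := by
  obtain ⟨i, x, hx⟩ := exists_conj_sub (L.comap (MonoidHom.inl S3 S3))
  obtain ⟨j, y, hy⟩ := exists_conj_sub (L.comap (MonoidHom.inr S3 S3))
  refine ⟨Sum.inl (i, j), trans_eq_of_conj x y fun g h => ?_⟩
  change g ∈ sub i ∧ h ∈ sub j ↔ _
  rw [hx, hy]
  constructor
  · rintro ⟨h1, h2⟩
    have h3 := mul_mem (S := Subgroup (S3 × S3)) h1 h2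
    simpa using h3
  · intro h1
    have h2 := hL _ _ h1
    refine ⟨h2, ?_⟩
    have h3 := mul_mem (inv_mem h2) h1
    rwa [Prod.inv_mk, Prod.mk_mul_mk, inv_mul_cancel, inv_one, one_mul] at h3

/-- The conjugates of a subgroup of `S₃ × S₃`. -/
def conjGroup (L : Subgroup (S3 × S3)) (x y : S3) : Subgroup (S3 × S3) :=
  L.comap ((MulAut.conj x⁻¹).toMonoidHom.prodMap (MulAut.conj y⁻¹).toMonoidHom)

theorem mem_conjGroup {x y g h : S3} :
    (g, h) ∈ conjGroup L x y ↔ (x⁻¹ * g * x, y⁻¹ * h * y) ∈ L := by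
  simp [conjGroup]

theorem trans_conjGroup (x y : S3) : trans L = trans (conjGroup L x y) :=
  trans_eq_of_conj x y fun _ _ => mem_conjGroup

theorem mem_inl_of_isRot (h₁ : (cyc, 1) ∈ L) {r : S3} (hr : IsRot r) : (r, 1) ∈ L :=
  mem_of_isRot (H := L.comap (MonoidHom.inl S3 S3)) h₁ hr

theorem eq_one_of_mem_inr (h₂ : (1, cyc) ∉ L) {r : S3} (hr : IsRot r) (h : (1, r) ∈ L) : r = 1 :=
  eq_one_of_isRot (H := L.comap (MonoidHom.inr S3 S3)) h₂ hr h

theorem eq_one_of_mem_inl (h₂ : (cyc, 1) ∉ L) {r : S3} (hr : IsRot r) (h : (r, 1) ∈ L) : r = 1 :=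
  eq_one_of_isRot (H := L.comap (MonoidHom.inl S3 S3)) h₂ hr h

theorem mem_inr_of_isRot (h₁ : (1, cyc) ∈ L) {r : S3} (hr : IsRot r) : (1, r) ∈ L :=
  mem_of_isRot (H := L.comap (MonoidHom.inr S3 S3)) h₁ hr

/-- `L` contains all pairs of rotations, so it is the preimage of a subgroup of `C₂ × C₂`. That
subgroup contains a pair with odd first entry, but not (odd, even), so it is the diagonal. -/
theorem eq_signGraph (h₁ : (cyc, 1) ∈ L) (h₂ : (1, cyc) ∈ L) {g₀ h₀ : S3} (hgh : (g₀, h₀) ∈ L)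
    (hg : (g₀, 1) ∉ L) : L = signGraph := by
  have rr {g h : S3} (hg : IsRot g) (hh : IsRot h) : (g, h) ∈ L := by
    simpa using mul_mem (mem_inl_of_isRot h₁ hg) (mem_inr_of_isRot h₂ hh)
  have hg₀ : ¬ IsRot g₀ := fun h => hg (mem_inl_of_isRot h₁ h)
  have odd {g h : S3} (hg' : ¬ IsRot g) (hgh' : (g, h) ∈ L) : ¬ IsRot h := fun hh => hg <| by
    simpa using mul_mem (rr (isRot_mul_inv_of_not hg₀ hg') isRot_one)
      (mul_mem hgh' (inv_mem (rr isRot_one hh)))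
  have hh₀ := odd hg₀ hgh
  ext ⟨g, h⟩
  rw [mem_signGraph]
  constructor
  · intro H
    by_cases hgr : IsRot g
    · refine iff_of_true hgr ?_
      by_contra hh
      have h3 := mul_mem H hgh
      exact odd (fun h => hg₀ (((isRot_mul g g₀).1 h).1 hgr)) h3 (isRot_mul_of_not hh hh₀)
    · exact iff_of_false hgr (odd hgr H)
  · intro H
    by_cases hgr : IsRot g
    · exact rr hgr (H.1 hgr)
    · simpa using mul_mem (rr (isRot_mul_inv_of_not hgr hg₀)
        (isRot_mul_inv_of_not (fun hh => hgr (H.2 hh)) hh₀)) hgh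

/-- If `h` were a rotation, the square of `(g, h)` would put `(1, h * h)` into `L`, because `g * g`
is a rotation; then `h = 1` and `(g, 1) ∈ L`. -/
theorem not_isRot_of_mem (h₁ : (cyc, 1) ∈ L) (h₂ : (1, cyc) ∉ L) {g h : S3} (hgh : (g, h) ∈ L)
    (hg : (g, 1) ∉ L) : ¬ IsRot g ∧ ¬ IsRot h := by
  have hg' : ¬ IsRot g := fun h => hg (mem_inl_of_isRot h₁ h)
  refine ⟨hg', fun hh => hg ?_⟩
  have h3 := mul_mem (inv_mem (mem_inl_of_isRot h₁ (isRot_mul_of_not hg' hg'))) (mul_mem hgh hgh)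
  have h4 : h * h = 1 := eq_one_of_mem_inr h₂ ((isRot_mul h h).2 Iff.rfl) (by simpa using h3)
  rwa [eq_one_of_mul_self h hh h4] at hgh

/-- Since `L` contains no `(1, r)` with `r ≠ 1` a rotation, the second entry depends only on the
sign of the first: it is `1` for even and `s12` for odd elements. -/
theorem eq_signGraph_inf (h₁ : (cyc, 1) ∈ L) (h₂ : (1, cyc) ∉ L) {g₀ : S3} (hgh : (g₀, s12) ∈ L)
    (hg : (g₀, 1) ∉ L) : L = signGraph ⊓ (⊤ : Subgroup S3).prod swapGroup := by
  have hg₀ := (not_isRot_of_mem h₁ h₂ hgh hg).1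
  have hg1 {g : S3} (hg' : ¬ IsRot g) : (g, 1) ∉ L := fun h => hg <| by
    simpa using mul_mem (mem_inl_of_isRot h₁ (isRot_mul_inv_of_not hg₀ hg')) h
  ext ⟨g, h⟩
  rw [Subgroup.mem_inf, mem_signGraph, Subgroup.mem_prod]
  constructor
  · intro H
    by_cases hgr : IsRot g
    · have h3 : (1, h) ∈ L := by simpa using mul_mem (inv_mem (mem_inl_of_isRot h₁ hgr)) H
      have hh : IsRot h := by
        by_contra hh
        have h4 : (g₀, s12 * h) ∈ L := by simpa using mul_mem hgh h3
        exact (not_isRot_of_mem h₁ h₂ h4 hg).2 (isRot_mul_of_not not_isRot_s12 hh)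
      refine ⟨iff_of_true hgr hh, trivial, ?_⟩
      rw [eq_one_of_mem_inr h₂ hh h3]
      exact one_mem _
    · have hh := (not_isRot_of_mem h₁ h₂ H (hg1 hgr)).2
      refine ⟨iff_of_false hgr hh, trivial, (mem_swapGroup_iff h).2 (Or.inr ?_)⟩
      have h3 : (g * g₀⁻¹, h * s12⁻¹) ∈ L := by simpa using mul_mem H (inv_mem hgh)
      have h4 := mul_mem (inv_mem (mem_inl_of_isRot h₁ (isRot_mul_inv_of_not hgr hg₀))) h3
      exact mul_inv_eq_one.1 (eq_one_of_mem_inr h₂ (isRot_mul_inv_of_not hh not_isRot_s12)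
        (by simpa using h4))
  · rintro ⟨H, -, hh⟩
    rcases (mem_swapGroup_iff h).1 hh with rfl | rfl
    · exact mem_inl_of_isRot h₁ (H.2 isRot_one)
    · simpa using mul_mem
        (mem_inl_of_isRot h₁ (isRot_mul_inv_of_not (fun h => not_isRot_s12 (H.1 h)) hg₀)) hgh

theorem trans_eq_signGraph_inf (h₁ : (cyc, 1) ∈ L) (h₂ : (1, cyc) ∉ L) {g₀ h₀ : S3}
    (hgh : (g₀, h₀) ∈ L) (hg : (g₀, 1) ∉ L) :
    ∃ y, conjGroup L 1 y = signGraph ⊓ (⊤ : Subgroup S3).prod swapGroup := by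
  obtain ⟨y, rfl, hy⟩ := exists_conj_s12 h₀ (not_isRot_of_mem h₁ h₂ hgh hg).2
  refine ⟨y, eq_signGraph_inf (g₀ := g₀) ?_ ?_ ?_ ?_⟩ <;> rw [mem_conjGroup]
  · simpa using h₁
  · simpa [hy] using h₂
  · simpa using hgh
  · simpa using hg

/-- A subgroup that contains no elements `(g, 1)` and `(1, h)` except for `1`. -/
def IsGraph (L : Subgroup (S3 × S3)) : Prop :=
  (∀ g, (g, 1) ∈ L → g = 1) ∧ ∀ h, (1, h) ∈ L → h = 1

/-- An odd `g` with `(g, 1) ∈ L` yields the rotation `g * (g₀⁻¹ * g * g₀)` in the same intersection,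
which must be trivial. Then `g₀` centralizes `g`, so `g₀ ∈ {1, g}` and `(g₀, 1) ∈ L`. The other
factor is symmetric. -/
theorem isGraph_of_not_mem (h₁ : (cyc, 1) ∉ L) (h₂ : (1, cyc) ∉ L) {g₀ h₀ : S3}
    (hgh : (g₀, h₀) ∈ L) (hg : (g₀, 1) ∉ L) : IsGraph L := by
  constructor
  · intro g hgL
    by_contra hne
    have hr : ¬ IsRot g := fun hr => hne (eq_one_of_mem_inl h₁ hr hgL)
    have h3 : (g * (g₀⁻¹ * g * g₀), 1) ∈ L := by
      simpa using mul_mem hgL (mul_mem (mul_mem (inv_mem hgh) hgL) hgh)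
    rcases eq_of_mul_conj_eq_one g g₀ hr (eq_one_of_mem_inl h₁
      (isRot_mul_of_not hr (by rwa [isRot_conj])) h3) with rfl | rfl
    · exact hg (one_mem L)
    · exact hg hgL
  · intro h hhL
    by_contra hne
    have hr : ¬ IsRot h := fun hr => hne (eq_one_of_mem_inr h₂ hr hhL)
    have h3 : (1, h * (h₀⁻¹ * h * h₀)) ∈ L := by
      simpa using mul_mem hhL (mul_mem (mul_mem (inv_mem hgh) hhL) hgh)
    rcases eq_of_mul_conj_eq_one h h₀ hr (eq_one_of_mem_inr h₂
      (isRot_mul_of_not hr (by rwa [isRot_conj])) h3) with rfl | rfl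
    · exact hg hgh
    · exact hg (by simpa using mul_mem hgh (inv_mem hhL))

theorem IsGraph.conjGroup (hL : IsGraph L) (x y : S3) : IsGraph (conjGroup L x y) := by
  constructor
  · intro g hg
    rw [mem_conjGroup, mul_one, inv_mul_cancel] at hg
    simpa [mul_assoc, inv_mul_eq_one, eq_comm] using hL.1 _ hg
  · intro g hg
    rw [mem_conjGroup, mul_one, inv_mul_cancel] at hg
    simpa [mul_assoc, inv_mul_eq_one, eq_comm] using hL.2 _ hg

/-- `L` is the graph of an isomorphism between subgroups, and rotations are recognized by their
orders. -/
theorem IsGraph.isRot_iff (hL : IsGraph L) {g h : S3} (hgh : (g, h) ∈ L) : IsRot g ↔ IsRot h := by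
  have h3 : (g * g * g, h * h * h) ∈ L := mul_mem (mul_mem hgh hgh) hgh
  rw [isRot_iff_pow, isRot_iff_pow]
  exact ⟨fun e => hL.2 _ (e ▸ h3), fun e => hL.1 _ (e ▸ h3)⟩

theorem IsGraph.eq_diagonal (hL : IsGraph L) {H : Subgroup S3} (h₁ : ∀ g ∈ H, (g, g) ∈ L)
    (h₂ : ∀ g h, (g, h) ∈ L → g ∈ H) : L = diagonal H := by
  ext ⟨g, h⟩
  rw [mem_diagonal]
  constructor
  · intro hgh
    have hg := h₂ g h hgh
    exact ⟨inv_mul_eq_one.1 (hL.2 _ (by simpa using mul_mem (inv_mem (h₁ g hg)) hgh)), hg⟩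
  · rintro ⟨rfl, hg⟩
    exact h₁ g hg

theorem cyc_mem_diagonal (h : (cyc, cyc) ∈ L) {r : S3} (hr : IsRot r) : (r, r) ∈ L := by
  rcases eq_of_isRot r hr with rfl | rfl | rfl
  exacts [one_mem L, h, inv_mem h]

/-- Either `L` consists of rotations and is `diagonal rotGroup`, or conjugation by a rotation on the
right also matches a transposition with itself, which gives the full diagonal. -/
theorem IsGraph.exists_trans_eq_of_cyc (hL : IsGraph L) (hc : (cyc, cyc) ∈ L) :
    ∃ i, trans L = trans (wordGroup i) := by
  by_cases ho : ∃ g h, (g, h) ∈ L ∧ ¬ IsRot g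
  · obtain ⟨g, h, hgh, hg⟩ := ho
    have hr := isRot_mul_inv_of_not not_isRot_s12 hg
    have h3 : (s12, s12 * g⁻¹ * h) ∈ L := by
      simpa using mul_mem (cyc_mem_diagonal hc hr) hgh
    obtain ⟨y, hy, hyc⟩ := exists_conj_s12 _ ((hL.isRot_iff h3).not.1 not_isRot_s12)
    refine ⟨Sum.inr 0, (trans_conjGroup 1 y).trans (congrArg BisetClass.trans ?_)⟩
    have hs : (s12, s12) ∈ KraussS3.conjGroup L 1 y := by
      rw [mem_conjGroup, hy]
      simpa using h3
    have hc' : (cyc, cyc) ∈ KraussS3.conjGroup L 1 y := by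
      rw [mem_conjGroup, hyc]
      simpa using hc
    refine (hL.conjGroup 1 y).eq_diagonal (H := ⊤) (fun k _ => ?_) fun _ _ _ => trivial
    by_cases hk : IsRot k
    · exact cyc_mem_diagonal hc' hk
    · simpa using mul_mem (cyc_mem_diagonal hc' (isRot_mul_inv_of_not hk not_isRot_s12)) hs
  · push Not at ho
    exact ⟨Sum.inr 5, congrArg BisetClass.trans (hL.eq_diagonal (H := rotGroup)
      (fun g hg => cyc_mem_diagonal hc hg) ho)⟩

theorem IsGraph.exists_trans_eq (hL : IsGraph L) {g₀ h₀ : S3} (hgh : (g₀, h₀) ∈ L) (hg : g₀ ≠ 1) :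
    ∃ i, trans L = trans (wordGroup i) := by
  by_cases hr : ∃ g h, (g, h) ∈ L ∧ IsRot g ∧ g ≠ 1
  · obtain ⟨h, hh⟩ : ∃ h, (cyc, h) ∈ L := by
      obtain ⟨g, h, hgh, hg, hne⟩ := hr
      rcases eq_of_isRot g hg with rfl | rfl | rfl
      exacts [absurd rfl hne, ⟨h, hgh⟩, ⟨h⁻¹, by simpa using inv_mem hgh⟩]
    rcases eq_of_isRot h ((hL.isRot_iff hh).1 isRot_cyc) with rfl | rfl | rfl
    · exact absurd (hL.1 _ hh) (by decide)
    · exact hL.exists_trans_eq_of_cyc hh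
    -- Inversion of `cyc` is conjugation by a transposition, which reduces to the case of `(cyc,
    -- cyc) ∈ L`.
    · obtain ⟨i, hi⟩ := (hL.conjGroup 1 s12).exists_trans_eq_of_cyc (by
        rw [mem_conjGroup, show s12⁻¹ * cyc * s12 = cyc⁻¹ by decide]
        simpa using hh)
      exact ⟨i, (trans_conjGroup 1 s12).trans hi⟩
  -- Without nontrivial rotations any two odd elements agree, so the group has order two and is
  -- conjugate to `diagonal swapGroup`.
  · push Not at hr
    have hg₀ : ¬ IsRot g₀ := fun h => hg (hr g₀ h₀ hgh h)
    obtain ⟨x, hx, -⟩ := exists_conj_s12 g₀ hg₀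
    obtain ⟨y, hy, -⟩ := exists_conj_s12 h₀ ((hL.isRot_iff hgh).not.1 hg₀)
    have hs : (s12, s12) ∈ KraussS3.conjGroup L x y := by
      rw [mem_conjGroup, hx, hy]
      exact hgh
    have hr' {g h : S3} (hgL : (g, h) ∈ KraussS3.conjGroup L x y) (hg : IsRot g) : g = 1 := by
      have h3 := hr _ _ (mem_conjGroup.1 hgL) ((isRot_conj x g).2 hg)
      simpa [mul_assoc, inv_mul_eq_one, eq_comm] using h3
    refine ⟨Sum.inr 1, (trans_conjGroup x y).trans (congrArg BisetClass.trans
      ((hL.conjGroup x y).eq_diagonal (H := swapGroup) (fun g hg => ?_) fun g h hgL => ?_))⟩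
    · rcases (mem_swapGroup_iff g).1 hg with rfl | rfl
      exacts [one_mem _, hs]
    · rw [mem_swapGroup_iff]
      by_cases hg : IsRot g
      · exact Or.inl (hr' hgL hg)
      · have h3 := mul_mem hgL (inv_mem hs)
        rw [Prod.inv_mk, Prod.mk_mul_mk] at h3
        exact Or.inr (mul_inv_eq_one.1 (hr' h3 (isRot_mul_inv_of_not hg not_isRot_s12)))

/-- Every transitive biset is isomorphic to one of the `22` representatives. -/
theorem exists_trans_eq (L : Subgroup (S3 × S3)) : ∃ i, trans L = trans (wordGroup i) := by
  by_cases hL : ∀ g h, (g, h) ∈ L → (g, 1) ∈ L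
  · exact exists_trans_eq_of_prod hL
  push Not at hL
  obtain ⟨g₀, h₀, hgh, hg⟩ := hL
  by_cases h₁ : (cyc, 1) ∈ L <;> by_cases h₂ : (1, cyc) ∈ L
  · exact ⟨Sum.inr 2, congrArg BisetClass.trans (eq_signGraph h₁ h₂ hgh hg)⟩
  · obtain ⟨y, hy⟩ := trans_eq_signGraph_inf h₁ h₂ hgh hg
    exact ⟨Sum.inr 4, (trans_conjGroup 1 y).trans (congrArg BisetClass.trans hy)⟩
  -- Exchanging the two factors reduces this case to the previous one.
  · obtain ⟨x, hx⟩ := trans_eq_signGraph_inf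
      (L := L.comap (MulEquiv.prodComm (M := S3) (N := S3)).toMonoidHom) (g₀ := h₀) (h₀ := g₀) h₂ h₁ hgh
      (fun h => hg (by simpa using mul_mem hgh (inv_mem (show ((1, h₀) : S3 × S3) ∈ L from h))))
    refine ⟨Sum.inr 3, (trans_conjGroup x 1).trans (congrArg BisetClass.trans ?_)⟩
    ext ⟨g, h⟩
    have h3 := SetLike.ext_iff.1 hx (h, g)
    rw [mem_conjGroup] at h3 ⊢
    refine Iff.trans h3 ?_
    change (IsRot h ↔ IsRot g) ∧ True ∧ g ∈ swapGroup ↔ (IsRot g ↔ IsRot h) ∧ g ∈ swapGroup ∧ True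
    tauto
  · exact (isGraph_of_not_mem h₁ h₂ hgh hg).exists_trans_eq hgh fun h => hg (by rw [h]; exact one_mem L)

end Classification

/-! ## The words form a basis of the double Burnside algebra -/

section BurnsideBasis

open BisetClass

/-- The orders of the representatives of the conjugacy classes of subgroups of `S₃`. -/
def subCard : Fin 4 → ℕ := ![6, 2, 3, 1]

/-- The orders of the images of `wordGroup i` in the two factors and the order of `wordGroup i`. -/
def wordCard : WordIndex → ℕ × ℕ × ℕ :=
  Sum.elim (fun ij => (subCard ij.1, subCard ij.2, subCard ij.1 * subCard ij.2))
    ![(6, 6, 6), (2, 2, 2), (6, 6, 18), (2, 6, 6), (6, 2, 6), (3, 3, 3)]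

/-- The membership test for `sub i`. -/
def subTest : Fin 4 → S3 → Bool :=
  ![fun _ => true, fun g => g 2 == 2, fun g => decide (IsRot g), fun g => g == 1]

/-- The membership test for `wordGroup i`. -/
def wordTest : WordIndex → S3 → S3 → Bool :=
  Sum.elim (fun ij g h => subTest ij.1 g && subTest ij.2 h)
    ![fun g h => g == h, fun g h => g == h && g 2 == 2,
      fun g h => decide (IsRot g ↔ IsRot h),
      fun g h => decide (IsRot g ↔ IsRot h) && g 2 == 2,
      fun g h => decide (IsRot g ↔ IsRot h) && h 2 == 2,
      fun g h => g == h && decide (IsRot g)]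

theorem mem_sub_iff (i : Fin 4) (g : S3) : g ∈ sub i ↔ subTest i g = true := by
  fin_cases i
  · exact iff_of_true trivial rfl
  · exact mem_swapGroup.trans beq_iff_eq.symm
  · exact mem_rotGroup.trans decide_eq_true_iff.symm
  · exact Subgroup.mem_bot.trans beq_iff_eq.symm

theorem mem_wordGroup_iff (i : WordIndex) (g h : S3) :
    (g, h) ∈ wordGroup i ↔ wordTest i g h = true := by
  rcases i with ⟨i, j⟩ | k
  · refine (and_congr (mem_sub_iff i g) (mem_sub_iff j h)).trans ?_
    exact (Bool.and_eq_true_iff).symm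
  · fin_cases k <;>
      simp [wordGroup, wordTest, mem_diagonal, mem_signGraph, Subgroup.mem_prod, mem_swapGroup,
        mem_rotGroup, -Bool.decide_iff_dist]

theorem card_wordGroup (i : WordIndex) : Nat.card (wordGroup i) = (wordCard i).2.2 := by
  have h1 : Nat.card (wordGroup i) =
      (Finset.univ.filter fun x : S3 × S3 => wordTest i x.1 x.2 = true).card := by
    rw [← Fintype.card_subtype, ← Nat.card_eq_fintype_card]
    exact Nat.card_congr (Equiv.subtypeEquivRight fun x => mem_wordGroup_iff i x.1 x.2)
  rw [h1]
  clear h1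
  revert i
  decide +kernel

theorem card_map_fst_wordGroup (i : WordIndex) :
    Nat.card ((wordGroup i).map (MonoidHom.fst S3 S3)) = (wordCard i).1 := by
  have h1 : Nat.card ((wordGroup i).map (MonoidHom.fst S3 S3)) =
      (Finset.univ.filter fun g : S3 => ∃ h, wordTest i g h = true).card := by
    rw [← Fintype.card_subtype, ← Nat.card_eq_fintype_card]
    refine Nat.card_congr (Equiv.subtypeEquivRight fun g => ?_)
    simp [Subgroup.mem_map, mem_wordGroup_iff]
  rw [h1]
  clear h1
  revert i
  decide +kernel

theorem card_map_snd_wordGroup (i : WordIndex) :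
    Nat.card ((wordGroup i).map (MonoidHom.snd S3 S3)) = (wordCard i).2.1 := by
  have h1 : Nat.card ((wordGroup i).map (MonoidHom.snd S3 S3)) =
      (Finset.univ.filter fun h : S3 => ∃ g, wordTest i g h = true).card := by
    rw [← Fintype.card_subtype, ← Nat.card_eq_fintype_card]
    refine Nat.card_congr (Equiv.subtypeEquivRight fun g => ?_)
    simp [Subgroup.mem_map, mem_wordGroup_iff]
  rw [h1]
  clear h1
  revert i
  decide +kernel

/-- The three orders together separate the 22 representatives, so their sum is strictly monotone.
The order of the group alone would not do: several representatives have order 6. -/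
theorem eq_or_lt_of_wordCard_le : ∀ i j : WordIndex, (wordCard i).1 ≤ (wordCard j).1 ∧
    (wordCard i).2.1 ≤ (wordCard j).2.1 ∧ (wordCard i).2.2 ≤ (wordCard j).2.2 →
    i = j ∨ (wordCard i).1 + (wordCard i).2.1 + (wordCard i).2.2 <
      (wordCard j).1 + (wordCard j).2.1 + (wordCard j).2.2 := by
  decide +kernel

theorem card_le_of_conj {G : Type} [Group G] [Finite G] {H K : Subgroup G} (x : G)
    (h : ∀ g ∈ H, x⁻¹ * g * x ∈ K) : Nat.card H ≤ Nat.card K :=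
  Nat.card_le_card_of_injective (fun g : H => (⟨x⁻¹ * g.1 * x, h g.1 g.2⟩ : K)) fun g k hgk =>
    Subtype.ext (by simpa using congrArg Subtype.val hgk)

theorem eq_or_lt_of_conj_le (i j : WordIndex) (x y : S3)
    (h : ∀ g k, (g, k) ∈ wordGroup i → (x⁻¹ * g * x, y⁻¹ * k * y) ∈ wordGroup j) :
    i = j ∨ (wordCard i).1 + (wordCard i).2.1 + (wordCard i).2.2 <
      (wordCard j).1 + (wordCard j).2.1 + (wordCard j).2.2 := by
  refine eq_or_lt_of_wordCard_le i j ⟨?_, ?_, ?_⟩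
  · rw [← card_map_fst_wordGroup, ← card_map_fst_wordGroup]
    refine card_le_of_conj x ?_
    rintro _ ⟨⟨g, k⟩, hgk, rfl⟩
    exact ⟨_, h g k hgk, rfl⟩
  · rw [← card_map_snd_wordGroup, ← card_map_snd_wordGroup]
    refine card_le_of_conj y ?_
    rintro _ ⟨⟨g, k⟩, hgk, rfl⟩
    exact ⟨_, h g k hgk, rfl⟩
  · rw [← card_wordGroup, ← card_wordGroup]
    exact card_le_of_conj (x, y) fun g hg => h g.1 g.2 hg

variable (R : Type) [CommRing R]

/-- Spanning is the classification of subgroups up to conjugacy; independence is triangularity of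
the marks with respect to the sum of the three orders. -/
theorem wordBasis_transClass [IsDomain R] [CharZero R] :
    WordBasis R (transClass R (diagonal swapGroup)) (transClass R signGraph)
      (transClass R (diagonal rotGroup))
      (transClass R ((⊤ : Subgroup S3).prod (⊤ : Subgroup S3))) where
  toGeneratorRelations := generatorRelations_transClass R
  span := by
    rw [eq_top_iff, ← span_burnsideClass_trans, Submodule.span_le]
    rintro _ ⟨L, rfl⟩
    obtain ⟨i, hi⟩ := exists_trans_eq L
    refine Submodule.subset_span ⟨i, ?_⟩
    rw [word_transClass, transClass, ← hi]
  indep r hr := by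
    simp only [word_transClass] at hr
    exact sum_burnsideClass_trans_eq_zero R wordGroup
      (fun i => (wordCard i).1 + (wordCard i).2.1 + (wordCard i).2.2) eq_or_lt_of_conj_le r hr

end BurnsideBasis
end KraussS3

namespace KraussS3

/-! ## The ring `ℤ_(3)` -/

section Localization

instance : IsDomain Z3 :=
  IsLocalization.isDomain_of_atPrime Z3 (Ideal.span {(3 : ℤ)})

instance : CharZero Z3 :=
  charZero_of_injective_algebraMap (R := ℤ)
    (IsLocalization.injective Z3 
      (Ideal.primeCompl_le_nonZeroDivisors (Ideal.span {(3 : ℤ)})))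

theorem three_ne_zero_Z3 : (3 : Z3) ≠ 0 := by
  have h := (Nat.cast_ne_zero (R := Z3)).2 (by decide : (3 : ℕ) ≠ 0)
  rwa [Nat.cast_ofNat] at h

theorem exists_two_mul_eq_one : ∃ h : Z3, 2 * h = 1 := by
  have h2 : (2 : ℤ) ∈ (Ideal.span {(3 : ℤ)}).primeCompl := fun h => by
    have := Ideal.mem_span_singleton.1 h
    omega
  obtain ⟨u, hu⟩ := IsLocalization.map_units Z3 (⟨2, h2⟩ : (Ideal.span {(3 : ℤ)}).primeCompl)
  refine ⟨(u⁻¹ : Z3ˣ), ?_⟩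
  have h3 := u.mul_inv
  rw [hu] at h3
  simpa using h3

end Localization

/-- The double Burnside algebra of `S₃` over `ℤ_(3)` is isomorphic to `Λ_(3)`. -/
theorem nonempty_doubleBurnside_algEquiv : Nonempty (DoubleBurnside S3 Z3 ≃ₐ[Z3] Lambda3 Z3) := by
  obtain ⟨h, hh⟩ := exists_two_mul_eq_one
  exact nonempty_algEquiv_of_wordBasis Z3 (wordBasis_transClass Z3)
    (Lambda3.wordBasis three_ne_zero_Z3 hh)

end KraussS3
theorem proposition5p10 :
    (∃ φ : CornerLambda3 Z3 ≃ₐ[Z3] PsiAlgebra Z3,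
      (∀ i : PsiVertex, φ (CornerLambda3.e Z3 i) = psiE Z3 i) ∧
      (∀ (i j : PsiVertex) (α : PsiArrow i j), φ (CornerLambda3.tau Z3 α) = psiTau Z3 α)) ∧
    Nonempty (DoubleBurnside (Equiv.Perm (Fin 3)) Z3 ≃ₐ[Z3] Lambda3 Z3) ∧
    IsMoritaEquivalent Z3 (DoubleBurnside (Equiv.Perm (Fin 3)) Z3) (CornerLambda3 Z3) ∧
    IsMoritaEquivalent Z3 (DoubleBurnside (Equiv.Perm (Fin 3)) Z3) (PsiAlgebra Z3) := by
  obtain ⟨φ⟩ := nonempty_doubleBurnside_algEquiv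
  obtain ⟨x, y, hxy⟩ := cornerIdem_full (R := Z3)
  refine ⟨⟨(psiEquivCorner three_ne_zero_Z3).symm, fun i => ?_, fun i j α => ?_⟩, ⟨φ⟩,
    isMoritaEquivalent_of_corner (cornerIdem_isIdempotentElem Z3) Z3 hxy φ AlgEquiv.refl,
    isMoritaEquivalent_of_corner (cornerIdem_isIdempotentElem Z3) Z3 hxy φ (psiEquivCorner three_ne_zero_Z3)⟩
  · rw [AlgEquiv.symm_apply_eq]
    exact (psiToCorner_psiE Z3 i).symm
  · rw [AlgEquiv.symm_apply_eq]
    exact (psiToCorner_psiTau Z3 α).symm
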